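/- Let $a,\phi,\eta,b,T>0$ with $$b<\exp\Big(-2T\,\frac{a\vee\sqrt{\eta\phi}}{\eta}\Big)\cdot\frac{\eta^2a^{-1}\wedge\eta^{3/2}\phi^{-1/2}\wedge\eta}{T^2+T}.$$ **Coefficients.** The Riccati equation $\gamma_t'=2\big(\phi-\tfrac{a^2}{\eta}\big)+\tfrac{2a}{\eta}\gamma_t-\tfrac1{2\eta}\gamma_t^2$, $\gamma_T=0$, has a unique solution on $[0,T]$. Put $\Gamma_{s,t}=\exp\big(\int_s^t\frac{\gamma_r-2a}{2\eta}dr\big)$, $z_t=\frac{\gamma_t-2a}{2\eta}\Gamma_{0,t}$, $$A_{r,s,t}=\tfrac{\gamma_t-2a}{4\eta^2}\Gamma_{s,r}\Gamma_{s,t},\quad B_{s,t}=\tfrac1{2\eta}\Gamma_{t,s},\quad C_{s,t}=\tfrac{\gamma_t-2a}{4\eta^2}\Gamma_{s,t}\int_s^T\Gamma_{s,r}dr,\quad D_t=\tfrac1{2\eta}\int_t^T\Gamma_{t,s}ds.$$ For deterministic $\xi$ let $L\xi_t=\int_0^t\int_s^TA_{r,s,t}\xi_r\,dr\,ds+\int_t^TB_{s,t}\xi_s\,ds$.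 For functions $E=E_{s,t}$, $F=F_t$ let $\hat L[E,F]=(\hat L_1[E,F],\hat L_2[E,F])$ with $$\hat L_1[E,F]_{s,t}=\int_s^t\!\int_u^T\!A_{r,u,t}E_{s,r}\,dr\,du+\int_s^T\!A_{r,s,t}\Big(\int_s^r\!E_{u,r}du+F_r\Big)dr+\int_t^T\!B_{u,t}E_{s,u}\,du,$$ $$\hat L_2[E,F]_t=\int_t^TB_{s,t}\Big(\int_t^sE_{u,s}du+F_s\Big)ds.$$ The series $(I-bL)^{-1}z:=\sum_kb^kL^kz$ and $\sum_kb^k\hat L_1^k[C,D]$, $\sum_kb^k\hat L_2^k[C,D]$ converge pointwise on $[0,T]$, resp. $[0,T]^2$, $[0,T]$; the function $y=(I-bL)^{-1}z$ is continuous on $[0,T]$ and satisfies $y-bLy=z$. Here $\hat L_i^k[C,D]$ is the $i$-th component of the $k$-th iterate $\hat L^k[C,D]$. Put $$\beta^1_s=b\int_s^T\Gamma_{s,r}\big((I-bL)^{-1}z\big)_rdr,\qquad \beta^2_{u,s}=b\int_s^T\Gamma_{s,r}\sum_{k\ge0}b^k\hat L_1^k[C,D]_{u,r}\,dr,$$ $$\beta^3_s=\int_s^T\Gamma_{s,r}\Big[1+\sum_{k\ge0}b^{k+1}\Big(\int_s^r\hat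 L_1^k[C,D]_{u,r}du+\hat L_2^k[C,D]_r\Big)\Big]dr,$$ $$\bar A_t=\tfrac{\beta^1_t}{2\eta}+\tfrac{\gamma_t-2a}{4\eta^2}\int_0^t\Gamma_{s,t}\beta^1_sds,\qquad \bar B_t=\tfrac{\gamma_t-2a}{2\eta}\Gamma_{0,t},\qquad \bar D_t=\tfrac{\beta^3_t}{2\eta},$$ $$\bar C_{s,t}=\tfrac{\gamma_t-2a}{4\eta^2}\Big(\int_s^t\Gamma_{r,t}\beta^2_{s,r}dr+\Gamma_{s,t}\beta^3_s\Big)+\tfrac{\beta^2_{s,t}}{2\eta}.$$ Then $\bar A,\bar B,\bar D$ are real analytic on $[0,T]$ and $\bar C$ is real analytic on $[0,T]^2$. **Game.** Let $(\mathcal F_t)_{t\in[0,T]}$ be a filtration (the information disclosed by the broker) on a probability space, let $Q_0$ and $\mu$ be square integrable random variables with $Q_0$ independent of $\mathcal F_T\vee\sigma(\mu)$, and let $(\mu_t)$ be a progressively measurable martingale with $\mu_t=\mathbb E[\mu|\mathcal F_t]$ a.s. for every $t\in[0,T]$ (with $\mu=\mu_T$ this covers every square integrable, progressively measurable martingale when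 $Q_0$ is independent of $\mathcal F_T$). Put $\bar Q_0=\mathbb E[Q_0]$ and $\mathcal F^r_t=\mathcal F_t\vee\sigma(Q_0)$. Let $\mathcal A^r$ be the set of $\mathcal F^r$-progressively measurable $\nu$ with $\mathbb E\int_0^T\nu_t^2dt<\infty$. An *equilibrium* is a pair $(\nu,m)$ of some $\nu\in\mathcal A^r$ and an $\mathcal F^r$-progressively measurable process $m$ of probability measures on $\mathbb R$ with finite second moment such that, with $\bar\nu_t=\int x\,m_t(dx)$, the control $\nu$ maximizes over $\mathcal A^r$ $$\mathbb E\int_0^T\big\{Q_t(b\bar\nu_t+\mu)-\eta\nu_t^2-2aQ_t\nu_t-\phi Q_t^2\big\}dt,\qquad Q_t=Q_0+\int_0^t\nu_udu,$$ and $m_t$ is the conditional law of $\nu_t$ given $\mathcal F_t$ for a.e. $t\in[0,T]$. **Claim.** An equilibrium exists and is unique (up to equality a.s. for a.e. $t$), and its control is $$\hat\nu_t=\bar A_t\bar Q_0+\bar B_tQ_0+X_t,\qquad X_t=\int_0^t\bar C_{s,t}\mu_sds+\bar D_t\mu_t .$$ For every $t\in[0,T]$, $\hat\nu_t$ is square integrable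 and, a.s., $$\mathbb E[\hat\nu_t|\mathcal F_t]=(\bar A_t+\bar B_t)\bar Q_0+X_t,$$ $$\mathbb E[\hat\nu_t^2|\mathcal F_t]=(\bar A_t^2+2\bar A_t\bar B_t)\bar Q_0^2+\bar B_t^2\,\mathbb E[Q_0^2]+2(\bar A_t+\bar B_t)X_t\bar Q_0+X_t^2 ;$$ at equilibrium $\bar\nu_t=\mathbb E[\hat\nu_t|\mathcal F_t]$ a.s. for a.e. $t$. -/

import Mathlib

open MeasureTheory ProbabilityTheory

noncomputable section

/-- The constants of the traders' problem: the risk aversions `a`, `φ`, the transaction cost `η`,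
the permanent impact `b` and the horizon `T`. -/
structure TraderParams where
  a : ℝ
  φ : ℝ
  η : ℝ
  b : ℝ
  T : ℝ

namespace TraderParams

/-- The time interval `[0, T]`, used as the index set of all processes. -/
abbrev Time (p : TraderParams) : Type := Set.Icc (0 : ℝ) p.T

/-- Lebesgue measure on `[0, T]`. -/
def timeMeasure (p : TraderParams) : Measure p.Time :=
  (volume : Measure ℝ).comap (Subtype.val : p.Time → ℝ)

/-! ### Deterministic coefficients -/

/-- `γ' = 2 (φ - a² / η) + (2 a / η) γ - γ² / (2 η)` on `[0, T]`, with `γ T = 0`. -/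
structure IsRiccatiSolution (p : TraderParams) (γ : ℝ → ℝ) : Prop where
  terminal : γ p.T = 0
  deriv : ∀ t ∈ Set.Icc (0 : ℝ) p.T,
    HasDerivWithinAt γ
      (2 * (p.φ - p.a ^ 2 / p.η) + 2 * (p.a / p.η) * γ t - γ t ^ 2 / (2 * p.η))
      (Set.Icc (0 : ℝ) p.T) t

/-- `Γ_{s,t} = exp (∫_s^t (γ_r - 2a) / (2η) dr)`. -/
def Gam (p : TraderParams) (γ : ℝ → ℝ) (s t : ℝ) : ℝ :=
  Real.exp (∫ r in s..t, (γ r - 2 * p.a) / (2 * p.η))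

/-- `z_t = (γ_t - 2a) / (2η) * Γ_{0,t}`. -/
def zCoef (p : TraderParams) (γ : ℝ → ℝ) (t : ℝ) : ℝ :=
  (γ t - 2 * p.a) / (2 * p.η) * p.Gam γ 0 t

/-- `A_{r,s,t} = (γ_t - 2a) / (4η²) * Γ_{s,r} * Γ_{s,t}`. -/
def kerA (p : TraderParams) (γ : ℝ → ℝ) (r s t : ℝ) : ℝ :=
  (γ t - 2 * p.a) / (4 * p.η ^ 2) * p.Gam γ s r * p.Gam γ s t

/-- `B_{s,t} = Γ_{t,s} / (2η)`. -/
def kerB (p : TraderParams) (γ : ℝ → ℝ) (s t : ℝ) : ℝ :=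
  1 / (2 * p.η) * p.Gam γ t s

/-- `C_{s,t} = (γ_t - 2a) / (4η²) * Γ_{s,t} * ∫_s^T Γ_{s,r} dr`. -/
def kerC (p : TraderParams) (γ : ℝ → ℝ) (s t : ℝ) : ℝ :=
  (γ t - 2 * p.a) / (4 * p.η ^ 2) * p.Gam γ s t * ∫ r in s..p.T, p.Gam γ s r

/-- `D_t = (1 / (2η)) * ∫_t^T Γ_{t,s} ds`. -/
def kerD (p : TraderParams) (γ : ℝ → ℝ) (t : ℝ) : ℝ :=
  1 / (2 * p.η) * ∫ s in t..p.T, p.Gam γ t s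

/-- The operator `L ξ_t = ∫_0^t ∫_s^T A_{r,s,t} E[ξ_r | F_s] dr ds + ∫_t^T B_{s,t} E[ξ_s | F_t] ds`
on deterministic functions, for which the conditional expectations disappear. -/
def opL (p : TraderParams) (γ : ℝ → ℝ) (ξ : ℝ → ℝ) (t : ℝ) : ℝ :=
  (∫ s in (0 : ℝ)..t, ∫ r in s..p.T, p.kerA γ r s t * ξ r) +
    ∫ s in t..p.T, p.kerB γ s t * ξ s

/-- `(I - b L)⁻¹ z`, as the Neumann series `∑ b^k L^k z`. -/
def resolventZ (p : TraderParams) (γ : ℝ → ℝ) (t : ℝ) : ℝ :=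
  ∑' k : ℕ, p.b ^ k * ((p.opL γ)^[k] (p.zCoef γ)) t

/-- The operator `L̂` on pairs `(E, F)`: it satisfies `L ∘ L̃^{E,F} = L̃^{L̂[E,F]}` on martingales,
where `L̃^{E,F} μ_t = ∫_0^t E_{s,t} μ_s ds + F_t μ_t`. -/
def opLhat (p : TraderParams) (γ : ℝ → ℝ) (EF : (ℝ → ℝ → ℝ) × (ℝ → ℝ)) :
    (ℝ → ℝ → ℝ) × (ℝ → ℝ) :=
  (fun s t =>
      (∫ u in s..t, ∫ r in u..p.T, p.kerA γ r u t * EF.1 s r) +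
      (∫ r in s..p.T, p.kerA γ r s t * ((∫ u in s..r, EF.1 u r) + EF.2 r)) +
      ∫ u in t..p.T, p.kerB γ u t * EF.1 s u,
   fun t => ∫ s in t..p.T, p.kerB γ s t * ((∫ u in t..s, EF.1 u s) + EF.2 s))

/-- `L̂₁^k [C, D]_{s,t}`. -/
def LhatIter₁ (p : TraderParams) (γ : ℝ → ℝ) (k : ℕ) (s t : ℝ) : ℝ :=
  ((p.opLhat γ)^[k] (p.kerC γ, p.kerD γ)).1 s t

/-- `L̂₂^k [C, D]_t`. -/
def LhatIter₂ (p : TraderParams) (γ : ℝ → ℝ) (k : ℕ) (t : ℝ) : ℝ :=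
  ((p.opLhat γ)^[k] (p.kerC γ, p.kerD γ)).2 t

/-- `β¹_s = b ∫_s^T Γ_{s,r} ((I - bL)⁻¹ z)_r dr`. -/
def beta₁ (p : TraderParams) (γ : ℝ → ℝ) (s : ℝ) : ℝ :=
  p.b * ∫ r in s..p.T, p.Gam γ s r * p.resolventZ γ r

/-- `β²_{u,s} = b ∫_s^T Γ_{s,r} ∑_k b^k L̂₁^k[C,D]_{u,r} dr`. -/
def beta₂ (p : TraderParams) (γ : ℝ → ℝ) (u s : ℝ) : ℝ :=
  p.b * ∫ r in s..p.T, p.Gam γ s r * ∑' k : ℕ, p.b ^ k * p.LhatIter₁ γ k u r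

/-- `β³_s = ∫_s^T Γ_{s,r} (1 + ∑_k b^(k+1) (∫_s^r L̂₁^k[C,D]_{u,r} du + L̂₂^k[C,D]_r)) dr`. -/
def beta₃ (p : TraderParams) (γ : ℝ → ℝ) (s : ℝ) : ℝ :=
  ∫ r in s..p.T, p.Gam γ s r *
    (1 + ∑' k : ℕ, p.b ^ (k + 1) * ((∫ u in s..r, p.LhatIter₁ γ k u r) + p.LhatIter₂ γ k r))

/-- The coefficient `Ā`. -/
def Abar (p : TraderParams) (γ : ℝ → ℝ) (t : ℝ) : ℝ :=
  p.beta₁ γ t / (2 * p.η) +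
    (γ t - 2 * p.a) / (4 * p.η ^ 2) * ∫ s in (0 : ℝ)..t, p.Gam γ s t * p.beta₁ γ s

/-- The coefficient `B̄`. -/
def Bbar (p : TraderParams) (γ : ℝ → ℝ) (t : ℝ) : ℝ :=
  (γ t - 2 * p.a) / (2 * p.η) * p.Gam γ 0 t

/-- The coefficient `C̄`. -/
def Cbar (p : TraderParams) (γ : ℝ → ℝ) (s t : ℝ) : ℝ :=
  (γ t - 2 * p.a) / (4 * p.η ^ 2) *
      ((∫ r in s..t, p.Gam γ r t * p.beta₂ γ s r) + p.Gam γ s t * p.beta₃ γ s) +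
    p.beta₂ γ s t / (2 * p.η)

/-- The coefficient `D̄`. -/
def Dbar (p : TraderParams) (γ : ℝ → ℝ) (t : ℝ) : ℝ :=
  p.beta₃ γ t / (2 * p.η)

/-! ### The mean field game of the traders -/

section Game

variable {Ω : Type*} {mΩ : MeasurableSpace Ω} (p : TraderParams)

/-- The information of the representative trader: `F^r_t = F_t ∨ σ(Q₀)`. -/
def traderFiltration (F : Filtration p.Time mΩ) (Q₀ : Ω → ℝ) (hQ₀ : Measurable Q₀) :
    Filtration p.Time mΩ :=
  F ⊔ Filtration.const p.Time (MeasurableSpace.comap Q₀ inferInstance) hQ₀.comap_le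

/-- The admissible controls: `F^r`-progressively measurable, with `E ∫_0^T ν_t² dt < ∞`. -/
structure IsAdmissible (P : Measure Ω) (F : Filtration p.Time mΩ) (Q₀ : Ω → ℝ)
    (hQ₀ : Measurable Q₀) (ν : p.Time → Ω → ℝ) : Prop where
  progressive : IsProgressive (p.traderFiltration F Q₀ hQ₀) ν
  memLp : MemLp (fun q : p.Time × Ω => ν q.1 q.2) 2 (p.timeMeasure.prod P)

/-- `Q_t = Q₀ + ∫_0^t ν_u du`. -/
def inventory (Q₀ : Ω → ℝ) (ν : p.Time → Ω → ℝ) (t : p.Time) (ω : Ω) : ℝ :=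
  Q₀ ω + ∫ u in Set.Iic t, ν u ω ∂p.timeMeasure

/-- `ν̄_t = ∫ x m_t(dx)`. -/
def meanRate (m : p.Time → Ω → Measure ℝ) (t : p.Time) (ω : Ω) : ℝ :=
  ∫ x, x ∂(m t ω)

/-- The objective
`E ∫_0^T { Q_t (b ν̄_t + μ) - η ν_t² - 2 a Q_t ν_t - φ Q_t² } dt` of the representative trader,
given the flow `m` of conditional laws of the other traders' rates. -/
def traderObjective (P : Measure Ω) (Q₀ μ : Ω → ℝ) (m : p.Time → Ω → Measure ℝ)
    (ν : p.Time → Ω → ℝ) : ℝ :=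
  ∫ ω, ∫ t, (p.inventory Q₀ ν t ω * (p.b * p.meanRate m t ω + μ ω) - p.η * ν t ω ^ 2
      - 2 * p.a * p.inventory Q₀ ν t ω * ν t ω - p.φ * p.inventory Q₀ ν t ω ^ 2)
    ∂p.timeMeasure ∂P

/-- An equilibrium of the traders' mean field game: an admissible control `ν` and an
`F^r`-progressively measurable process `m` of square integrable probability measures, such that
`ν` maximizes the objective given `m`, and `m_t` is the law of `ν_t` conditional on `F_t` for
almost every `t`. -/
structure IsMFGEquilibrium (P : Measure Ω) (F : Filtration p.Time mΩ) (Q₀ : Ω → ℝ)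
    (hQ₀ : Measurable Q₀) (μ : Ω → ℝ) (ν : p.Time → Ω → ℝ) (m : p.Time → Ω → Measure ℝ) :
    Prop where
  admissible : p.IsAdmissible P F Q₀ hQ₀ ν
  isProbabilityMeasure : ∀ t ω, IsProbabilityMeasure (m t ω)
  secondMoment : ∀ t ω, MemLp (fun x : ℝ => x) 2 (m t ω)
  progressive : IsProgressive (p.traderFiltration F Q₀ hQ₀) m
  optimal : ∀ ν', p.IsAdmissible P F Q₀ hQ₀ ν' →
    p.traderObjective P Q₀ μ m ν' ≤ p.traderObjective P Q₀ μ m ν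
  consistent : ∀ᵐ t ∂p.timeMeasure, ∀ S : Set ℝ, MeasurableSet S →
    (fun ω => (m t ω).real S) =ᵐ[P] P[(ν t ⁻¹' S).indicator (fun _ => (1 : ℝ)) | F t]

/-- `∫_0^t C̄_{s,t} μ_s ds + D̄_t μ_t` for the process `M = (μ_t)`. -/
def signalPart (γ : ℝ → ℝ) (M : p.Time → Ω → ℝ) (t : p.Time) (ω : Ω) : ℝ :=
  (∫ s in Set.Iic t, p.Cbar γ s t * M s ω ∂p.timeMeasure) + M t ω * p.Dbar γ t

/-- `ν̂_t = Ā_t E[Q₀] + B̄_t Q₀ + ∫_0^t C̄_{s,t} μ_s ds + D̄_t μ_t`. -/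
def nuHat (γ : ℝ → ℝ) (P : Measure Ω) (Q₀ : Ω → ℝ) (M : p.Time → Ω → ℝ)
    (t : p.Time) (ω : Ω) : ℝ :=
  p.Abar γ t * P[Q₀] + p.Bbar γ t * Q₀ ω + p.signalPart γ M t ω

end Game

end TraderParams

end

/-! Write `u` for `solo`, `v` for `crowd`, `g` for `signalCoef`, κ = φ/η and δ = b/(2η). The
substitution γ = 2a + 2η u'/u turns the Riccati equation into u'' = κu with u(T) = 1 and u'(T) =
-a/η. Hence Γ_{s,t} = u(t)/u(s), and every kernel is a product of functions of one variable.
Averaging the traders' Euler-Lagrange equation gives, without signal, the mean inventory v: v'' = κv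
- δv' with the same terminal data. The signal enters by variation of constants: the mean inventory
becomes vP with P' = (g/v)M, where g' = -δg - 1/(2η) - gv'/v and g(T) = 0.

Coefficients. These functions sum the series in closed form. The Wronskian W = uv' - u'v satisfies
W' = -δuv', W(T) = 0 and (v/u)' = W/u². With these identities ξ = v'/v(0) solves ξ - bLξ = z, and
the pair (g(s)/v(s) · v'(t), g(t)) solves the corresponding equation for L̂ and (C, D); see
`zCoef_eq_sub`, `kerC_eq`, `kerD_eq`. If ζ = ξ - bLξ, then the terms b^k L^k ζ telescope, and the
smallness of b gives b · `opBound` < 1, so the Neumann series converge to these solutions. It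
follows that Ā = v'/v(0) - u'/u(0), B̄ = u'/u(0), C̄_{s,t} = g(s)/v(s) · v'(t) and D̄ = g, which are
analytic because u and v are positive on [0, T].

Game. For a fixed mean rate the objective along ν + ch is V₀ + cV - c²K with K ≥ η E∫h², so that
optimality amounts to the vanishing of the first variation V. At the candidate, integration by parts
along each path reduces V to E∫(μ - M_t)k_t dt with k adapted to F^r. Since Q₀ is independent of the
signal, M_t is also E[μ | F^r_t], and V = 0 (`integral_gainVariation_eq_zero`). For uniqueness, the
first order conditions of two equilibria are subtracted and tested with the difference d of the
controls (`control_unique`): b E∫Dr = 2K(d), where D is the primitive of d and r the difference of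
the mean rates. As r_t = E[d_t | F_t] and ‖D‖ ≤ T‖d‖, this gives 2η‖d‖² ≤ bT‖d‖², while bT < η. The
conditional laws and moments come from the form of the control: an F_t-measurable part plus B̄_t(Q₀
- E[Q₀]), with Q₀ independent of F_t. -/

noncomputable section

/-! ### Second order linear equations with a Robin condition at the terminal time -/

/-- The positive root of `x² + δ x = κ`. -/
def rootPos (δ κ : ℝ) : ℝ := (-δ + Real.sqrt (δ ^ 2 + 4 * κ)) / 2

/-- The negative root of `x² + δ x = κ`. -/
def rootNeg (δ κ : ℝ) : ℝ := (-δ - Real.sqrt (δ ^ 2 + 4 * κ)) / 2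

/-- The solution of `f'' = κ f - δ f'` with `f T = 1` and `f' T = -c`. -/
def robin (δ κ c T t : ℝ) : ℝ :=
  ((-c - rootNeg δ κ) * Real.exp (rootPos δ κ * (t - T)) +
    (rootPos δ κ + c) * Real.exp (rootNeg δ κ * (t - T))) / (rootPos δ κ - rootNeg δ κ)

/-- The derivative of `robin`. -/
def robinDeriv (δ κ c T t : ℝ) : ℝ :=
  ((-c - rootNeg δ κ) * (Real.exp (rootPos δ κ * (t - T)) * rootPos δ κ) +
    (rootPos δ κ + c) * (Real.exp (rootNeg δ κ * (t - T)) * rootNeg δ κ)) /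
      (rootPos δ κ - rootNeg δ κ)

section Robin

variable {δ κ c T t : ℝ}

lemma sqrt_disc_sq (hκ : 0 < κ) : Real.sqrt (δ ^ 2 + 4 * κ) ^ 2 = δ ^ 2 + 4 * κ :=
  Real.sq_sqrt (by positivity)

lemma rootPos_sq (hκ : 0 < κ) : rootPos δ κ ^ 2 = κ - δ * rootPos δ κ := by
  have := sqrt_disc_sq (δ := δ) hκ
  unfold rootPos
  linear_combination this / 4

lemma rootNeg_sq (hκ : 0 < κ) : rootNeg δ κ ^ 2 = κ - δ * rootNeg δ κ := by
  have := sqrt_disc_sq (δ := δ) hκ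
  unfold rootNeg
  linear_combination this / 4

lemma abs_lt_sqrt_disc (hκ : 0 < κ) : |δ| < Real.sqrt (δ ^ 2 + 4 * κ) := by
  rw [Real.lt_sqrt (abs_nonneg _), sq_abs]
  linarith

lemma rootPos_pos (hκ : 0 < κ) : 0 < rootPos δ κ := by
  have := abs_lt_sqrt_disc (δ := δ) hκ
  have := le_abs_self δ
  unfold rootPos
  linarith

lemma rootNeg_neg (hκ : 0 < κ) : rootNeg δ κ < 0 := by
  have := abs_lt_sqrt_disc (δ := δ) hκ
  have := neg_abs_le δ
  unfold rootNeg
  linarith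

lemma root_gap_pos (hκ : 0 < κ) : 0 < rootPos δ κ - rootNeg δ κ := by
  have := rootPos_pos (δ := δ) hκ
  have := rootNeg_neg (δ := δ) hκ
  linarith

lemma robin_terminal (hκ : 0 < κ) : robin δ κ c T T = 1 := by
  have := (root_gap_pos (δ := δ) hκ).ne'
  simp only [robin, sub_self, mul_zero, Real.exp_zero]
  field_simp
  ring

lemma robinDeriv_terminal (hκ : 0 < κ) : robinDeriv δ κ c T T = -c := by
  have := (root_gap_pos (δ := δ) hκ).ne'
  simp only [robinDeriv, sub_self, mul_zero, Real.exp_zero]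
  field_simp
  ring

lemma hasDerivAt_exp_mul_sub (x T t : ℝ) :
    HasDerivAt (fun t => Real.exp (x * (t - T))) (Real.exp (x * (t - T)) * x) t := by
  have h : HasDerivAt (fun t => x * (t - T)) x t := by
    simpa using ((hasDerivAt_id t).sub_const T).const_mul x
  exact h.exp

lemma hasDerivAt_robin (δ κ c T t : ℝ) :
    HasDerivAt (robin δ κ c T) (robinDeriv δ κ c T t) t :=
  (((hasDerivAt_exp_mul_sub _ T t).const_mul _).add
    ((hasDerivAt_exp_mul_sub _ T t).const_mul _)).div_const _

lemma hasDerivAt_robinDeriv (hκ : 0 < κ) (c T t : ℝ) :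
    HasDerivAt (robinDeriv δ κ c T) (κ * robin δ κ c T t - δ * robinDeriv δ κ c T t) t := by
  have h := ((((hasDerivAt_exp_mul_sub (rootPos δ κ) T t).mul_const (rootPos δ κ)).const_mul
    (-c - rootNeg δ κ)).add (((hasDerivAt_exp_mul_sub (rootNeg δ κ) T t).mul_const
      (rootNeg δ κ)).const_mul (rootPos δ κ + c))).div_const (rootPos δ κ - rootNeg δ κ)
  refine h.congr_deriv ?_
  have h0 := (root_gap_pos (δ := δ) hκ).ne'
  have h1 := rootPos_sq (δ := δ) hκ
  have h2 := rootNeg_sq (δ := δ) hκ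
  unfold robin robinDeriv
  rw [eq_comm, ← mul_div_assoc, ← mul_div_assoc, ← sub_div]
  congr 1
  linear_combination (-(-c - rootNeg δ κ) * Real.exp (rootPos δ κ * (t - T))) * h1 -
    (rootPos δ κ + c) * Real.exp (rootNeg δ κ * (t - T)) * h2

/-- With e± = exp(r±(t - T)) the numerator is c(e₋ - e₊) - r₋e₊ + r₊e₋. Here r₋ < 0 < r₊, and e₊ ≤
e₋ before T. -/
lemma robin_pos (hκ : 0 < κ) (hc : 0 < c) (ht : t ≤ T) : 0 < robin δ κ c T t := by
  have h0 := root_gap_pos (δ := δ) hκ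
  have h1 := rootPos_pos (δ := δ) hκ
  have h2 := rootNeg_neg (δ := δ) hκ
  refine div_pos ?_ h0
  have hle : Real.exp (rootPos δ κ * (t - T)) ≤ Real.exp (rootNeg δ κ * (t - T)) := by
    apply Real.exp_le_exp.2
    nlinarith
  have := Real.exp_pos (rootPos δ κ * (t - T))
  nlinarith

lemma continuous_robin (δ κ c T : ℝ) : Continuous (robin δ κ c T) :=
  continuous_iff_continuousAt.2 fun t => (hasDerivAt_robin δ κ c T t).continuousAt

lemma continuous_robinDeriv (δ κ c T : ℝ) : Continuous (robinDeriv δ κ c T) := by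
  unfold robinDeriv
  fun_prop

lemma analyticAt_robin (δ κ c T t : ℝ) : AnalyticAt ℝ (robin δ κ c T) t := by
  unfold robin
  simp only [div_eq_mul_inv]
  fun_prop

lemma analyticAt_robinDeriv (δ κ c T t : ℝ) : AnalyticAt ℝ (robinDeriv δ κ c T) t := by
  unfold robinDeriv
  simp only [div_eq_mul_inv]
  fun_prop

lemma rootPos_zero (κ : ℝ) : rootPos 0 κ = Real.sqrt κ := by
  have : Real.sqrt (0 ^ 2 + 4 * κ) = 2 * Real.sqrt κ := by
    rw [zero_pow two_ne_zero, zero_add, Real.sqrt_mul (by norm_num)]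
    congr 1
    rw [show (4 : ℝ) = 2 ^ 2 by norm_num, Real.sqrt_sq (by norm_num)]
  rw [rootPos, this]
  ring

lemma rootNeg_zero (κ : ℝ) : rootNeg 0 κ = -Real.sqrt κ := by
  have h := rootPos_zero κ
  unfold rootPos at h
  unfold rootNeg
  linarith

lemma robinDeriv_zero_nonpos (hκ : 0 < κ) (hc : 0 < c) (ht : t ≤ T) :
    robinDeriv 0 κ c T t ≤ 0 := by
  have h0 := root_gap_pos (δ := 0) hκ
  have h1 := rootPos_pos (δ := 0) hκ
  have hp := Real.exp_pos (rootPos 0 κ * (t - T))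
  refine div_nonpos_of_nonpos_of_nonneg ?_ h0.le
  have hle : Real.exp (rootPos 0 κ * (t - T)) ≤ Real.exp (rootNeg 0 κ * (t - T)) := by
    apply Real.exp_le_exp.2
    nlinarith [rootNeg_neg (δ := 0) hκ]
  rw [rootNeg_zero, rootPos_zero] at *
  nlinarith [mul_pos hp h1, mul_pos h1 hc, mul_le_mul_of_nonneg_left hle (mul_pos h1 h1).le,
    mul_pos (mul_pos h1 hc) hp, mul_pos (mul_pos h1 hc)
    (Real.exp_pos (-Real.sqrt κ * (t - T)))]

/-- Put k = √κ and e± = exp(±k(t - T)). Up to the positive denominator, kf + f' is 2k(k - c)e₊ and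
cf + f' is (c² - k²)(e₋ - e₊). The larger of c and k makes its own expression nonnegative. -/
lemma neg_robinDeriv_zero_le (hκ : 0 < κ) (ht : t ≤ T) :
    -robinDeriv 0 κ c T t ≤ max c (Real.sqrt κ) * robin 0 κ c T t := by
  have h0 := root_gap_pos (δ := 0) hκ
  have h1 := rootPos_pos (δ := 0) hκ
  have hp := Real.exp_pos (rootPos 0 κ * (t - T))
  have hle : Real.exp (rootPos 0 κ * (t - T)) ≤ Real.exp (rootNeg 0 κ * (t - T)) := by
    apply Real.exp_le_exp.2
    nlinarith [rootNeg_neg (δ := 0) hκ]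
  rw [robinDeriv, robin, ← neg_div, ← mul_div_assoc]
  refine div_le_div_of_nonneg_right ?_ h0.le
  rw [rootNeg_zero, rootPos_zero] at *
  rcases le_total c (Real.sqrt κ) with h | h
  · rw [max_eq_right h]
    nlinarith [mul_nonneg (mul_nonneg h1.le (sub_nonneg.2 h)) hp.le]
  · rw [max_eq_left h]
    nlinarith [mul_nonneg (mul_nonneg (sub_nonneg.2 h) (by linarith : 0 ≤ c + Real.sqrt κ))
      (sub_nonneg.2 hle)]

end Robin

/-! ### Linearization of the Riccati equation -/

namespace TraderParams

/-- The constants are positive. -/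
structure Positive (p : TraderParams) : Prop where
  a : 0 < p.a
  φ : 0 < p.φ
  η : 0 < p.η
  b : 0 < p.b
  T : 0 < p.T

/-- The optimal inventory of a trader without signal, normalized at the terminal time. -/
def solo (p : TraderParams) : ℝ → ℝ := robin 0 (p.φ / p.η) (p.a / p.η) p.T

/-- The derivative of `solo`. -/
def soloDeriv (p : TraderParams) : ℝ → ℝ := robinDeriv 0 (p.φ / p.η) (p.a / p.η) p.T

/-- The mean inventory of the traders without signal, normalized at the terminal time. -/
def crowd (p : TraderParams) : ℝ → ℝ := robin (p.b / (2 * p.η)) (p.φ / p.η) (p.a / p.η) p.T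

/-- The derivative of `crowd`. -/
def crowdDeriv (p : TraderParams) : ℝ → ℝ :=
  robinDeriv (p.b / (2 * p.η)) (p.φ / p.η) (p.a / p.η) p.T

/-- A solution of the Riccati equation, frozen after the terminal time. -/
def riccatiSol (p : TraderParams) (t : ℝ) : ℝ :=
  2 * p.a + 2 * p.η * (p.soloDeriv (min t p.T) / p.solo (min t p.T))

/-- A bound for `|γ - 2a| / (2η)`. -/
def slopeBound (p : TraderParams) : ℝ := max p.a (Real.sqrt (p.η * p.φ)) / p.η

variable {p : TraderParams}

namespace Positive

variable (hp : p.Positive)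
include hp

lemma ratio : 0 < p.φ / p.η := div_pos hp.φ hp.η

lemma slopeBound_pos : 0 < p.slopeBound := div_pos (lt_max_of_lt_left hp.a) hp.η

lemma slopeBound_eq : p.slopeBound = max (p.a / p.η) (Real.sqrt (p.φ / p.η)) := by
  have hη := hp.η
  have : Real.sqrt (p.φ / p.η) = Real.sqrt (p.η * p.φ) / p.η := by
    rw [← Real.sqrt_sq hη.le, ← Real.sqrt_div' _ (sq_nonneg _), Real.sqrt_sq hη.le]
    congr 1
    field_simp
  rw [slopeBound, this, max_div_div_right hη.le]

lemma solo_pos {t : ℝ} (ht : t ≤ p.T) : 0 < p.solo t :=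
  robin_pos hp.ratio (div_pos hp.a hp.η) ht

lemma crowd_pos {t : ℝ} (ht : t ≤ p.T) : 0 < p.crowd t :=
  robin_pos hp.ratio (div_pos hp.a hp.η) ht

lemma solo_terminal : p.solo p.T = 1 := robin_terminal hp.ratio

lemma soloDeriv_terminal : p.soloDeriv p.T = -(p.a / p.η) := robinDeriv_terminal hp.ratio

lemma crowd_terminal : p.crowd p.T = 1 := robin_terminal hp.ratio

lemma crowdDeriv_terminal : p.crowdDeriv p.T = -(p.a / p.η) := robinDeriv_terminal hp.ratio

lemma hasDerivAt_soloDeriv (t : ℝ) :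
    HasDerivAt p.soloDeriv (p.φ / p.η * p.solo t) t := by
  exact (hasDerivAt_robinDeriv (δ := 0) hp.ratio (p.a / p.η) p.T t).congr_deriv (by simp [solo])

lemma hasDerivAt_crowdDeriv (t : ℝ) :
    HasDerivAt p.crowdDeriv
      (p.φ / p.η * p.crowd t - p.b / (2 * p.η) * p.crowdDeriv t) t :=
  hasDerivAt_robinDeriv hp.ratio (p.a / p.η) p.T t

end Positive

lemma hasDerivAt_solo (t : ℝ) : HasDerivAt p.solo (p.soloDeriv t) t := hasDerivAt_robin ..

lemma hasDerivAt_crowd (t : ℝ) : HasDerivAt p.crowd (p.crowdDeriv t) t := hasDerivAt_robin ..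

@[fun_prop]
lemma continuous_solo : Continuous p.solo := continuous_robin ..

@[fun_prop]
lemma continuous_soloDeriv : Continuous p.soloDeriv := continuous_robinDeriv ..

@[fun_prop]
lemma continuous_crowd : Continuous p.crowd := continuous_robin ..

@[fun_prop]
lemma continuous_crowdDeriv : Continuous p.crowdDeriv := continuous_robinDeriv ..

@[fun_prop]
lemma analyticAt_solo (t : ℝ) : AnalyticAt ℝ p.solo t := analyticAt_robin ..

@[fun_prop]
lemma analyticAt_soloDeriv (t : ℝ) : AnalyticAt ℝ p.soloDeriv t := analyticAt_robinDeriv ..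

@[fun_prop]
lemma analyticAt_crowd (t : ℝ) : AnalyticAt ℝ p.crowd t := analyticAt_robin ..

@[fun_prop]
lemma analyticAt_crowdDeriv (t : ℝ) : AnalyticAt ℝ p.crowdDeriv t := analyticAt_robinDeriv ..

/-- Freezing the time at T keeps the argument where `solo` is positive. Continuity on all of ℝ makes
the kernels globally continuous, so integrability is automatic for any limits of integration. -/
lemma Positive.continuous_riccatiSol (hp : p.Positive) : Continuous p.riccatiSol := by
  have h : ∀ t, p.solo (min t p.T) ≠ 0 := fun t => (hp.solo_pos (min_le_right _ _)).ne'
  have hm : Continuous fun t : ℝ => min t p.T := by fun_prop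
  unfold riccatiSol
  exact continuous_const.add (continuous_const.mul
    ((continuous_soloDeriv.comp hm).div (continuous_solo.comp hm) h))

lemma Positive.slope_eq (hp : p.Positive) (t : ℝ) :
    (p.riccatiSol t - 2 * p.a) / (2 * p.η) = p.soloDeriv (min t p.T) / p.solo (min t p.T) := by
  have := hp.η.ne'
  unfold riccatiSol
  field_simp
  ring

lemma Positive.slope_eq_of_le (hp : p.Positive) {t : ℝ} (ht : t ≤ p.T) :
    (p.riccatiSol t - 2 * p.a) / (2 * p.η) = p.soloDeriv t / p.solo t := by
  rw [hp.slope_eq, min_eq_left ht]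

lemma Positive.slope_nonpos (hp : p.Positive) (t : ℝ) :
    (p.riccatiSol t - 2 * p.a) / (2 * p.η) ≤ 0 := by
  rw [hp.slope_eq]
  exact div_nonpos_of_nonpos_of_nonneg
    (robinDeriv_zero_nonpos hp.ratio (div_pos hp.a hp.η) (min_le_right _ _))
    (hp.solo_pos (min_le_right _ _)).le

lemma Positive.neg_slopeBound_le (hp : p.Positive) (t : ℝ) :
    -p.slopeBound ≤ (p.riccatiSol t - 2 * p.a) / (2 * p.η) := by
  rw [hp.slope_eq, le_div_iff₀ (hp.solo_pos (min_le_right _ _))]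
  have := neg_robinDeriv_zero_le (c := p.a / p.η) hp.ratio (min_le_right t p.T)
  rw [← hp.slopeBound_eq] at this
  unfold solo soloDeriv
  linarith

/-- γ - 2a is 2η times the logarithmic derivative of `solo`: the quotient rule produces the
quadratic term, and the slope -a/η at T cancels 2a. -/
lemma Positive.isRiccatiSolution (hp : p.Positive) : p.IsRiccatiSolution p.riccatiSol where
  terminal := by
    have := hp.η.ne'
    rw [riccatiSol, min_self, hp.solo_terminal, hp.soloDeriv_terminal]
    field_simp
    ring
  deriv t ht := by
    have hη := hp.η.ne'
    have h0 := (hp.solo_pos ht.2).ne'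
    have h := ((((hp.hasDerivAt_soloDeriv t).div (hasDerivAt_solo t) h0).const_mul
      (2 * p.η)).const_add (2 * p.a)).hasDerivWithinAt (s := Set.Icc 0 p.T)
    have heq : ∀ x ∈ Set.Icc 0 p.T, p.riccatiSol x =
        2 * p.a + 2 * p.η * (p.soloDeriv x / p.solo x) := fun x hx => by
      rw [riccatiSol, min_eq_left hx.2]
    refine (h.congr heq (heq t ht)).congr_deriv ?_
    rw [heq t ht]
    field_simp
    ring

/-- The difference of two solutions solves the linear equation x' = qx with q continuous, hence
bounded, on [0, T] and x(T) = 0. Gronwall's inequality backwards in time gives x = 0. -/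
lemma IsRiccatiSolution.eqOn {γ γ' : ℝ → ℝ} (h : p.IsRiccatiSolution γ)
    (h' : p.IsRiccatiSolution γ') : Set.EqOn γ' γ (Set.Icc 0 p.T) := by
  have hc : ContinuousOn γ (Set.Icc 0 p.T) := fun t ht => (h.deriv t ht).continuousWithinAt
  have hc' : ContinuousOn γ' (Set.Icc 0 p.T) := fun t ht => (h'.deriv t ht).continuousWithinAt
  set q : ℝ → ℝ := fun t => 2 * (p.a / p.η) - (γ' t + γ t) / (2 * p.η) with hq
  have hqc : ContinuousOn q (Set.Icc 0 p.T) := by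
    rw [hq]
    exact continuousOn_const.sub ((hc'.add hc).div_const _)
  obtain ⟨K, hK⟩ := isCompact_Icc.exists_bound_of_continuousOn hqc
  have key : Set.EqOn (fun t => γ' t - γ t) (fun _ => 0) (Set.Icc 0 p.T) := by
    refine ODE_solution_unique_of_mem_Icc_left (v := fun t x => q t * x) (s := fun _ => Set.univ)
      (K := K.toNNReal) ?_ (hc'.sub hc) ?_ (fun _ _ => trivial) continuousOn_const ?_
      (fun _ _ => trivial) ?_
    · intro t ht
      refine LipschitzOnWith.of_dist_le_mul fun x _ y _ => ?_
      rw [Real.dist_eq, Real.dist_eq, ← mul_sub, abs_mul]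
      refine mul_le_mul_of_nonneg_right ?_ (abs_nonneg _)
      exact (hK t (Set.Ioc_subset_Icc_self ht)).trans (Real.le_coe_toNNReal K)
    · intro t ht
      have ht' := Set.Ioc_subset_Icc_self ht
      have := ((h'.deriv t ht').sub (h.deriv t ht')).mono_of_mem_nhdsWithin
        (Icc_mem_nhdsLE_of_mem ht)
      refine this.congr_deriv ?_
      simp only [hq]
      ring
    · intro t _
      simpa using hasDerivWithinAt_const t (Set.Iic t) (0 : ℝ)
    · simp [h.terminal, h'.terminal]
  intro t ht
  have := key ht
  simp only at this
  linarith

/-- The integrand in the exponent is the derivative of log `solo`. -/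
lemma Positive.Gam_eq (hp : p.Positive) {s t : ℝ} (hs : s ≤ p.T) (ht : t ≤ p.T) :
    p.Gam p.riccatiSol s t = p.solo t / p.solo s := by
  have hle : ∀ r ∈ Set.uIcc s t, r ≤ p.T := fun r hr => hr.2.trans (max_le hs ht)
  have h1 : ∫ r in s..t, (p.riccatiSol r - 2 * p.a) / (2 * p.η) =
      ∫ r in s..t, p.soloDeriv r / p.solo r :=
    intervalIntegral.integral_congr fun r hr => hp.slope_eq_of_le (hle r hr)
  rw [Gam, h1, intervalIntegral.integral_eq_sub_of_hasDerivAt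
    (f := fun r => Real.log (p.solo r)), Real.exp_sub, Real.exp_log (hp.solo_pos ht),
    Real.exp_log (hp.solo_pos hs)]
  · exact fun r hr => (hasDerivAt_solo r).log (hp.solo_pos (hle r hr)).ne'
  · refine ContinuousOn.intervalIntegrable ?_
    exact continuous_soloDeriv.continuousOn.div continuous_solo.continuousOn
      fun r hr => (hp.solo_pos (hle r hr)).ne'

end TraderParams

/-! ### Parameter integrals and telescoping series -/

lemma continuous_intervalIntegral_of_continuous {X : Type*} [TopologicalSpace X]
    [FirstCountableTopology X] [LocallyCompactSpace X] {f : X → ℝ → ℝ}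
    (hf : Continuous (Function.uncurry f)) {a b : X → ℝ} (ha : Continuous a) (hb : Continuous b) :
    Continuous fun x => ∫ t in a x..b x, f x t := by
  have h : ∀ x, ∫ t in a x..b x, f x t = (∫ t in (0 : ℝ)..b x, f x t) - ∫ t in (0 : ℝ)..a x, f x t :=
    fun x => (intervalIntegral.integral_interval_sub_left
      ((hf.comp (Continuous.prodMk_right x)).intervalIntegrable _ _)
      ((hf.comp (Continuous.prodMk_right x)).intervalIntegrable _ _)).symm
  simp_rw [h]
  exact (intervalIntegral.continuous_parametric_intervalIntegral_of_continuous hf hb).sub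
    (intervalIntegral.continuous_parametric_intervalIntegral_of_continuous hf ha)

/-- The terms b^k L^k ζ of a Neumann series have this form, with a_k = b^k L^k ξ, as soon as ζ = ξ -
bLξ. -/
lemma hasSum_sub_succ_of_geometric_bound {a : ℕ → ℝ} {M θ : ℝ} (hθ0 : 0 ≤ θ) (hθ : θ < 1)
    (h : ∀ k, |a k| ≤ M * θ ^ k) : HasSum (fun k => a k - a (k + 1)) (a 0) := by
  have hs : Summable a := Summable.of_norm_bounded
    ((summable_geometric_of_lt_one hθ0 hθ).mul_left M) h
  have h1 := (hasSum_nat_add_iff' 1).2 hs.hasSum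
  simpa using hs.hasSum.sub h1

/-- `|∫_a^b f| ≤ C T` if `|f| ≤ C` between `a` and `b`, two points of `[0, T]`. -/
lemma abs_intervalIntegral_le {a b T C : ℝ} {f : ℝ → ℝ} (ha : a ∈ Set.Icc 0 T)
    (hb : b ∈ Set.Icc 0 T) (hC : 0 ≤ C) (h : ∀ x ∈ Set.uIcc a b, |f x| ≤ C) :
    |∫ x in a..b, f x| ≤ C * T := by
  refine (intervalIntegral.norm_integral_le_of_norm_le_const
    fun x hx => (Real.norm_eq_abs _).trans_le (h x (Set.uIoc_subset_uIcc hx))).trans (mul_le_mul_of_nonneg_left ?_ hC)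
  exact abs_le.2 ⟨by linarith [ha.2, hb.1], by linarith [ha.1, hb.2]⟩

/-! ### Bounds and continuity of the kernels -/

namespace TraderParams

variable {p : TraderParams}

/-- A bound for the operators `L` and `L̂` on `[0, T]`. -/
def opBound (p : TraderParams) : ℝ :=
  max p.slopeBound 1 * Real.exp (p.slopeBound * p.T) * (p.T ^ 2 + p.T) / p.η

namespace Positive

variable (hp : p.Positive)
include hp

lemma zero_mem : (0 : ℝ) ∈ Set.Icc 0 p.T := ⟨le_rfl, hp.T.le⟩

lemma T_mem : p.T ∈ Set.Icc 0 p.T := ⟨hp.T.le, le_rfl⟩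

lemma uIcc_T_subset {s : ℝ} (hs : s ∈ Set.Icc 0 p.T) {r : ℝ} (hr : r ∈ Set.uIcc s p.T) :
    s ≤ r ∧ r ∈ Set.Icc 0 p.T :=
  ⟨by rw [Set.uIcc_of_le hs.2] at hr; exact hr.1, Set.uIcc_subset_Icc hs hp.T_mem hr⟩

lemma opBound_pos : 0 < p.opBound := by
  have := hp.T
  have := hp.η
  have : 0 < max p.slopeBound 1 := lt_max_of_lt_left hp.slopeBound_pos
  unfold opBound
  positivity

/-- Through this inequality the smallness of b required by the Neumann series also yields bT < η, on
which uniqueness rests. -/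
lemma T_lt_opBound : p.T < p.opBound * p.η := by
  have hT := hp.T
  have hη := hp.η
  have h1 : 1 ≤ max p.slopeBound 1 * Real.exp (p.slopeBound * p.T) :=
    one_le_mul_of_one_le_of_one_le (le_max_right _ _)
      (Real.one_le_exp (mul_nonneg hp.slopeBound_pos.le hT.le))
  rw [opBound, div_mul_cancel₀ _ hη.ne']
  nlinarith [sq_nonneg p.T, mul_pos hT hT]

lemma continuous_slope : Continuous fun t => (p.riccatiSol t - 2 * p.a) / (2 * p.η) := by
  have := hp.continuous_riccatiSol
  fun_prop

lemma continuous_Gam {X : Type*} [TopologicalSpace X] {s t : X → ℝ} (hs : Continuous s)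
    (ht : Continuous t) : Continuous fun x => p.Gam p.riccatiSol (s x) (t x) := by
  have hg := hp.continuous_slope
  have h : ∀ x, p.Gam p.riccatiSol (s x) (t x) = Real.exp
      ((∫ r in (0 : ℝ)..t x, (p.riccatiSol r - 2 * p.a) / (2 * p.η)) -
        ∫ r in (0 : ℝ)..s x, (p.riccatiSol r - 2 * p.a) / (2 * p.η)) := fun x => by
    rw [Gam, intervalIntegral.integral_interval_sub_left (hg.intervalIntegrable _ _)
      (hg.intervalIntegrable _ _)]
  have hc : Continuous fun x : ℝ => ∫ r in (0 : ℝ)..x,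
      (p.riccatiSol r - 2 * p.a) / (2 * p.η) :=
    intervalIntegral.continuous_primitive (fun a b => hg.intervalIntegrable a b) 0
  simp_rw [h]
  exact Real.continuous_exp.comp ((hc.comp ht).sub (hc.comp hs))

lemma continuous_kerA {X : Type*} [TopologicalSpace X] {r s t : X → ℝ} (hr : Continuous r)
    (hs : Continuous s) (ht : Continuous t) :
    Continuous fun x => p.kerA p.riccatiSol (r x) (s x) (t x) := by
  have := hp.continuous_riccatiSol
  have := hp.continuous_Gam hs hr
  have := hp.continuous_Gam hs ht
  unfold kerA
  fun_prop

lemma continuous_kerB {X : Type*} [TopologicalSpace X] {s t : X → ℝ} (hs : Continuous s)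
    (ht : Continuous t) : Continuous fun x => p.kerB p.riccatiSol (s x) (t x) := by
  have := hp.continuous_Gam ht hs
  unfold kerB
  fun_prop

lemma Gam_le_one {s t : ℝ} (hst : s ≤ t) : p.Gam p.riccatiSol s t ≤ 1 := by
  rw [Gam, Real.exp_le_one_iff, ← neg_nonneg, ← intervalIntegral.integral_neg]
  exact intervalIntegral.integral_nonneg hst fun r _ => neg_nonneg.2 (hp.slope_nonpos r)

/-- Unlike in `Gam_le_one`, the order of s and t is free: L̂₁ is estimated on the whole square,
where Γ_{s,t} with t < s can exceed 1. -/
lemma Gam_le {s t : ℝ} (hs : s ∈ Set.Icc 0 p.T) (ht : t ∈ Set.Icc 0 p.T) :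
    p.Gam p.riccatiSol s t ≤ Real.exp (p.slopeBound * p.T) := by
  refine Real.exp_le_exp.2 ((le_abs_self _).trans ?_)
  refine abs_intervalIntegral_le hs ht hp.slopeBound_pos.le fun x _ => abs_le.2
    ⟨hp.neg_slopeBound_le x, (hp.slope_nonpos x).trans hp.slopeBound_pos.le⟩

lemma abs_kerA_le {r s t : ℝ} (hsr : s ≤ r) (hs : s ∈ Set.Icc 0 p.T) (ht : t ∈ Set.Icc 0 p.T) :
    |p.kerA p.riccatiSol r s t| ≤
      p.slopeBound * Real.exp (p.slopeBound * p.T) / (2 * p.η) := by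
  have hη := hp.η
  have h1 : |(p.riccatiSol t - 2 * p.a) / (2 * p.η)| ≤ p.slopeBound := abs_le.2
    ⟨hp.neg_slopeBound_le t, (hp.slope_nonpos t).trans hp.slopeBound_pos.le⟩
  have h2 : p.kerA p.riccatiSol r s t = (p.riccatiSol t - 2 * p.a) / (2 * p.η) *
      (p.Gam p.riccatiSol s r * p.Gam p.riccatiSol s t) / (2 * p.η) := by
    unfold kerA
    field_simp
    ring
  have h3 : 0 ≤ p.Gam p.riccatiSol s r * p.Gam p.riccatiSol s t :=
    mul_nonneg (Real.exp_pos _).le (Real.exp_pos _).le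
  rw [h2, abs_div, abs_mul, abs_of_nonneg h3, abs_of_pos (by positivity : 0 < 2 * p.η)]
  refine div_le_div_of_nonneg_right ?_ (by positivity)
  refine mul_le_mul h1 ?_ h3 hp.slopeBound_pos.le
  calc _ ≤ 1 * Real.exp (p.slopeBound * p.T) :=
        mul_le_mul (hp.Gam_le_one hsr) (hp.Gam_le hs ht) (Real.exp_pos _).le zero_le_one
    _ = _ := one_mul _

lemma abs_kerB_le {s t : ℝ} (hts : t ≤ s) : |p.kerB p.riccatiSol s t| ≤ 1 / (2 * p.η) := by
  have hη := hp.η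
  have h0 : 0 < p.Gam p.riccatiSol t s := Real.exp_pos _
  rw [kerB, abs_of_pos (by positivity)]
  exact mul_le_of_le_one_right (by positivity) (hp.Gam_le_one hts)

/-! ### The operator `L` -/

lemma continuous_opL {ξ : ℝ → ℝ} (hξ : Continuous ξ) : Continuous (p.opL p.riccatiSol ξ) := by
  unfold opL
  refine Continuous.add ?_ ?_
  · refine continuous_intervalIntegral_of_continuous ?_ (by fun_prop) (by fun_prop)
    refine continuous_intervalIntegral_of_continuous ?_ (by fun_prop) (by fun_prop)
    refine Continuous.mul (hp.continuous_kerA ?_ ?_ ?_) ?_ <;> fun_prop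
  · refine continuous_intervalIntegral_of_continuous ?_ (by fun_prop) (by fun_prop)
    refine Continuous.mul (hp.continuous_kerB ?_ ?_) ?_ <;> fun_prop

lemma opL_sub_mul {ξ ζ : ℝ → ℝ} (hξ : Continuous ξ) (hζ : Continuous ζ) (c t : ℝ) :
    p.opL p.riccatiSol (fun r => ξ r - c * ζ r) t =
      p.opL p.riccatiSol ξ t - c * p.opL p.riccatiSol ζ t := by
  have hA : ∀ (f : ℝ → ℝ), Continuous f → ∀ s, Continuous fun r =>
      p.kerA p.riccatiSol r s t * f r := fun f hf s =>
    (hp.continuous_kerA continuous_id continuous_const continuous_const).mul hf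
  have hB : ∀ (f : ℝ → ℝ), Continuous f → Continuous fun s => p.kerB p.riccatiSol s t * f s :=
    fun f hf => (hp.continuous_kerB continuous_id continuous_const).mul hf
  have hAA : ∀ (f : ℝ → ℝ), Continuous f → Continuous fun s =>
      ∫ r in s..p.T, p.kerA p.riccatiSol r s t * f r := fun f hf => by
    refine continuous_intervalIntegral_of_continuous ?_ (by fun_prop) (by fun_prop)
    refine Continuous.mul (hp.continuous_kerA ?_ ?_ ?_) ?_ <;> fun_prop
  have h1 : ∀ s, ∫ r in s..p.T, p.kerA p.riccatiSol r s t * (ξ r - c * ζ r) =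
      (∫ r in s..p.T, p.kerA p.riccatiSol r s t * ξ r) -
        c * ∫ r in s..p.T, p.kerA p.riccatiSol r s t * ζ r := fun s => by
    rw [← intervalIntegral.integral_const_mul, ← intervalIntegral.integral_sub
      ((hA ξ hξ s).intervalIntegrable _ _) (((hA ζ hζ s).const_mul c).intervalIntegrable _ _)]
    exact intervalIntegral.integral_congr fun r _ => by ring
  have h2 : ∫ s in t..p.T, p.kerB p.riccatiSol s t * (ξ s - c * ζ s) =
      (∫ s in t..p.T, p.kerB p.riccatiSol s t * ξ s) -
        c * ∫ s in t..p.T, p.kerB p.riccatiSol s t * ζ s := by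
    rw [← intervalIntegral.integral_const_mul, ← intervalIntegral.integral_sub
      ((hB ξ hξ).intervalIntegrable _ _) (((hB ζ hζ).const_mul c).intervalIntegrable _ _)]
    exact intervalIntegral.integral_congr fun r _ => by ring
  simp only [opL, h1, h2]
  rw [intervalIntegral.integral_sub ((hAA ξ hξ).intervalIntegrable _ _)
    (((hAA ζ hζ).const_mul c).intervalIntegrable _ _), intervalIntegral.integral_const_mul]
  ring

/-- The closed forms of the kernels hold on [0, T] only. All integrals in L stay there, so such
identities pass through the iterates. -/
lemma opL_congr {ξ ζ : ℝ → ℝ} (h : Set.EqOn ξ ζ (Set.Icc 0 p.T)) :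
    Set.EqOn (p.opL p.riccatiSol ξ) (p.opL p.riccatiSol ζ) (Set.Icc 0 p.T) := by
  intro t ht
  unfold opL
  congr 1
  · refine intervalIntegral.integral_congr fun s hs =>
      intervalIntegral.integral_congr fun r hr => ?_
    rw [h (Set.uIcc_subset_Icc (Set.uIcc_subset_Icc hp.zero_mem ht hs) hp.T_mem hr)]
  · refine intervalIntegral.integral_congr fun s hs => ?_
    rw [h (Set.uIcc_subset_Icc ht hp.T_mem hs)]

lemma abs_opL_le {ξ : ℝ → ℝ} {M : ℝ} (hM : 0 ≤ M) (h : ∀ t ∈ Set.Icc 0 p.T, |ξ t| ≤ M) {t : ℝ}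
    (ht : t ∈ Set.Icc 0 p.T) : |p.opL p.riccatiSol ξ t| ≤ p.opBound * M := by
  have hη := hp.η
  have hT := hp.T
  have hK := hp.slopeBound_pos
  have he := Real.exp_pos (p.slopeBound * p.T)
  have h1 : |∫ s in (0 : ℝ)..t, ∫ r in s..p.T, p.kerA p.riccatiSol r s t * ξ r| ≤
      p.slopeBound * Real.exp (p.slopeBound * p.T) / (2 * p.η) * M * p.T * p.T := by
    refine abs_intervalIntegral_le hp.zero_mem ht (by positivity) fun s hs => ?_
    have hs := Set.uIcc_subset_Icc hp.zero_mem ht hs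
    refine abs_intervalIntegral_le hs hp.T_mem (by positivity) fun r hr => ?_
    obtain ⟨hsr, hr⟩ := hp.uIcc_T_subset hs hr
    rw [abs_mul]
    exact mul_le_mul (hp.abs_kerA_le hsr hs ht) (h r hr) (abs_nonneg _) (by positivity)
  have h2 : |∫ s in t..p.T, p.kerB p.riccatiSol s t * ξ s| ≤ 1 / (2 * p.η) * M * p.T := by
    refine abs_intervalIntegral_le ht hp.T_mem (by positivity) fun s hs => ?_
    obtain ⟨hts, hs⟩ := hp.uIcc_T_subset ht hs
    rw [abs_mul]
    exact mul_le_mul (hp.abs_kerB_le hts) (h s hs) (abs_nonneg _) (by positivity)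
  refine (abs_add_le _ _).trans ((add_le_add h1 h2).trans ?_)
  have hm1 : p.slopeBound * Real.exp (p.slopeBound * p.T) ≤
      max p.slopeBound 1 * Real.exp (p.slopeBound * p.T) :=
    mul_le_mul_of_nonneg_right (le_max_left _ _) he.le
  have hm2 : 1 ≤ max p.slopeBound 1 * Real.exp (p.slopeBound * p.T) :=
    one_le_mul_of_one_le_of_one_le (le_max_right _ _)
      (Real.one_le_exp (mul_nonneg hK.le hT.le))
  unfold opBound
  generalize max p.slopeBound 1 * Real.exp (p.slopeBound * p.T) = N at *
  generalize p.slopeBound * Real.exp (p.slopeBound * p.T) = N' at *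
  rw [show N' / (2 * p.η) * M * p.T * p.T + 1 / (2 * p.η) * M * p.T =
    ((N' * p.T ^ 2 + p.T) / 2) / p.η * M by field_simp]
  gcongr
  nlinarith [mul_le_mul_of_nonneg_right hm1 (sq_nonneg p.T), mul_le_mul_of_nonneg_right hm2 hT.le,
    sq_nonneg p.T]

/-! ### The operator `L̂` -/

lemma continuous_opLhat {E : ℝ → ℝ → ℝ} {F : ℝ → ℝ} (hE : Continuous (Function.uncurry E))
    (hF : Continuous F) :
    Continuous (Function.uncurry (p.opLhat p.riccatiSol (E, F)).1) ∧
      Continuous (p.opLhat p.riccatiSol (E, F)).2 := by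
  have hE' : ∀ {X : Type} [TopologicalSpace X] {s t : X → ℝ}, Continuous s → Continuous t →
      Continuous fun x => E (s x) (t x) := fun hs ht => hE.comp (hs.prodMk ht)
  unfold opLhat
  refine ⟨(Continuous.add ?_ ?_).add ?_, ?_⟩
  · refine continuous_intervalIntegral_of_continuous ?_ (by fun_prop) (by fun_prop)
    refine continuous_intervalIntegral_of_continuous ?_ (by fun_prop) (by fun_prop)
    refine Continuous.mul (hp.continuous_kerA ?_ ?_ ?_) (hE' ?_ ?_) <;> fun_prop
  · refine continuous_intervalIntegral_of_continuous ?_ (by fun_prop) (by fun_prop)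
    refine Continuous.mul (hp.continuous_kerA ?_ ?_ ?_) (Continuous.add ?_ ?_) <;>
      try fun_prop
    refine continuous_intervalIntegral_of_continuous ?_ (by fun_prop) (by fun_prop)
    refine hE' ?_ ?_ <;> fun_prop
  · refine continuous_intervalIntegral_of_continuous ?_ (by fun_prop) (by fun_prop)
    refine Continuous.mul (hp.continuous_kerB ?_ ?_) (hE' ?_ ?_) <;> fun_prop
  · refine continuous_intervalIntegral_of_continuous ?_ (by fun_prop) (by fun_prop)
    refine Continuous.mul (hp.continuous_kerB ?_ ?_) (Continuous.add ?_ ?_) <;>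
      try fun_prop
    refine continuous_intervalIntegral_of_continuous ?_ (by fun_prop) (by fun_prop)
    refine hE' ?_ ?_ <;> fun_prop

lemma opLhat_congr {E E' : ℝ → ℝ → ℝ} {F F' : ℝ → ℝ}
    (hE : ∀ s ∈ Set.Icc 0 p.T, ∀ t ∈ Set.Icc 0 p.T, E s t = E' s t)
    (hF : ∀ t ∈ Set.Icc 0 p.T, F t = F' t) :
    (∀ s ∈ Set.Icc 0 p.T, ∀ t ∈ Set.Icc 0 p.T,
      (p.opLhat p.riccatiSol (E, F)).1 s t = (p.opLhat p.riccatiSol (E', F')).1 s t) ∧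
    ∀ t ∈ Set.Icc 0 p.T,
      (p.opLhat p.riccatiSol (E, F)).2 t = (p.opLhat p.riccatiSol (E', F')).2 t := by
  have hH : ∀ s ∈ Set.Icc 0 p.T, ∀ r ∈ Set.Icc 0 p.T,
      (∫ u in s..r, E u r) + F r = (∫ u in s..r, E' u r) + F' r := fun s hs r hr => by
    rw [hF r hr, intervalIntegral.integral_congr
      fun u hu => hE u (Set.uIcc_subset_Icc hs hr hu) r hr]
  constructor
  · intro s hs t ht
    simp only [opLhat]
    congr 1
    · congr 1
      · refine intervalIntegral.integral_congr fun u hu =>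
          intervalIntegral.integral_congr fun r hr => ?_
        rw [hE s hs r (Set.uIcc_subset_Icc (Set.uIcc_subset_Icc hs ht hu) hp.T_mem hr)]
      · refine intervalIntegral.integral_congr fun r hr => ?_
        rw [hH s hs r (Set.uIcc_subset_Icc hs hp.T_mem hr)]
    · refine intervalIntegral.integral_congr fun u hu => ?_
      rw [hE s hs u (Set.uIcc_subset_Icc ht hp.T_mem hu)]
  · intro t ht
    simp only [opLhat]
    refine intervalIntegral.integral_congr fun r hr => ?_
    rw [hH t ht r (Set.uIcc_subset_Icc ht hp.T_mem hr)]

lemma opLhat_sub_mul {E E' : ℝ → ℝ → ℝ} {F F' : ℝ → ℝ} (hE : Continuous (Function.uncurry E))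
    (hE' : Continuous (Function.uncurry E')) (hF : Continuous F) (hF' : Continuous F') (c : ℝ) :
    (∀ s t, (p.opLhat p.riccatiSol (fun s t => E s t - c * E' s t, fun t => F t - c * F' t)).1 s t =
      (p.opLhat p.riccatiSol (E, F)).1 s t - c * (p.opLhat p.riccatiSol (E', F')).1 s t) ∧
    ∀ t, (p.opLhat p.riccatiSol (fun s t => E s t - c * E' s t, fun t => F t - c * F' t)).2 t =
      (p.opLhat p.riccatiSol (E, F)).2 t - c * (p.opLhat p.riccatiSol (E', F')).2 t := by
  have lin : ∀ {f g : ℝ → ℝ} (a b : ℝ), Continuous f → Continuous g →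
      ∫ x in a..b, (f x - c * g x) = (∫ x in a..b, f x) - c * ∫ x in a..b, g x := by
    intro f g a b hf hg
    rw [intervalIntegral.integral_sub (hf.intervalIntegrable _ _)
      ((hg.const_mul c).intervalIntegrable _ _), intervalIntegral.integral_const_mul]
  have comp : ∀ {E : ℝ → ℝ → ℝ}, Continuous (Function.uncurry E) →
      ∀ {X : Type} [TopologicalSpace X] {s t : X → ℝ}, Continuous s → Continuous t →
      Continuous fun x => E (s x) (t x) := fun hE _ _ _ _ hs ht => hE.comp (hs.prodMk ht)
  have hHc : ∀ {E : ℝ → ℝ → ℝ} {F : ℝ → ℝ}, Continuous (Function.uncurry E) → Continuous F →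
      ∀ s, Continuous fun r => (∫ u in s..r, E u r) + F r := fun hE hF s => by
    refine (continuous_intervalIntegral_of_continuous ?_ (by fun_prop) (by fun_prop)).add hF
    exact comp hE continuous_snd continuous_fst
  have hH : ∀ s r, (∫ u in s..r, (E u r - c * E' u r)) + (F r - c * F' r) =
      ((∫ u in s..r, E u r) + F r) - c * ((∫ u in s..r, E' u r) + F' r) := fun s r => by
    rw [lin s r (comp hE (s := fun u => u) (t := fun _ => r) continuous_id continuous_const)
      (comp hE' (s := fun u => u) (t := fun _ => r) continuous_id continuous_const)]
    ring
  have mul : ∀ {f g : ℝ → ℝ}, Continuous f → Continuous g → Continuous fun x => f x * g x :=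
    fun hf hg => hf.mul hg
  have hA : ∀ s t, Continuous fun r => p.kerA p.riccatiSol r s t := fun s t =>
    hp.continuous_kerA continuous_id continuous_const continuous_const
  have hB : ∀ t, Continuous fun s => p.kerB p.riccatiSol s t := fun t =>
    hp.continuous_kerB continuous_id continuous_const
  have hAA : ∀ {f : ℝ → ℝ} (t : ℝ), Continuous f → Continuous fun s =>
      ∫ r in s..p.T, p.kerA p.riccatiSol r s t * f r := fun t hf => by
    refine continuous_intervalIntegral_of_continuous ?_ (by fun_prop) (by fun_prop)
    refine Continuous.mul (hp.continuous_kerA ?_ ?_ ?_) ?_ <;> fun_prop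
  have hEc : ∀ s, Continuous (E s) := fun s => comp hE continuous_const continuous_id
  have hEc' : ∀ s, Continuous (E' s) := fun s => comp hE' continuous_const continuous_id
  constructor
  · intro s t
    simp only [opLhat, hH, mul_sub, mul_left_comm _ c]
    simp only [lin _ _ (mul (hA _ t) (hEc s)) (mul (hA _ t) (hEc' s)),
      lin _ _ (hAA t (hEc s)) (hAA t (hEc' s)),
      lin _ _ (mul (hA s t) (hHc hE hF s)) (mul (hA s t) (hHc hE' hF' s)),
      lin _ _ (mul (hB t) (hEc s)) (mul (hB t) (hEc' s))]
    ring
  · intro t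
    simp only [opLhat, hH, mul_sub, mul_left_comm _ c]
    exact lin _ _ (mul (hB t) (hHc hE hF t)) (mul (hB t) (hHc hE' hF' t))

/-- The factor 1/(2η) in the bounds of A and B lets both occurrences of T² fit into `opBound`. With
K = `slopeBound`, N' = K e^{KT} and N = max(K, 1) e^{KT}, what is needed is N'T² + (N'T + T)/2 ≤
N(T² + T), and this holds since N' ≤ N and 1 ≤ N. -/
lemma abs_opLhat_le {E : ℝ → ℝ → ℝ} {F : ℝ → ℝ} {M : ℝ} (hM : 0 ≤ M)
    (hE : ∀ s ∈ Set.Icc 0 p.T, ∀ t ∈ Set.Icc 0 p.T, |E s t| ≤ M)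
    (hF : ∀ t ∈ Set.Icc 0 p.T, |F t| ≤ M) :
    (∀ s ∈ Set.Icc 0 p.T, ∀ t ∈ Set.Icc 0 p.T,
      |(p.opLhat p.riccatiSol (E, F)).1 s t| ≤ p.opBound * M) ∧
    ∀ t ∈ Set.Icc 0 p.T, |(p.opLhat p.riccatiSol (E, F)).2 t| ≤ p.opBound * M := by
  have hη := hp.η
  have hT := hp.T
  have hK := hp.slopeBound_pos
  have he := Real.exp_pos (p.slopeBound * p.T)
  have hH : ∀ s ∈ Set.Icc 0 p.T, ∀ r ∈ Set.Icc 0 p.T,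
      |(∫ u in s..r, E u r) + F r| ≤ M * (p.T + 1) := fun s hs r hr => by
    have := abs_intervalIntegral_le hs hr hM fun u hu => hE u (Set.uIcc_subset_Icc hs hr hu) r hr
    linarith [abs_add_le (∫ u in s..r, E u r) (F r), hF r hr]
  have hm1 : p.slopeBound * Real.exp (p.slopeBound * p.T) ≤
      max p.slopeBound 1 * Real.exp (p.slopeBound * p.T) :=
    mul_le_mul_of_nonneg_right (le_max_left _ _) he.le
  have hm2 : 1 ≤ max p.slopeBound 1 * Real.exp (p.slopeBound * p.T) :=
    one_le_mul_of_one_le_of_one_le (le_max_right _ _)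
      (Real.one_le_exp (mul_nonneg hK.le hT.le))
  constructor
  · intro s hs t ht
    have h1 : |∫ u in s..t, ∫ r in u..p.T, p.kerA p.riccatiSol r u t * E s r| ≤
        p.slopeBound * Real.exp (p.slopeBound * p.T) / (2 * p.η) * M * p.T * p.T := by
      refine abs_intervalIntegral_le hs ht (by positivity) fun u hu => ?_
      have hu := Set.uIcc_subset_Icc hs ht hu
      refine abs_intervalIntegral_le hu hp.T_mem (by positivity) fun r hr => ?_
      obtain ⟨hur, hr⟩ := hp.uIcc_T_subset hu hr
      rw [abs_mul]
      exact mul_le_mul (hp.abs_kerA_le hur hu ht) (hE s hs r hr) (abs_nonneg _) (by positivity)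
    have h2 : |∫ r in s..p.T, p.kerA p.riccatiSol r s t * ((∫ u in s..r, E u r) + F r)| ≤
        p.slopeBound * Real.exp (p.slopeBound * p.T) / (2 * p.η) * (M * (p.T + 1)) * p.T := by
      refine abs_intervalIntegral_le hs hp.T_mem (by positivity) fun r hr => ?_
      obtain ⟨hsr, hr⟩ := hp.uIcc_T_subset hs hr
      rw [abs_mul]
      exact mul_le_mul (hp.abs_kerA_le hsr hs ht) (hH s hs r hr) (abs_nonneg _) (by positivity)
    have h3 : |∫ u in t..p.T, p.kerB p.riccatiSol u t * E s u| ≤ 1 / (2 * p.η) * M * p.T := by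
      refine abs_intervalIntegral_le ht hp.T_mem (by positivity) fun u hu => ?_
      obtain ⟨htu, hu⟩ := hp.uIcc_T_subset ht hu
      rw [abs_mul]
      exact mul_le_mul (hp.abs_kerB_le htu) (hE s hs u hu) (abs_nonneg _) (by positivity)
    refine (abs_add_le _ _).trans ((add_le_add ((abs_add_le _ _).trans (add_le_add h1 h2))
      h3).trans ?_)
    unfold opBound
    generalize max p.slopeBound 1 * Real.exp (p.slopeBound * p.T) = N at *
    generalize p.slopeBound * Real.exp (p.slopeBound * p.T) = N' at *
    rw [show N' / (2 * p.η) * M * p.T * p.T + N' / (2 * p.η) * (M * (p.T + 1)) * p.T +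
      1 / (2 * p.η) * M * p.T = (N' * p.T ^ 2 + (N' * p.T + p.T) / 2) / p.η * M by
        field_simp; ring]
    gcongr
    nlinarith [mul_le_mul_of_nonneg_right hm1 (sq_nonneg p.T),
      mul_le_mul_of_nonneg_right hm2 hT.le, mul_le_mul_of_nonneg_right hm1 hT.le]
  · intro t ht
    have h1 : |∫ s in t..p.T, p.kerB p.riccatiSol s t * ((∫ u in t..s, E u s) + F s)| ≤
        1 / (2 * p.η) * (M * (p.T + 1)) * p.T := by
      refine abs_intervalIntegral_le ht hp.T_mem (by positivity) fun s hs => ?_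
      obtain ⟨hts, hs⟩ := hp.uIcc_T_subset ht hs
      rw [abs_mul]
      exact mul_le_mul (hp.abs_kerB_le hts) (hH t ht s hs) (abs_nonneg _) (by positivity)
    refine h1.trans ?_
    unfold opBound
    generalize max p.slopeBound 1 * Real.exp (p.slopeBound * p.T) = N at *
    rw [show 1 / (2 * p.η) * (M * (p.T + 1)) * p.T = ((p.T ^ 2 + p.T) / 2) / p.η * M by
        field_simp]
    gcongr
    nlinarith [mul_le_mul_of_nonneg_right hm2 (sq_nonneg p.T),
      mul_le_mul_of_nonneg_right hm2 hT.le, sq_nonneg p.T]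

end Positive

end TraderParams

/-! ### Wronskian identities and solutions of the integral equations -/

namespace TraderParams

/-- The coefficient of the current signal in the equilibrium rate. -/
def signalCoef (p : TraderParams) (t : ℝ) : ℝ :=
  (-(p.a / p.η) * Real.exp (p.b / (2 * p.η) * (p.T - t)) - p.crowdDeriv t) /
    (2 * p.φ * p.crowd t)

/-- `signalCoef / crowd`, frozen after the terminal time. -/
def signalRatio (p : TraderParams) (t : ℝ) : ℝ :=
  p.signalCoef (min t p.T) / p.crowd (min t p.T)

/-- The coefficient of the signal at time `s` in the equilibrium rate at time `t`. -/
def memoryKernel (p : TraderParams) (s t : ℝ) : ℝ := p.signalRatio s * p.crowdDeriv t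

/-- `signalCoef`, frozen after the terminal time. -/
def currentKernel (p : TraderParams) (t : ℝ) : ℝ := p.signalCoef (min t p.T)

/-- The Wronskian of `solo` and `crowd`. -/
def wronskian (p : TraderParams) (t : ℝ) : ℝ :=
  p.solo t * p.crowdDeriv t - p.soloDeriv t * p.crowd t

variable {p : TraderParams}

@[fun_prop]
lemma continuous_wronskian : Continuous p.wronskian := by
  unfold wronskian
  fun_prop

namespace Positive

variable (hp : p.Positive)
include hp

lemma analyticAt_signalCoef {t : ℝ} (ht : t ≤ p.T) : AnalyticAt ℝ p.signalCoef t := by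
  have h0 := (hp.crowd_pos ht).ne'
  have hφ := hp.φ.ne'
  unfold signalCoef
  refine AnalyticAt.div ?_ ?_ (by positivity)
  · have : AnalyticAt ℝ (fun t => Real.exp (p.b / (2 * p.η) * (p.T - t))) t := by fun_prop
    fun_prop
  · fun_prop

/-- This equation is the reason for the choice of `signalCoef`: for a constant signal M it makes x =
vP with P' = (g/v)M a solution of x'' = κx - δx' - M/(2η), the equation of the mean inventory. -/
lemma hasDerivAt_signalCoef {t : ℝ} (ht : t ≤ p.T) :
    HasDerivAt p.signalCoef (-(p.b / (2 * p.η) * p.signalCoef t) - 1 / (2 * p.η) -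
      p.signalCoef t * p.crowdDeriv t / p.crowd t) t := by
  have h0 := (hp.crowd_pos ht).ne'
  have hφ := hp.φ.ne'
  have hη := hp.η.ne'
  have he : HasDerivAt (fun t => Real.exp (p.b / (2 * p.η) * (p.T - t)))
      (Real.exp (p.b / (2 * p.η) * (p.T - t)) * (p.b / (2 * p.η) * -1)) t :=
    (((hasDerivAt_id t).const_sub p.T).const_mul _).exp
  have h := ((he.const_mul (-(p.a / p.η))).sub (hp.hasDerivAt_crowdDeriv t)).div
    ((hasDerivAt_crowd t).const_mul (2 * p.φ)) (by positivity)
  refine h.congr_deriv ?_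
  unfold signalCoef
  simp only [Pi.sub_apply]
  field_simp
  ring

lemma signalCoef_terminal : p.signalCoef p.T = 0 := by
  simp [signalCoef, hp.crowdDeriv_terminal]

lemma continuous_currentKernel : Continuous p.currentKernel := by
  refine continuous_iff_continuousAt.2 fun t => ?_
  exact (hp.analyticAt_signalCoef (min_le_right t p.T)).continuousAt.comp
    (f := fun t : ℝ => min t p.T) (by fun_prop)

lemma continuous_signalRatio : Continuous p.signalRatio := by
  unfold signalRatio
  exact hp.continuous_currentKernel.div (by fun_prop)
    fun t => (hp.crowd_pos (min_le_right _ _)).ne'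

lemma continuous_memoryKernel : Continuous (Function.uncurry p.memoryKernel) := by
  have := hp.continuous_signalRatio
  unfold memoryKernel
  exact (this.comp continuous_fst).mul (continuous_crowdDeriv.comp continuous_snd)

omit hp in
lemma signalRatio_eq {t : ℝ} (ht : t ≤ p.T) : p.signalRatio t = p.signalCoef t / p.crowd t := by
  rw [signalRatio, min_eq_left ht]

omit hp in
lemma currentKernel_eq {t : ℝ} (ht : t ≤ p.T) : p.currentKernel t = p.signalCoef t := by
  rw [currentKernel, min_eq_left ht]

/-- The equations of `solo` and `crowd` share their zeroth order term, so only the drift of `crowd`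
survives. -/
lemma hasDerivAt_wronskian (t : ℝ) :
    HasDerivAt p.wronskian (-(p.b / (2 * p.η)) * (p.solo t * p.crowdDeriv t)) t := by
  refine (((hasDerivAt_solo t).mul (hp.hasDerivAt_crowdDeriv t)).sub
    ((hp.hasDerivAt_soloDeriv t).mul (hasDerivAt_crowd t))).congr_deriv ?_
  ring

lemma wronskian_terminal : p.wronskian p.T = 0 := by
  simp [wronskian, hp.solo_terminal, hp.soloDeriv_terminal, hp.crowd_terminal,
    hp.crowdDeriv_terminal]

lemma integral_solo_mul_crowdDeriv (s : ℝ) :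
    p.b / (2 * p.η) * ∫ r in s..p.T, p.solo r * p.crowdDeriv r = p.wronskian s := by
  have h := intervalIntegral.integral_eq_sub_of_hasDerivAt (a := s) (b := p.T)
    (fun r _ => hp.hasDerivAt_wronskian r)
    ((by fun_prop : Continuous fun r => -(p.b / (2 * p.η)) *
      (p.solo r * p.crowdDeriv r)).intervalIntegrable _ _)
  rw [intervalIntegral.integral_const_mul, hp.wronskian_terminal] at h
  linarith

lemma integral_wronskian_div {s t : ℝ} (hs : s ≤ p.T) (ht : t ≤ p.T) :
    ∫ r in s..t, p.wronskian r / p.solo r ^ 2 = p.crowd t / p.solo t - p.crowd s / p.solo s := by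
  have hle : ∀ r ∈ Set.uIcc s t, p.solo r ≠ 0 := fun r hr =>
    (hp.solo_pos (hr.2.trans (max_le hs ht))).ne'
  refine intervalIntegral.integral_eq_sub_of_hasDerivAt (f := fun r => p.crowd r / p.solo r) ?_ ?_
  · intro r hr
    refine ((hasDerivAt_crowd r).div (hasDerivAt_solo r) (hle r hr)).congr_deriv ?_
    rw [wronskian]
    ring
  · refine ContinuousOn.intervalIntegrable ?_
    exact continuous_wronskian.continuousOn.div (by fun_prop) fun r hr => pow_ne_zero 2 (hle r hr)

lemma slope_div_eq {t : ℝ} (ht : t ≤ p.T) :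
    (p.riccatiSol t - 2 * p.a) / (4 * p.η ^ 2) = p.soloDeriv t / p.solo t / (2 * p.η) := by
  have := hp.η.ne'
  rw [← hp.slope_eq_of_le ht]
  field_simp
  ring

/-- The variables separate, so that every integral against A over [s, T] is a multiple of ∫_s^T
`solo` · f. -/
lemma kerA_eq {r s t : ℝ} (hr : r ≤ p.T) (hs : s ≤ p.T) (ht : t ≤ p.T) :
    p.kerA p.riccatiSol r s t = p.soloDeriv t / (2 * p.η) / p.solo s ^ 2 * p.solo r := by
  have := hp.η.ne'
  have h1 := (hp.solo_pos hs).ne'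
  have h2 := (hp.solo_pos ht).ne'
  rw [kerA, hp.slope_div_eq ht, hp.Gam_eq hs hr, hp.Gam_eq hs ht]
  field_simp

lemma kerB_eq {s t : ℝ} (hs : s ≤ p.T) (ht : t ≤ p.T) :
    p.kerB p.riccatiSol s t = 1 / (2 * p.η) / p.solo t * p.solo s := by
  rw [kerB, hp.Gam_eq ht hs]
  ring

omit hp in
lemma le_T_of_mem_uIcc {s t r : ℝ} (hs : s ≤ p.T) (ht : t ≤ p.T) (hr : r ∈ Set.uIcc s t) :
    r ≤ p.T := hr.2.trans (max_le hs ht)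

lemma integral_kerA {s t : ℝ} (hs : s ≤ p.T) (ht : t ≤ p.T) (f : ℝ → ℝ) :
    ∫ r in s..p.T, p.kerA p.riccatiSol r s t * f r =
      p.soloDeriv t / (2 * p.η) / p.solo s ^ 2 * ∫ r in s..p.T, p.solo r * f r := by
  rw [← intervalIntegral.integral_const_mul]
  refine intervalIntegral.integral_congr fun r hr => ?_
  rw [hp.kerA_eq (le_T_of_mem_uIcc hs le_rfl hr) hs ht]
  ring

lemma integral_kerB {t : ℝ} (ht : t ≤ p.T) (f : ℝ → ℝ) :
    ∫ r in t..p.T, p.kerB p.riccatiSol r t * f r =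
      1 / (2 * p.η) / p.solo t * ∫ r in t..p.T, p.solo r * f r := by
  rw [← intervalIntegral.integral_const_mul]
  refine intervalIntegral.integral_congr fun r hr => ?_
  rw [hp.kerB_eq (le_T_of_mem_uIcc ht le_rfl hr) ht]
  ring

lemma integral_Gam {s : ℝ} (hs : s ≤ p.T) (f : ℝ → ℝ) :
    ∫ r in s..p.T, p.Gam p.riccatiSol s r * f r =
      1 / p.solo s * ∫ r in s..p.T, p.solo r * f r := by
  rw [← intervalIntegral.integral_const_mul]
  refine intervalIntegral.integral_congr fun r hr => ?_
  rw [hp.Gam_eq hs (le_T_of_mem_uIcc hs le_rfl hr)]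
  ring

/-- `b L` applied to `crowdDeriv`, with initial time `s`. -/
lemma opL_crowdDeriv {s t : ℝ} (hs : s ≤ p.T) (ht : t ≤ p.T) :
    p.b * ((∫ u in s..t, ∫ r in u..p.T, p.kerA p.riccatiSol r u t * p.crowdDeriv r) +
      ∫ u in t..p.T, p.kerB p.riccatiSol u t * p.crowdDeriv u) =
    p.crowdDeriv t - p.soloDeriv t / p.solo s * p.crowd s := by
  have hη := hp.η.ne'
  have hb := hp.b.ne'
  have h1 := (hp.solo_pos hs).ne'
  have h2 := (hp.solo_pos ht).ne'
  -- Both inner integrals reduce to the Wronskian; the remaining outer integral of W/u² is then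
  -- exact, with primitive v/u.
  have hw : ∀ u, ∫ r in u..p.T, p.solo r * p.crowdDeriv r = 2 * p.η / p.b * p.wronskian u :=
    fun u => by
      rw [← hp.integral_solo_mul_crowdDeriv u]
      field_simp
  have hA : ∫ u in s..t, ∫ r in u..p.T, p.kerA p.riccatiSol r u t * p.crowdDeriv r =
      p.soloDeriv t / p.b * (p.crowd t / p.solo t - p.crowd s / p.solo s) := by
    rw [← hp.integral_wronskian_div hs ht, ← intervalIntegral.integral_const_mul]
    refine intervalIntegral.integral_congr fun u hu => ?_
    rw [hp.integral_kerA (le_T_of_mem_uIcc hs ht hu) ht, hw]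
    field_simp
  rw [hA, hp.integral_kerB ht, hw, wronskian]
  field_simp
  ring

omit hp in
lemma integral_memoryKernel (s r : ℝ) :
    ∫ v in s..r, p.memoryKernel v r = (∫ v in s..r, p.signalRatio v) * p.crowdDeriv r := by
  simp only [memoryKernel, intervalIntegral.integral_mul_const]

/-- The integrand is the derivative in r of -2η(PW + ug), where P(r) is the integral of
`signalRatio` from s to r. W and g vanish at T, and P vanishes at s. -/
lemma integral_solo_response {s : ℝ} (hs : s ≤ p.T) :
    ∫ r in s..p.T, p.solo r *
      (1 + p.b * ((∫ v in s..r, p.memoryKernel v r) + p.currentKernel r)) =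
      2 * p.η * p.solo s * p.signalCoef s := by
  have hη := hp.η.ne'
  set P : ℝ → ℝ := fun r => ∫ v in s..r, p.signalRatio v with hP
  have hPd : ∀ r, HasDerivAt P (p.signalRatio r) r := fun r =>
    intervalIntegral.integral_hasDerivAt_right (hp.continuous_signalRatio.intervalIntegrable _ _)
      (hp.continuous_signalRatio.stronglyMeasurableAtFilter _ _)
      hp.continuous_signalRatio.continuousAt
  have hPc : Continuous P := continuous_iff_continuousAt.2 fun r => (hPd r).continuousAt
  have hd : ∀ r ∈ Set.uIcc s p.T, HasDerivAt
      (fun r => -(2 * p.η) * (P r * p.wronskian r + p.solo r * p.signalCoef r))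
      (p.solo r * (1 + p.b * ((∫ v in s..r, p.memoryKernel v r) + p.currentKernel r))) r := by
    intro r hr
    have hr := le_T_of_mem_uIcc hs le_rfl hr
    have h0 := (hp.crowd_pos hr).ne'
    refine ((((hPd r).mul (hp.hasDerivAt_wronskian r)).add
      ((hasDerivAt_solo r).mul (hp.hasDerivAt_signalCoef hr))).const_mul _).congr_deriv ?_
    rw [integral_memoryKernel, signalRatio_eq hr, currentKernel_eq hr, wronskian]
    simp only [hP]
    field_simp
    ring
  rw [intervalIntegral.integral_eq_sub_of_hasDerivAt hd]
  · simp only [hp.signalCoef_terminal, hp.wronskian_terminal, hP, intervalIntegral.integral_same]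
    ring
  · have := hp.continuous_currentKernel
    simp only [integral_memoryKernel]
    exact (by fun_prop : Continuous fun r => p.solo r *
      (1 + p.b * (P r * p.crowdDeriv r + p.currentKernel r))).intervalIntegrable _ _

lemma continuous_response (s : ℝ) :
    Continuous fun r => (∫ v in s..r, p.memoryKernel v r) + p.currentKernel r := by
  have h1 := hp.continuous_currentKernel
  have h2 : Continuous fun r => ∫ v in s..r, p.signalRatio v :=
    intervalIntegral.continuous_primitive
      (fun a b => hp.continuous_signalRatio.intervalIntegrable a b) s
  simp only [integral_memoryKernel]
  fun_prop

lemma integral_solo_response' {s : ℝ} (hs : s ≤ p.T) :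
    (∫ r in s..p.T, p.solo r) + p.b * ∫ r in s..p.T, p.solo r *
      ((∫ v in s..r, p.memoryKernel v r) + p.currentKernel r) =
      2 * p.η * p.solo s * p.signalCoef s := by
  have h := hp.continuous_response s
  rw [← hp.integral_solo_response hs, ← intervalIntegral.integral_const_mul,
    ← intervalIntegral.integral_add (continuous_solo.intervalIntegrable _ _)
      ((by fun_prop : Continuous fun r => p.b * (p.solo r *
        ((∫ v in s..r, p.memoryKernel v r) + p.currentKernel r))).intervalIntegrable _ _)]
  exact intervalIntegral.integral_congr fun r _ => by ring

lemma integral_Gam_one {s : ℝ} (hs : s ≤ p.T) :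
    ∫ r in s..p.T, p.Gam p.riccatiSol s r = 1 / p.solo s * ∫ r in s..p.T, p.solo r := by
  simpa using hp.integral_Gam hs fun _ => 1

/-- In the first and the third integral of L̂₁ the factor `signalRatio s` comes out and leaves
`opL_crowdDeriv` with initial time s. The second integral is the response to a signal given at s,
known from `integral_solo_response'`. -/
lemma kerC_eq {s t : ℝ} (hs : s ≤ p.T) (ht : t ≤ p.T) :
    p.kerC p.riccatiSol s t = p.memoryKernel s t -
      p.b * (p.opLhat p.riccatiSol (p.memoryKernel, p.currentKernel)).1 s t := by
  have hη := hp.η.ne'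
  have h1 := (hp.solo_pos hs).ne'
  have h2 := (hp.solo_pos ht).ne'
  have h3 := (hp.crowd_pos hs).ne'
  have hL := hp.opL_crowdDeriv hs ht
  have hR := hp.integral_solo_response' hs
  have e1 : ∫ u in s..t, ∫ r in u..p.T, p.kerA p.riccatiSol r u t * p.memoryKernel s r =
      p.signalRatio s * ∫ u in s..t, ∫ r in u..p.T, p.kerA p.riccatiSol r u t * p.crowdDeriv r := by
    simp only [memoryKernel, mul_left_comm _ (p.signalRatio s),
      intervalIntegral.integral_const_mul]
  have e2 : ∫ u in t..p.T, p.kerB p.riccatiSol u t * p.memoryKernel s u =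
      p.signalRatio s * ∫ u in t..p.T, p.kerB p.riccatiSol u t * p.crowdDeriv u := by
    simp only [memoryKernel, mul_left_comm _ (p.signalRatio s),
      intervalIntegral.integral_const_mul]
  simp only [opLhat]
  rw [e1, e2, hp.integral_kerA hs ht, kerC, hp.slope_div_eq ht, hp.Gam_eq hs ht,
    hp.integral_Gam_one hs, memoryKernel]
  have e3 : p.signalRatio s * p.crowd s = p.signalCoef s := by
    rw [signalRatio_eq hs, div_mul_cancel₀ _ h3]
  generalize (∫ r in s..p.T, p.solo r *
      ((∫ v in s..r, p.memoryKernel v r) + p.currentKernel r)) = I at *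
  generalize (∫ r in s..p.T, p.solo r) = I' at *
  have hI : I' = 2 * p.η * p.solo s * p.signalCoef s - p.b * I := by linarith
  have hL' := congrArg (p.signalRatio s * ·) hL
  rw [hI]
  field_simp at hL' ⊢
  linear_combination (2 * p.η * p.solo s) * hL' +
    (-2 * p.η * p.solo s * p.soloDeriv t) * e3

lemma kerD_eq {t : ℝ} (ht : t ≤ p.T) :
    p.kerD p.riccatiSol t = p.currentKernel t -
      p.b * (p.opLhat p.riccatiSol (p.memoryKernel, p.currentKernel)).2 t := by
  have hη := hp.η.ne'
  have h2 := (hp.solo_pos ht).ne'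
  have hR := hp.integral_solo_response' ht
  simp only [opLhat]
  rw [hp.integral_kerB ht, kerD, hp.integral_Gam_one ht, currentKernel_eq ht]
  field_simp
  linear_combination hR

lemma zCoef_eq {t : ℝ} (ht : t ≤ p.T) :
    p.zCoef p.riccatiSol t = p.soloDeriv t / p.solo 0 := by
  have h2 := (hp.solo_pos ht).ne'
  rw [zCoef, hp.slope_eq_of_le ht, hp.Gam_eq hp.T.le ht]
  field_simp

/-- This is `opL_crowdDeriv` with initial time 0, divided by `crowd 0`. -/
lemma zCoef_eq_sub {t : ℝ} (ht : t ≤ p.T) :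
    p.zCoef p.riccatiSol t = p.crowdDeriv t / p.crowd 0 -
      p.b * p.opL p.riccatiSol (fun r => p.crowdDeriv r / p.crowd 0) t := by
  have h3 := (hp.crowd_pos hp.T.le).ne'
  have hL := hp.opL_crowdDeriv hp.T.le ht
  rw [hp.zCoef_eq ht]
  simp only [opL, div_eq_mul_inv, ← mul_assoc, intervalIntegral.integral_mul_const]
  simp only [div_eq_mul_inv] at hL
  rw [← add_mul, ← mul_assoc, hL]
  field_simp
  ring

end Positive

end TraderParams

namespace TraderParams

variable {p : TraderParams}

lemma opLhat_iterate_succ (γ : ℝ → ℝ) (k : ℕ) (EF : (ℝ → ℝ → ℝ) × (ℝ → ℝ)) :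
    (p.opLhat γ)^[k + 1] EF =
      p.opLhat γ (((p.opLhat γ)^[k] EF).1, ((p.opLhat γ)^[k] EF).2) :=
  Function.iterate_succ_apply' _ _ _

namespace Positive

variable (hp : p.Positive)
include hp

/-! ### The Neumann series -/

lemma continuous_iterate_opL {ξ : ℝ → ℝ} (hξ : Continuous ξ) (k : ℕ) :
    Continuous ((p.opL p.riccatiSol)^[k] ξ) := by
  induction k with
  | zero => exact hξ
  | succ k ih =>
    rw [Function.iterate_succ_apply']
    exact hp.continuous_opL ih

lemma abs_iterate_opL_le {ξ : ℝ → ℝ} {M : ℝ} (hM : 0 ≤ M) (h : ∀ t ∈ Set.Icc 0 p.T, |ξ t| ≤ M)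
    (k : ℕ) : ∀ t ∈ Set.Icc 0 p.T, |(p.opL p.riccatiSol)^[k] ξ t| ≤ p.opBound ^ k * M := by
  induction k with
  | zero => simpa using h
  | succ k ih =>
    intro t ht
    have := hp.opBound_pos
    rw [Function.iterate_succ_apply', pow_succ', mul_assoc]
    exact hp.abs_opL_le (by positivity) ih ht

lemma iterate_opL_eq_sub {ξ ζ : ℝ → ℝ} (hξ : Continuous ξ)
    (h : ∀ t ∈ Set.Icc 0 p.T, ζ t = ξ t - p.b * p.opL p.riccatiSol ξ t) (k : ℕ) :
    ∀ t ∈ Set.Icc 0 p.T, (p.opL p.riccatiSol)^[k] ζ t =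
      (p.opL p.riccatiSol)^[k] ξ t - p.b * (p.opL p.riccatiSol)^[k + 1] ξ t := by
  induction k with
  | zero => exact h
  | succ k ih =>
    intro t ht
    rw [Function.iterate_succ_apply', hp.opL_congr ih ht,
      hp.opL_sub_mul (hp.continuous_iterate_opL hξ k) (hp.continuous_iterate_opL hξ (k + 1)),
      ← Function.iterate_succ_apply' (p.opL p.riccatiSol),
      ← Function.iterate_succ_apply' (p.opL p.riccatiSol)]

/-- With a_k = b^k L^k ξ the k-th term is a_k - a_{k+1}, and |a_k| ≤ M (b · `opBound`)^k. A known
solution of the integral equation is thus identified as the sum of the series. -/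
lemma hasSum_iterate_opL (hθ : p.b * p.opBound < 1) {ξ ζ : ℝ → ℝ} (hξ : Continuous ξ)
    (h : ∀ t ∈ Set.Icc 0 p.T, ζ t = ξ t - p.b * p.opL p.riccatiSol ξ t) {t : ℝ}
    (ht : t ∈ Set.Icc 0 p.T) :
    HasSum (fun k : ℕ => p.b ^ k * (p.opL p.riccatiSol)^[k] ζ t) (ξ t) := by
  have hb := hp.b
  have hB := hp.opBound_pos
  obtain ⟨M, hM⟩ := isCompact_Icc.exists_bound_of_continuousOn (hξ.continuousOn
    (s := Set.Icc 0 p.T))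
  have hM0 : 0 ≤ M := (norm_nonneg _).trans (hM t ht)
  have := hasSum_sub_succ_of_geometric_bound
    (a := fun k => p.b ^ k * (p.opL p.riccatiSol)^[k] ξ t) (M := M) (by positivity) hθ
    fun k => by
      rw [abs_mul, abs_of_pos (by positivity), mul_pow]
      calc _ ≤ p.b ^ k * (p.opBound ^ k * M) :=
            mul_le_mul_of_nonneg_left (hp.abs_iterate_opL_le hM0 hM k t ht) (by positivity)
        _ = _ := by ring
  simp only [pow_zero, one_mul, Function.iterate_zero, id_eq] at this
  refine this.congr_fun ?_
  intro k
  rw [hp.iterate_opL_eq_sub hξ h k t ht]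
  ring

lemma continuous_iterate_opLhat {E : ℝ → ℝ → ℝ} {F : ℝ → ℝ}
    (hE : Continuous (Function.uncurry E)) (hF : Continuous F) (k : ℕ) :
    Continuous (Function.uncurry ((p.opLhat p.riccatiSol)^[k] (E, F)).1) ∧
      Continuous ((p.opLhat p.riccatiSol)^[k] (E, F)).2 := by
  induction k with
  | zero => exact ⟨hE, hF⟩
  | succ k ih =>
    rw [opLhat_iterate_succ]
    exact hp.continuous_opLhat ih.1 ih.2

lemma abs_iterate_opLhat_le {E : ℝ → ℝ → ℝ} {F : ℝ → ℝ} {M : ℝ} (hM : 0 ≤ M)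
    (hE : ∀ s ∈ Set.Icc 0 p.T, ∀ t ∈ Set.Icc 0 p.T, |E s t| ≤ M)
    (hF : ∀ t ∈ Set.Icc 0 p.T, |F t| ≤ M) (k : ℕ) :
    (∀ s ∈ Set.Icc 0 p.T, ∀ t ∈ Set.Icc 0 p.T,
      |((p.opLhat p.riccatiSol)^[k] (E, F)).1 s t| ≤ p.opBound ^ k * M) ∧
    ∀ t ∈ Set.Icc 0 p.T,
      |((p.opLhat p.riccatiSol)^[k] (E, F)).2 t| ≤ p.opBound ^ k * M := by
  induction k with
  | zero =>
    simp only [pow_zero, one_mul, Function.iterate_zero, id_eq]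
    exact ⟨hE, hF⟩
  | succ k ih =>
    have := hp.opBound_pos
    rw [opLhat_iterate_succ, pow_succ', mul_assoc]
    exact hp.abs_opLhat_le (by positivity) ih.1 ih.2

lemma iterate_opLhat_eq_sub {E C : ℝ → ℝ → ℝ} {F D : ℝ → ℝ}
    (hE : Continuous (Function.uncurry E)) (hF : Continuous F)
    (hC : ∀ s ∈ Set.Icc 0 p.T, ∀ t ∈ Set.Icc 0 p.T,
      C s t = E s t - p.b * (p.opLhat p.riccatiSol (E, F)).1 s t)
    (hD : ∀ t ∈ Set.Icc 0 p.T, D t = F t - p.b * (p.opLhat p.riccatiSol (E, F)).2 t) (k : ℕ) :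
    (∀ s ∈ Set.Icc 0 p.T, ∀ t ∈ Set.Icc 0 p.T,
      ((p.opLhat p.riccatiSol)^[k] (C, D)).1 s t =
        ((p.opLhat p.riccatiSol)^[k] (E, F)).1 s t -
          p.b * ((p.opLhat p.riccatiSol)^[k + 1] (E, F)).1 s t) ∧
    ∀ t ∈ Set.Icc 0 p.T,
      ((p.opLhat p.riccatiSol)^[k] (C, D)).2 t =
        ((p.opLhat p.riccatiSol)^[k] (E, F)).2 t -
          p.b * ((p.opLhat p.riccatiSol)^[k + 1] (E, F)).2 t := by
  induction k with
  | zero => exact ⟨hC, hD⟩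
  | succ k ih =>
    have h0 := hp.continuous_iterate_opLhat hE hF k
    have h1 := hp.continuous_iterate_opLhat hE hF (k + 1)
    have hl := hp.opLhat_sub_mul h0.1 h1.1 h0.2 h1.2 p.b
    have hc := hp.opLhat_congr ih.1 ih.2
    rw [opLhat_iterate_succ, opLhat_iterate_succ _ (k + 1) (E, F)]
    refine ⟨fun s hs t ht => ?_, fun t ht => ?_⟩
    · rw [hc.1 s hs t ht, hl.1, opLhat_iterate_succ _ k (E, F)]
    · rw [hc.2 t ht, hl.2, opLhat_iterate_succ _ k (E, F)]

lemma exists_bound_kernels : ∃ M, 0 ≤ M ∧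
    (∀ s ∈ Set.Icc 0 p.T, ∀ t ∈ Set.Icc 0 p.T, |p.memoryKernel s t| ≤ M) ∧
    ∀ t ∈ Set.Icc 0 p.T, |p.currentKernel t| ≤ M := by
  obtain ⟨M, hM⟩ := (isCompact_Icc (a := (0 : ℝ)) (b := p.T)).prod
    (isCompact_Icc (a := (0 : ℝ)) (b := p.T)) |>.exists_bound_of_continuousOn
    hp.continuous_memoryKernel.continuousOn
  obtain ⟨M', hM'⟩ := isCompact_Icc.exists_bound_of_continuousOn
    (hp.continuous_currentKernel.continuousOn (s := Set.Icc 0 p.T))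
  have h0 := hM' _ hp.zero_mem
  exact ⟨max M M', (norm_nonneg _).trans (h0.trans (le_max_right _ _)),
    fun s hs t ht => (hM (s, t) ⟨hs, ht⟩).trans (le_max_left _ _),
    fun t ht => (hM' t ht).trans (le_max_right _ _)⟩

lemma iterate_kernels_eq_sub (k : ℕ) :
    (∀ s ∈ Set.Icc 0 p.T, ∀ t ∈ Set.Icc 0 p.T, p.LhatIter₁ p.riccatiSol k s t =
      ((p.opLhat p.riccatiSol)^[k] (p.memoryKernel, p.currentKernel)).1 s t -
        p.b * ((p.opLhat p.riccatiSol)^[k + 1] (p.memoryKernel, p.currentKernel)).1 s t) ∧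
    ∀ t ∈ Set.Icc 0 p.T, p.LhatIter₂ p.riccatiSol k t =
      ((p.opLhat p.riccatiSol)^[k] (p.memoryKernel, p.currentKernel)).2 t -
        p.b * ((p.opLhat p.riccatiSol)^[k + 1] (p.memoryKernel, p.currentKernel)).2 t :=
  hp.iterate_opLhat_eq_sub hp.continuous_memoryKernel hp.continuous_currentKernel
    (fun _ hs _ ht => hp.kerC_eq hs.2 ht.2) (fun _ ht => hp.kerD_eq ht.2) k

lemma hasSum_LhatIter₁ (hθ : p.b * p.opBound < 1) {s t : ℝ} (hs : s ∈ Set.Icc 0 p.T)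
    (ht : t ∈ Set.Icc 0 p.T) :
    HasSum (fun k : ℕ => p.b ^ k * p.LhatIter₁ p.riccatiSol k s t) (p.memoryKernel s t) := by
  have hb := hp.b
  have hB := hp.opBound_pos
  obtain ⟨M, hM0, hM, hM'⟩ := hp.exists_bound_kernels
  have := hasSum_sub_succ_of_geometric_bound (a := fun k => p.b ^ k *
    ((p.opLhat p.riccatiSol)^[k] (p.memoryKernel, p.currentKernel)).1 s t) (M := M)
    (by positivity) hθ fun k => by
      rw [abs_mul, abs_of_pos (by positivity), mul_pow]
      calc _ ≤ p.b ^ k * (p.opBound ^ k * M) := mul_le_mul_of_nonneg_left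
            ((hp.abs_iterate_opLhat_le hM0 hM hM' k).1 s hs t ht) (by positivity)
        _ = _ := by ring
  simp only [pow_zero, one_mul, Function.iterate_zero, id_eq] at this
  refine this.congr_fun ?_
  intro k
  rw [(hp.iterate_kernels_eq_sub k).1 s hs t ht]
  ring

lemma hasSum_LhatIter₂ (hθ : p.b * p.opBound < 1) {t : ℝ} (ht : t ∈ Set.Icc 0 p.T) :
    HasSum (fun k : ℕ => p.b ^ k * p.LhatIter₂ p.riccatiSol k t) (p.currentKernel t) := by
  have hb := hp.b
  have hB := hp.opBound_pos
  obtain ⟨M, hM0, hM, hM'⟩ := hp.exists_bound_kernels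
  have := hasSum_sub_succ_of_geometric_bound (a := fun k => p.b ^ k *
    ((p.opLhat p.riccatiSol)^[k] (p.memoryKernel, p.currentKernel)).2 t) (M := M)
    (by positivity) hθ fun k => by
      rw [abs_mul, abs_of_pos (by positivity), mul_pow]
      calc _ ≤ p.b ^ k * (p.opBound ^ k * M) := mul_le_mul_of_nonneg_left
            ((hp.abs_iterate_opLhat_le hM0 hM hM' k).2 t ht) (by positivity)
        _ = _ := by ring
  simp only [pow_zero, one_mul, Function.iterate_zero, id_eq] at this
  refine this.congr_fun ?_
  intro k
  rw [(hp.iterate_kernels_eq_sub k).2 t ht]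
  ring

/-- The integrated terms telescope by themselves, which avoids an exchange of sum and integral. -/
lemma hasSum_integral_LhatIter₁ (hθ : p.b * p.opBound < 1) {s t : ℝ} (hs : s ∈ Set.Icc 0 p.T)
    (ht : t ∈ Set.Icc 0 p.T) :
    HasSum (fun k : ℕ => p.b ^ k * ∫ u in s..t, p.LhatIter₁ p.riccatiSol k u t)
      (∫ u in s..t, p.memoryKernel u t) := by
  have hb := hp.b
  have hB := hp.opBound_pos
  have hT := hp.T
  obtain ⟨M, hM0, hM, hM'⟩ := hp.exists_bound_kernels
  have := hasSum_sub_succ_of_geometric_bound (a := fun k => p.b ^ k * ∫ u in s..t,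
    ((p.opLhat p.riccatiSol)^[k] (p.memoryKernel, p.currentKernel)).1 u t) (M := M * p.T)
    (by positivity) hθ fun k => by
      rw [abs_mul, abs_of_pos (by positivity), mul_pow]
      calc _ ≤ p.b ^ k * (p.opBound ^ k * M * p.T) := by
            refine mul_le_mul_of_nonneg_left (abs_intervalIntegral_le hs ht (by positivity)
              fun u hu => ?_) (by positivity)
            exact (hp.abs_iterate_opLhat_le hM0 hM hM' k).1 u (Set.uIcc_subset_Icc hs ht hu) t ht
        _ = _ := by ring
  simp only [pow_zero, one_mul, Function.iterate_zero, id_eq] at this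
  refine this.congr_fun ?_
  intro k
  have hc : ∀ k, Continuous fun u =>
      ((p.opLhat p.riccatiSol)^[k] (p.memoryKernel, p.currentKernel)).1 u t := fun k =>
    (hp.continuous_iterate_opLhat hp.continuous_memoryKernel hp.continuous_currentKernel k).1.comp
      (continuous_id.prodMk continuous_const)
  rw [intervalIntegral.integral_congr fun u hu =>
    (hp.iterate_kernels_eq_sub k).1 u (Set.uIcc_subset_Icc hs ht hu) t ht,
    intervalIntegral.integral_sub ((hc k).intervalIntegrable _ _)
      (((hc (k + 1)).const_mul _).intervalIntegrable _ _), intervalIntegral.integral_const_mul]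
  ring

/-! ### Closed forms of the coefficients -/

variable (hθ : p.b * p.opBound < 1)
include hθ

lemma hasSum_resolventZ {t : ℝ} (ht : t ∈ Set.Icc 0 p.T) :
    HasSum (fun k : ℕ => p.b ^ k * (p.opL p.riccatiSol)^[k] (p.zCoef p.riccatiSol) t)
      (p.crowdDeriv t / p.crowd 0) :=
  hp.hasSum_iterate_opL hθ (ξ := fun r => p.crowdDeriv r / p.crowd 0) (by fun_prop)
    (fun _ ht => hp.zCoef_eq_sub ht.2) ht

lemma resolventZ_eq {t : ℝ} (ht : t ∈ Set.Icc 0 p.T) :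
    p.resolventZ p.riccatiSol t = p.crowdDeriv t / p.crowd 0 :=
  (hp.hasSum_resolventZ hθ ht).tsum_eq

lemma resolventZ_sub {t : ℝ} (ht : t ∈ Set.Icc 0 p.T) :
    p.resolventZ p.riccatiSol t - p.b * p.opL p.riccatiSol (p.resolventZ p.riccatiSol) t =
      p.zCoef p.riccatiSol t := by
  rw [hp.opL_congr (fun r hr => hp.resolventZ_eq hθ hr) ht, hp.resolventZ_eq hθ ht,
    hp.zCoef_eq_sub ht.2]

lemma beta₁_eq {s : ℝ} (hs : s ∈ Set.Icc 0 p.T) :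
    p.beta₁ p.riccatiSol s = 2 * p.η * p.wronskian s / (p.solo s * p.crowd 0) := by
  have hη := hp.η.ne'
  have h1 := (hp.solo_pos hs.2).ne'
  have h3 := (hp.crowd_pos hp.T.le).ne'
  have h : ∫ r in s..p.T, p.Gam p.riccatiSol s r * p.resolventZ p.riccatiSol r =
      ∫ r in s..p.T, p.Gam p.riccatiSol s r * (p.crowdDeriv r * (1 / p.crowd 0)) := by
    refine intervalIntegral.integral_congr fun r hr => ?_
    simp only [hp.resolventZ_eq hθ (Set.uIcc_subset_Icc hs hp.T_mem hr)]
    ring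
  rw [beta₁, h, hp.integral_Gam hs.2, ← hp.integral_solo_mul_crowdDeriv s]
  simp only [← mul_assoc, intervalIntegral.integral_mul_const]
  field_simp

/-- The integral of W/u² from 0 to t is v/u - v(0)/u(0). Its first part cancels the term u'v of the
Wronskian in β¹, its second part leaves -u'/u(0). -/
lemma Abar_eq {t : ℝ} (ht : t ∈ Set.Icc 0 p.T) :
    p.Abar p.riccatiSol t = p.crowdDeriv t / p.crowd 0 - p.soloDeriv t / p.solo 0 := by
  have hη := hp.η.ne'
  have h0 := (hp.solo_pos hp.T.le).ne'
  have h1 := (hp.solo_pos ht.2).ne'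
  have h3 := (hp.crowd_pos hp.T.le).ne'
  have h : ∫ s in (0 : ℝ)..t, p.Gam p.riccatiSol s t * p.beta₁ p.riccatiSol s =
      p.solo t * (2 * p.η) / p.crowd 0 * ∫ s in (0 : ℝ)..t, p.wronskian s / p.solo s ^ 2 := by
    rw [← intervalIntegral.integral_const_mul]
    refine intervalIntegral.integral_congr fun s hs => ?_
    have hs' := Set.uIcc_subset_Icc hp.zero_mem ht hs
    have hs0 := (hp.solo_pos hs'.2).ne'
    simp only [hp.beta₁_eq hθ hs', hp.Gam_eq hs'.2 ht.2]
    field_simp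
  rw [Abar, h, hp.integral_wronskian_div hp.T.le ht.2, hp.beta₁_eq hθ ht, hp.slope_div_eq ht.2,
    wronskian]
  field_simp
  ring

omit hθ in
lemma Bbar_eq {t : ℝ} (ht : t ∈ Set.Icc 0 p.T) :
    p.Bbar p.riccatiSol t = p.soloDeriv t / p.solo 0 := hp.zCoef_eq ht.2

lemma beta₃_eq {s : ℝ} (hs : s ∈ Set.Icc 0 p.T) :
    p.beta₃ p.riccatiSol s = 2 * p.η * p.signalCoef s := by
  have h1 := (hp.solo_pos hs.2).ne'
  have h : p.beta₃ p.riccatiSol s = ∫ r in s..p.T, p.Gam p.riccatiSol s r *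
      (1 + p.b * ((∫ u in s..r, p.memoryKernel u r) + p.currentKernel r)) := by
    refine intervalIntegral.integral_congr fun r hr => ?_
    have hr := Set.uIcc_subset_Icc hs hp.T_mem hr
    -- The powers b^(k+1) in β³ are b times those of the two series of iterates.
    rw [← (((hp.hasSum_integral_LhatIter₁ hθ hs hr).add
      (hp.hasSum_LhatIter₂ hθ hr)).mul_left p.b).tsum_eq]
    congr 3
    ext k
    ring
  rw [h, hp.integral_Gam hs.2, hp.integral_solo_response hs.2]
  field_simp

lemma Dbar_eq {t : ℝ} (ht : t ∈ Set.Icc 0 p.T) : p.Dbar p.riccatiSol t = p.signalCoef t := by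
  have hη := hp.η.ne'
  rw [Dbar, hp.beta₃_eq hθ ht]
  field_simp

lemma beta₂_eq {u s : ℝ} (hu : u ∈ Set.Icc 0 p.T) (hs : s ∈ Set.Icc 0 p.T) :
    p.beta₂ p.riccatiSol u s = p.signalRatio u * (2 * p.η * p.wronskian s / p.solo s) := by
  have hη := hp.η.ne'
  have h1 := (hp.solo_pos hs.2).ne'
  have h : ∫ r in s..p.T, p.Gam p.riccatiSol s r * ∑' k : ℕ, p.b ^ k *
      p.LhatIter₁ p.riccatiSol k u r =
      ∫ r in s..p.T, p.Gam p.riccatiSol s r * (p.crowdDeriv r * p.signalRatio u) := by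
    refine intervalIntegral.integral_congr fun r hr => ?_
    simp only [(hp.hasSum_LhatIter₁ hθ hu (Set.uIcc_subset_Icc hs hp.T_mem hr)).tsum_eq,
      memoryKernel]
    ring
  rw [beta₂, h, hp.integral_Gam hs.2, ← hp.integral_solo_mul_crowdDeriv s]
  simp only [← mul_assoc, intervalIntegral.integral_mul_const]
  field_simp

/-- The cancellation is that of `Abar_eq` with initial time s. The boundary term in v(s)/u(s) now
disappears against β³, because g(s) is `signalRatio s` times v(s). -/
lemma Cbar_eq {s t : ℝ} (hs : s ∈ Set.Icc 0 p.T) (ht : t ∈ Set.Icc 0 p.T) :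
    p.Cbar p.riccatiSol s t = p.signalRatio s * p.crowdDeriv t := by
  have hη := hp.η.ne'
  have h0 := (hp.solo_pos hs.2).ne'
  have h1 := (hp.solo_pos ht.2).ne'
  have h3 := (hp.crowd_pos hs.2).ne'
  have h : ∫ r in s..t, p.Gam p.riccatiSol r t * p.beta₂ p.riccatiSol s r =
      p.signalRatio s * p.solo t * (2 * p.η) * ∫ r in s..t, p.wronskian r / p.solo r ^ 2 := by
    rw [← intervalIntegral.integral_const_mul]
    refine intervalIntegral.integral_congr fun r hr => ?_
    have hr := Set.uIcc_subset_Icc hs ht hr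
    have hr0 := (hp.solo_pos hr.2).ne'
    simp only [hp.beta₂_eq hθ hs hr, hp.Gam_eq hr.2 ht.2]
    field_simp
  rw [Cbar, h, hp.integral_wronskian_div hs.2 ht.2, hp.beta₂_eq hθ hs ht, hp.beta₃_eq hθ hs,
    hp.slope_div_eq ht.2, hp.Gam_eq hs.2 ht.2, wronskian, signalRatio_eq hs.2]
  field_simp
  ring

lemma analyticOn_Abar : AnalyticOn ℝ (p.Abar p.riccatiSol) (Set.Icc 0 p.T) := by
  refine AnalyticOn.congr (fun t _ => AnalyticAt.analyticWithinAt ?_)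
    fun t ht => hp.Abar_eq hθ ht
  simp only [div_eq_mul_inv]
  fun_prop

omit hθ in
lemma analyticOn_Bbar : AnalyticOn ℝ (p.Bbar p.riccatiSol) (Set.Icc 0 p.T) := by
  refine AnalyticOn.congr (fun t _ => AnalyticAt.analyticWithinAt ?_) fun t ht => hp.Bbar_eq ht
  simp only [div_eq_mul_inv]
  fun_prop

lemma analyticOn_Cbar : AnalyticOn ℝ (fun q : ℝ × ℝ => p.Cbar p.riccatiSol q.1 q.2)
    (Set.Icc 0 p.T ×ˢ Set.Icc 0 p.T) := by
  -- The quotient without freezing is used here: the `min` in `signalRatio` may destroy analyticity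
  -- at T.
  refine AnalyticOn.congr (f := fun q : ℝ × ℝ =>
    p.signalCoef q.1 / p.crowd q.1 * p.crowdDeriv q.2)
    (fun q hq => AnalyticAt.analyticWithinAt ?_) fun q hq => ?_
  · have h1 : AnalyticAt ℝ (fun q : ℝ × ℝ => p.signalCoef q.1) q :=
      (hp.analyticAt_signalCoef hq.1.2).comp (f := Prod.fst) analyticAt_fst
    have h2 : AnalyticAt ℝ (fun q : ℝ × ℝ => p.crowd q.1) q :=
      (analyticAt_crowd q.1).comp (f := Prod.fst) analyticAt_fst
    have h3 : AnalyticAt ℝ (fun q : ℝ × ℝ => p.crowdDeriv q.2) q :=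
      (analyticAt_crowdDeriv q.2).comp (f := Prod.snd) analyticAt_snd
    exact (h1.div h2 (hp.crowd_pos hq.1.2).ne').mul h3
  · simp only
    rw [hp.Cbar_eq hθ hq.1 hq.2, signalRatio_eq hq.1.2]

lemma analyticOn_Dbar : AnalyticOn ℝ (p.Dbar p.riccatiSol) (Set.Icc 0 p.T) :=
  AnalyticOn.congr (fun _ ht => (hp.analyticAt_signalCoef ht.2).analyticWithinAt)
    fun _ ht => hp.Dbar_eq hθ ht

end Positive

/-- The minimum is matched to max(`slopeBound`, 1): the products η²a⁻¹ · (a/η), η^(3/2)φ^(-1/2) ·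
√(ηφ)/η and η · 1 all equal η. One factor exp(-T · `slopeBound`) absorbs the exponential in
`opBound`; the other one is to spare. -/
lemma b_mul_opBound_lt_one (hp : p.Positive)
    (hb_small : p.b < Real.exp (-(2 * p.T * (max p.a (Real.sqrt (p.η * p.φ)) / p.η))) *
      (min (min (p.η ^ 2 * p.a⁻¹) (p.η ^ (3 / 2 : ℝ) * p.φ ^ (-(1 / 2) : ℝ))) p.η /
        (p.T ^ 2 + p.T))) : p.b * p.opBound < 1 := by
  have hη := hp.η
  have ha := hp.a
  have hφ := hp.φ
  have hT := hp.T
  have hK := hp.slopeBound_pos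
  have hm : min (min (p.η ^ 2 * p.a⁻¹) (p.η ^ (3 / 2 : ℝ) * p.φ ^ (-(1 / 2) : ℝ))) p.η *
      max p.slopeBound 1 ≤ p.η := by
    have h1 : p.η ^ (3 / 2 : ℝ) * p.φ ^ (-(1 / 2) : ℝ) * (Real.sqrt (p.η * p.φ) / p.η) = p.η := by
      rw [Real.sqrt_mul hη.le, Real.sqrt_eq_rpow, Real.sqrt_eq_rpow, Real.rpow_neg hφ.le,
        show (3 / 2 : ℝ) = 1 + 1 / 2 by norm_num, Real.rpow_add hη, Real.rpow_one]
      have h2 : p.η ^ (1 / 2 : ℝ) * p.η ^ (1 / 2 : ℝ) = p.η := by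
        rw [← Real.rpow_add hη]
        norm_num
      have h3 : p.φ ^ (1 / 2 : ℝ) ≠ 0 := (Real.rpow_pos_of_pos hφ _).ne'
      field_simp
      rw [pow_two]
      exact h2
    have h2 : p.η ^ 2 * p.a⁻¹ * (p.a / p.η) = p.η := by field_simp
    have hs : 0 < Real.sqrt (p.η * p.φ) := Real.sqrt_pos.2 (mul_pos hη hφ)
    rcases le_total p.slopeBound 1 with h | h
    · rw [max_eq_right h, mul_one]
      exact min_le_right _ _
    · rw [max_eq_left h, slopeBound]
      rcases le_total p.a (Real.sqrt (p.η * p.φ)) with h' | h'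
      · rw [max_eq_right h']
        calc _ ≤ p.η ^ (3 / 2 : ℝ) * p.φ ^ (-(1 / 2) : ℝ) * (Real.sqrt (p.η * p.φ) / p.η) :=
              mul_le_mul_of_nonneg_right ((min_le_left _ _).trans (min_le_right _ _))
                (div_pos hs hη).le
          _ = _ := h1
      · rw [max_eq_left h']
        calc _ ≤ p.η ^ 2 * p.a⁻¹ * (p.a / p.η) :=
              mul_le_mul_of_nonneg_right ((min_le_left _ _).trans (min_le_left _ _))
                (div_pos ha hη).le
          _ = _ := h2
  have he : Real.exp (-(2 * p.T * (max p.a (Real.sqrt (p.η * p.φ)) / p.η))) *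
      Real.exp (p.slopeBound * p.T) ≤ 1 := by
    rw [← Real.exp_add, Real.exp_le_one_iff, ← slopeBound]
    nlinarith [mul_pos hK hT]
  have hB := hp.opBound_pos
  refine (mul_lt_mul_of_pos_right hb_small hB).trans_le ?_
  unfold opBound
  generalize min (min (p.η ^ 2 * p.a⁻¹) (p.η ^ (3 / 2 : ℝ) * p.φ ^ (-(1 / 2) : ℝ))) p.η = m at *
  have he1 := Real.exp_pos (p.slopeBound * p.T)
  have he2 := Real.exp_pos (-(2 * p.T * (max p.a (Real.sqrt (p.η * p.φ)) / p.η)))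
  generalize Real.exp (-(2 * p.T * (max p.a (Real.sqrt (p.η * p.φ)) / p.η))) = x at *
  generalize Real.exp (p.slopeBound * p.T) = y at *
  have hTT : 0 < p.T ^ 2 + p.T := by positivity
  calc x * (m / (p.T ^ 2 + p.T)) * (max p.slopeBound 1 * y * (p.T ^ 2 + p.T) / p.η) =
        x * y * (m * max p.slopeBound 1) / p.η := by field_simp
    _ ≤ x * y * p.η / p.η := by gcongr
    _ = x * y := by field_simp
    _ ≤ 1 := he

end TraderParams

/-! ### Calculus of absolutely continuous functions -/

/-- `F` is absolutely continuous on `[0, T]`, with derivative `f` almost everywhere. -/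
structure HasACDeriv (F f : ℝ → ℝ) (T : ℝ) : Prop where
  absCont : AbsolutelyContinuousOnInterval F 0 T
  hasDerivAt : ∀ᵐ x, x ∈ Set.uIcc 0 T → HasDerivAt F (f x) x

namespace HasACDeriv

variable {F f G g : ℝ → ℝ} {T : ℝ}

lemma add (hF : HasACDeriv F f T) (hG : HasACDeriv G g T) :
    HasACDeriv (fun x => F x + G x) (fun x => f x + g x) T where
  absCont := hF.absCont.fun_add hG.absCont
  hasDerivAt := by
    filter_upwards [hF.hasDerivAt, hG.hasDerivAt] with x h1 h2 hx using (h1 hx).add (h2 hx)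

lemma mul (hF : HasACDeriv F f T) (hG : HasACDeriv G g T) :
    HasACDeriv (fun x => F x * G x) (fun x => f x * G x + F x * g x) T where
  absCont := hF.absCont.fun_mul hG.absCont
  hasDerivAt := by
    filter_upwards [hF.hasDerivAt, hG.hasDerivAt] with x h1 h2 hx using (h1 hx).mul (h2 hx)

lemma of_contDiffAt (hT : 0 ≤ T) (h : ∀ x ∈ Set.Icc 0 T, ContDiffAt ℝ 1 F x)
    (hd : ∀ x ∈ Set.Icc 0 T, HasDerivAt F (f x) x) : HasACDeriv F f T where
  absCont := by
    refine ContDiffOn.absolutelyContinuousOnInterval fun x hx => ?_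
    rw [Set.uIcc_of_le hT] at hx
    exact (h x hx).contDiffWithinAt
  hasDerivAt := Filter.Eventually.of_forall fun x hx => hd x (by rwa [Set.uIcc_of_le hT] at hx)

/-- Paths of the signal and of the controls are only integrable in time, so their primitives are
differentiable only almost everywhere; this is what calls for absolute continuity. -/
lemma of_intervalIntegrable (h : IntervalIntegrable f volume 0 T) (c : ℝ) :
    HasACDeriv (fun x => c + ∫ u in (0 : ℝ)..x, f u) f T where
  absCont := by
    refine AbsolutelyContinuousOnInterval.fun_add ?_
      (h.absolutelyContinuousOnInterval_intervalIntegral Set.left_mem_uIcc)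
    exact (contDiff_const.contDiffOn).absolutelyContinuousOnInterval
  hasDerivAt := by
    filter_upwards [h.ae_hasDerivAt_integral] with x hx hx'
    exact (hx hx' 0 Set.left_mem_uIcc).const_add c

lemma ae_eq (hF : HasACDeriv F f T) : deriv F =ᵐ[volume.restrict (Set.uIoc 0 T)] f := by
  rw [Filter.EventuallyEq, ae_restrict_iff' measurableSet_uIoc]
  filter_upwards [hF.hasDerivAt] with x hx hx' using (hx (Set.uIoc_subset_uIcc hx')).deriv

lemma intervalIntegrable (hF : HasACDeriv F f T) : IntervalIntegrable f volume 0 T :=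
  hF.absCont.intervalIntegrable_deriv.congr_ae hF.ae_eq

lemma mono (hF : HasACDeriv F f T) {t : ℝ} (ht : t ∈ Set.Icc 0 T) : HasACDeriv F f t := by
  have h : Set.uIcc 0 t ⊆ Set.uIcc 0 T := by
    rw [Set.uIcc_of_le ht.1, Set.uIcc_of_le (ht.1.trans ht.2)]
    exact Set.Icc_subset_Icc_right ht.2
  exact ⟨hF.absCont.mono h, by filter_upwards [hF.hasDerivAt] with x hx hx' using hx (h hx')⟩

lemma integral_eq_sub (hF : HasACDeriv F f T) {t : ℝ} (ht : t ∈ Set.Icc 0 T) :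
    ∫ x in (0 : ℝ)..t, f x = F t - F 0 := by
  rw [← (hF.mono ht).absCont.integral_deriv_eq_sub]
  refine intervalIntegral.integral_congr_ae ?_
  filter_upwards [(hF.mono ht).hasDerivAt] with x hx hx'
  exact (hx (Set.uIoc_subset_uIcc hx')).deriv.symm

end HasACDeriv

/-! ### Time integrals along a path -/

namespace TraderParams

variable {p : TraderParams}

instance : IsFiniteMeasure p.timeMeasure := by
  refine ⟨?_⟩
  rw [timeMeasure, Measure.comap_apply _ Subtype.val_injective (fun s hs =>
    measurableSet_Icc.subtype_image hs) _ MeasurableSet.univ]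
  refine (measure_mono (t := Set.Icc 0 p.T) ?_).trans_lt measure_Icc_lt_top
  rintro _ ⟨x, -, rfl⟩
  exact x.2

lemma Positive.timeMeasure_univ (_hp : p.Positive) :
    p.timeMeasure Set.univ = ENNReal.ofReal p.T := by
  rw [timeMeasure, Measure.comap_apply _ Subtype.val_injective (fun s hs =>
    measurableSet_Icc.subtype_image hs) _ MeasurableSet.univ, Set.image_univ,
    Subtype.range_coe, Real.volume_Icc, sub_zero]

/-- The extension of a function on `[0, T]` to `ℝ`. -/
def extend (hp : p.Positive) (f : p.Time → ℝ) : ℝ → ℝ := Set.IccExtend hp.T.le f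

lemma extend_coe (hp : p.Positive) (f : p.Time → ℝ) (t : p.Time) : extend hp f t = f t :=
  Set.IccExtend_val _ _ _

lemma extend_of_mem (hp : p.Positive) (f : p.Time → ℝ) {x : ℝ} (hx : x ∈ Set.Icc 0 p.T) :
    extend hp f x = f ⟨x, hx⟩ :=
  Set.IccExtend_of_mem _ _ _

lemma intervalIntegrable_extend (hp : p.Positive) {f : p.Time → ℝ}
    (hf : Integrable f p.timeMeasure) : IntervalIntegrable (extend hp f) volume 0 p.T := by
  rw [intervalIntegrable_iff_integrableOn_Icc_of_le hp.T.le]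
  have he : MeasurableEmbedding (Subtype.val : p.Time → ℝ) :=
    MeasurableEmbedding.subtype_coe measurableSet_Icc
  have h : Measure.map Subtype.val p.timeMeasure = volume.restrict (Set.Icc 0 p.T) := by
    rw [timeMeasure, he.map_comap, Subtype.range_coe]
  rw [IntegrableOn, ← h, he.integrable_map_iff]
  refine hf.congr (Filter.Eventually.of_forall fun t => ?_)
  exact (extend_coe hp f t).symm

lemma integral_extend (hp : p.Positive) (f : p.Time → ℝ) :
    ∫ t, f t ∂p.timeMeasure = ∫ x in (0 : ℝ)..p.T, extend hp f x := by
  rw [intervalIntegral.integral_of_le hp.T.le, ← integral_Icc_eq_integral_Ioc,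
    ← integral_subtype_comap measurableSet_Icc]
  exact integral_congr_ae (Filter.Eventually.of_forall fun t => (extend_coe hp f t).symm)

lemma setIntegral_Iic_extend (hp : p.Positive) (f : p.Time → ℝ) (t : p.Time) :
    ∫ u in Set.Iic t, f u ∂p.timeMeasure = ∫ x in (0 : ℝ)..t, extend hp f x := by
  have h : ∀ x ∈ Set.Icc 0 p.T, extend hp ((Set.Iic t).indicator f) x =
      (Set.Iic (t : ℝ)).indicator (extend hp f) x := fun x hx => by
    by_cases hxt : x ≤ t
    · rw [Set.indicator_of_mem (Set.mem_Iic.2 hxt), extend_of_mem hp _ hx, extend_of_mem hp _ hx,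
        Set.indicator_of_mem]
      exact hxt
    · rw [Set.indicator_of_notMem (by simpa using hxt), extend_of_mem hp _ hx,
        Set.indicator_of_notMem]
      exact hxt
  rw [← integral_indicator measurableSet_Iic, integral_extend hp,
    intervalIntegral.integral_of_le hp.T.le, intervalIntegral.integral_of_le t.2.1,
    setIntegral_congr_fun measurableSet_Ioc fun x hx => h x (Set.Ioc_subset_Icc_self hx),
    setIntegral_indicator measurableSet_Iic, Set.Ioc_inter_Iic, min_eq_right t.2.2]

/-! ### Pathwise identities -/

/-- The normalized mean inventory along a path `M` of the signal. -/
def crowdFactor (p : TraderParams) (q : ℝ) (M : p.Time → ℝ) (t : p.Time) : ℝ :=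
  q / p.crowd 0 + ∫ u in Set.Iic t, p.signalRatio u * M u ∂p.timeMeasure

/-- The mean rate along a path `M` of the signal. -/
def crowdRate (p : TraderParams) (q : ℝ) (M : p.Time → ℝ) (t : p.Time) : ℝ :=
  p.crowdDeriv t * p.crowdFactor q M t + p.signalCoef t * M t

/-- The rate of a trader with initial inventory `x` along a path `M` of the signal. -/
def traderRate (p : TraderParams) (q x : ℝ) (M : p.Time → ℝ) (t : p.Time) : ℝ :=
  p.crowdRate q M t + p.soloDeriv t / p.solo 0 * (x - q)

/-- The derivative of `signalCoef`. -/
def signalSlope (p : TraderParams) (t : ℝ) : ℝ :=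
  -(p.b / (2 * p.η) * p.signalCoef t) - 1 / (2 * p.η) -
    p.signalCoef t * p.crowdDeriv t / p.crowd t

variable (hp : p.Positive)
include hp

lemma Positive.integrable_signalRatio_mul {M : p.Time → ℝ} (hM : Integrable M p.timeMeasure) :
    Integrable (fun u : p.Time => p.signalRatio u * M u) p.timeMeasure := by
  obtain ⟨C, hC⟩ := isCompact_Icc.exists_bound_of_continuousOn
    (hp.continuous_signalRatio.continuousOn (s := Set.Icc 0 p.T))
  exact hM.bdd_mul (c := C)
    (hp.continuous_signalRatio.comp continuous_subtype_val).aestronglyMeasurable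
    (Filter.Eventually.of_forall fun t => hC t t.2)

lemma Positive.hasACDeriv_crowd : HasACDeriv p.crowd p.crowdDeriv p.T :=
  HasACDeriv.of_contDiffAt hp.T.le (fun x _ => (analyticAt_crowd x).contDiffAt)
    fun x _ => hasDerivAt_crowd x

lemma Positive.hasACDeriv_crowdDeriv : HasACDeriv p.crowdDeriv
    (fun t => p.φ / p.η * p.crowd t - p.b / (2 * p.η) * p.crowdDeriv t) p.T :=
  HasACDeriv.of_contDiffAt hp.T.le (fun x _ => (analyticAt_crowdDeriv x).contDiffAt)
    fun x _ => hp.hasDerivAt_crowdDeriv x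

lemma Positive.hasACDeriv_solo : HasACDeriv p.solo p.soloDeriv p.T :=
  HasACDeriv.of_contDiffAt hp.T.le (fun x _ => (analyticAt_solo x).contDiffAt)
    fun x _ => hasDerivAt_solo x

lemma Positive.hasACDeriv_soloDeriv : HasACDeriv p.soloDeriv
    (fun t => p.φ / p.η * p.solo t) p.T :=
  HasACDeriv.of_contDiffAt hp.T.le (fun x _ => (analyticAt_soloDeriv x).contDiffAt)
    fun x _ => hp.hasDerivAt_soloDeriv x

lemma Positive.hasACDeriv_signalCoef : HasACDeriv p.signalCoef p.signalSlope p.T :=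
  HasACDeriv.of_contDiffAt hp.T.le (fun _ hx => (hp.analyticAt_signalCoef hx.2).contDiffAt)
    fun _ hx => hp.hasDerivAt_signalCoef hx.2

omit hp in
lemma hasACDeriv_const (c T : ℝ) : HasACDeriv (fun _ => c) (fun _ => 0) T where
  absCont := (contDiff_const.contDiffOn).absolutelyContinuousOnInterval
  hasDerivAt := Filter.Eventually.of_forall fun x _ => hasDerivAt_const x c

/-- The inventory along a path of the signal. -/
lemma Positive.inventory_traderRate (q x : ℝ) {M : p.Time → ℝ}
    (hM : Integrable M p.timeMeasure) (t : p.Time) :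
    x + ∫ u in Set.Iic t, p.traderRate q x M u ∂p.timeMeasure =
      p.crowd t * p.crowdFactor q M t + p.solo t / p.solo 0 * (x - q) := by
  have h0 := (hp.crowd_pos hp.T.le).ne'
  have h1 := (hp.solo_pos hp.T.le).ne'
  have hP := HasACDeriv.of_intervalIntegrable
    (intervalIntegrable_extend hp (hp.integrable_signalRatio_mul hM)) (q / p.crowd 0)
  -- The derivative of this function is `traderRate`, because vP' = gM.
  have hS := (hp.hasACDeriv_crowd.mul hP).add
    (hp.hasACDeriv_solo.mul (hasACDeriv_const ((x - q) / p.solo 0) p.T))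
  have h := hS.integral_eq_sub t.2
  simp only [intervalIntegral.integral_same] at h
  rw [crowdFactor, setIntegral_Iic_extend hp, setIntegral_Iic_extend hp]
  have e : ∫ r in (0 : ℝ)..t, extend hp (p.traderRate q x M) r =
      p.crowd t * (q / p.crowd 0 + ∫ r in (0 : ℝ)..t,
        extend hp (fun u => p.signalRatio u * M u) r) + p.solo t * ((x - q) / p.solo 0) -
      (p.crowd 0 * (q / p.crowd 0 + 0) + p.solo 0 * ((x - q) / p.solo 0)) := by
    rw [← h]
    refine intervalIntegral.integral_congr fun r hr => ?_
    have hr' : r ∈ Set.Icc 0 p.T := Set.uIcc_subset_Icc hp.zero_mem t.2 hr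
    have h2 := (hp.crowd_pos hr'.2).ne'
    rw [extend_of_mem hp _ hr', extend_of_mem hp _ hr', traderRate, crowdRate, crowdFactor,
      setIntegral_Iic_extend hp, signalRatio_eq hr'.2]
    field_simp
    ring
  rw [e]
  field_simp
  ring

/-- The first variation of the objective at `traderRate`, in the direction `h`. -/
lemma Positive.integral_variation (q x μ : ℝ) {M h : p.Time → ℝ}
    (hM : Integrable M p.timeMeasure) (hh : Integrable h p.timeMeasure)
    {H Q : p.Time → ℝ} (hH : ∀ t, H t = ∫ u in Set.Iic t, h u ∂p.timeMeasure)
    (hQ : ∀ t, Q t = p.crowd t * p.crowdFactor q M t + p.solo t / p.solo 0 * (x - q))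
    (hG : Integrable (fun t => H t * (p.b * p.crowdRate q M t + μ)
      - 2 * p.η * p.traderRate q x M t * h t
      - 2 * p.a * (H t * p.traderRate q x M t + Q t * h t) - 2 * p.φ * Q t * H t)
      p.timeMeasure) :
    ∫ t, (H t * (p.b * p.crowdRate q M t + μ) - 2 * p.η * p.traderRate q x M t * h t
      - 2 * p.a * (H t * p.traderRate q x M t + Q t * h t) - 2 * p.φ * Q t * H t)
      ∂p.timeMeasure =
    ∫ t, (μ - M t) * ((1 + 2 * p.η * p.signalSlope t) * H t + 2 * p.η * p.signalCoef t * h t)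
      ∂p.timeMeasure := by
  have hη := hp.η.ne'
  have hP := HasACDeriv.of_intervalIntegrable
    (intervalIntegrable_extend hp (hp.integrable_signalRatio_mul hM)) (q / p.crowd 0)
  have hHp := HasACDeriv.of_intervalIntegrable (intervalIntegrable_extend hp hh) 0
  have c := fun r => hasACDeriv_const r p.T
  -- The function R = (αP + β)H is the boundary term of the integration by parts. Here αP + β is 2ην
  -- + 2aQ, except that g is multiplied by the constant μ and not by M, which has no derivative in
  -- time. The replacement leaves exactly the terms in μ - M.
  have hα := ((c (2 * p.η)).mul hp.hasACDeriv_crowdDeriv).add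
    ((c (2 * p.a)).mul hp.hasACDeriv_crowd)
  have hβ := (((c (2 * p.η * ((x - q) / p.solo 0))).mul hp.hasACDeriv_soloDeriv).add
    ((c (2 * p.a * ((x - q) / p.solo 0))).mul hp.hasACDeriv_solo)).add
    ((c (2 * p.η * μ)).mul hp.hasACDeriv_signalCoef)
  have hR := ((hα.mul hP).add hβ).mul hHp
  have hR0 := hR.integral_eq_sub hp.T_mem
  have hRi := hR.intervalIntegrable
  -- R vanishes at 0 together with H, and at T because 2ηv' + 2av, 2ηu' + 2au and g vanish there.
  -- Adding R' under the integral therefore changes nothing.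
  simp only [intervalIntegral.integral_same, hp.crowdDeriv_terminal, hp.crowd_terminal,
    hp.solo_terminal, hp.soloDeriv_terminal, hp.signalCoef_terminal] at hR0
  have hGi := intervalIntegrable_extend hp hG
  have hsum := intervalIntegral.integral_add hGi hRi
  rw [hR0.trans (by field_simp; ring : _ = (0 : ℝ)), add_zero] at hsum
  rw [integral_extend hp, integral_extend hp, ← hsum]
  refine intervalIntegral.integral_congr fun r hr => ?_
  have hr' : r ∈ Set.Icc 0 p.T := Set.uIcc_subset_Icc hp.zero_mem hp.T_mem hr
  have h1 := (hp.solo_pos hp.T.le).ne'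
  have h2 := (hp.crowd_pos hr'.2).ne'
  simp only [extend_of_mem hp _ hr', hQ, hH, traderRate, crowdRate, crowdFactor,
    setIntegral_Iic_extend hp, signalRatio_eq hr'.2, signalSlope]
  field_simp
  ring

end TraderParams

/-! ### Square norms and the Cauchy-Schwarz inequality -/

section SquareNorm

variable {α : Type*} {mα : MeasurableSpace α} {ρ : Measure α}

lemma sq_eLpNorm_two {f : α → ℝ} : eLpNorm f 2 ρ ^ 2 = ∫⁻ x, ‖f x‖ₑ ^ 2 ∂ρ := by
  have := eLpNorm_nnreal_pow_eq_lintegral (μ := ρ) (f := f) (p := 2) two_ne_zero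
  simpa only [NNReal.coe_ofNat, ENNReal.coe_ofNat, ENNReal.rpow_ofNat] using this

lemma integral_sq_eq_toReal {f : α → ℝ} (hf : AEStronglyMeasurable f ρ) :
    ∫ x, f x ^ 2 ∂ρ = (eLpNorm f 2 ρ ^ 2).toReal := by
  rw [sq_eLpNorm_two, integral_eq_lintegral_of_nonneg_ae
    (Filter.Eventually.of_forall fun x => sq_nonneg _) (hf.pow 2)]
  congr 1
  refine lintegral_congr fun x => ?_
  rw [← Real.enorm_of_nonneg (sq_nonneg _), enorm_pow]

lemma integral_sq_le_of_sq_eLpNorm_le {f g : α → ℝ} (hf : AEStronglyMeasurable f ρ)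
    (hg : MemLp g 2 ρ) {c : ℝ} (hc : 0 ≤ c)
    (h : eLpNorm f 2 ρ ^ 2 ≤ ENNReal.ofReal c * eLpNorm g 2 ρ ^ 2) :
    ∫ x, f x ^ 2 ∂ρ ≤ c * ∫ x, g x ^ 2 ∂ρ := by
  rw [integral_sq_eq_toReal hf, integral_sq_eq_toReal hg.1]
  have h2 : ENNReal.ofReal c * eLpNorm g 2 ρ ^ 2 ≠ ⊤ :=
    ENNReal.mul_ne_top ENNReal.ofReal_ne_top (ENNReal.pow_ne_top hg.2.ne)
  refine (ENNReal.toReal_mono h2 h).trans_eq ?_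
  rw [ENNReal.toReal_mul, ENNReal.toReal_ofReal hc]

lemma sq_lintegral_enorm_le [IsFiniteMeasure ρ] {f : α → ℝ} (hf : AEStronglyMeasurable f ρ) :
    (∫⁻ x, ‖f x‖ₑ ∂ρ) ^ 2 ≤ ρ Set.univ * ∫⁻ x, ‖f x‖ₑ ^ 2 ∂ρ := by
  have h := eLpNorm_le_eLpNorm_mul_rpow_measure_univ (p := 1) (q := 2) one_le_two hf
  rw [eLpNorm_one_eq_lintegral_enorm] at h
  refine (pow_le_pow_left₀ zero_le h 2).trans_eq ?_
  rw [mul_pow, sq_eLpNorm_two, mul_comm]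
  congr 1
  rw [← ENNReal.rpow_natCast, ← ENNReal.rpow_mul]
  norm_num

end SquareNorm

/-! ### Progressive processes and their primitives -/

namespace TraderParams

variable {p : TraderParams} {Ω : Type*} {mΩ : MeasurableSpace Ω}

/-- The process `∫_0^t X_u du`. -/
def primitive (X : p.Time → Ω → ℝ) (t : p.Time) (ω : Ω) : ℝ :=
  ∫ u in Set.Iic t, X u ω ∂p.timeMeasure

lemma inventory_eq (Q₀ : Ω → ℝ) (ν : p.Time → Ω → ℝ) (t : p.Time) (ω : Ω) :
    p.inventory Q₀ ν t ω = Q₀ ω + primitive ν t ω := rfl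

/-- Progressive measurability at the terminal time T is joint measurability. -/
lemma Positive.measurable_of_isProgressive (hp : p.Positive) {β : Type*} [MeasurableSpace β]
    {G : Filtration p.Time mΩ} {X : p.Time → Ω → β} (h : IsProgressive G X) :
    Measurable fun q : p.Time × Ω => X q.1 q.2 := by
  let top : p.Time := ⟨p.T, hp.T_mem⟩
  have h1 := (h top).mono (sup_le_sup le_rfl (MeasurableSpace.comap_mono (G.le top))) le_rfl
  have h2 : Measurable fun q : p.Time × Ω => ((⟨q.1, q.1.2.2⟩ : Set.Iic top), q.2) :=
    (measurable_fst.subtype_mk).prodMk measurable_snd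
  exact h1.comp h2

lemma measurable_integral_Iic {Ω' : Type*} [MeasurableSpace Ω'] {i : p.Time}
    {X : p.Time → Ω' → ℝ} (h : Measurable fun q : Set.Iic i × Ω' => X q.1 q.2) :
    Measurable fun q : Set.Iic i × Ω' =>
      ∫ u in Set.Iic (q.1 : p.Time), X u q.2 ∂p.timeMeasure := by
  -- Measurability of X is known only up to time i. The truncation at i does not affect the times u
  -- ≤ q.1 ≤ i over which the integral runs.
  have h1 : ∀ q : Set.Iic i × Ω', ∫ u in Set.Iic (q.1 : p.Time), X u q.2 ∂p.timeMeasure =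
      ∫ u, (if u ≤ q.1 then X (min u i) q.2 else 0) ∂p.timeMeasure := fun q => by
    rw [← integral_indicator measurableSet_Iic]
    congr 1
    ext u
    by_cases hu : u ≤ q.1
    · rw [Set.indicator_of_mem (Set.mem_Iic.2 hu), if_pos hu, min_eq_left (hu.trans q.1.2)]
    · rw [Set.indicator_of_notMem (by simpa using hu), if_neg hu]
  simp_rw [h1]
  refine (StronglyMeasurable.integral_prod_right' (f := fun r : (Set.Iic i × Ω') × p.Time =>
    if r.2 ≤ r.1.1 then X (min r.2 i) r.1.2 else 0) ?_).measurable
  refine (Measurable.ite ?_ ?_ measurable_const).stronglyMeasurable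
  · exact measurableSet_le measurable_snd
      (measurable_subtype_coe.comp (measurable_fst.comp measurable_fst))
  · have h2 : Measurable fun r : (Set.Iic i × Ω') × p.Time =>
        ((⟨min r.2 i, Set.mem_Iic.2 (min_le_right _ _)⟩ : Set.Iic i), r.1.2) :=
      ((measurable_snd.min measurable_const).subtype_mk).prodMk
        (measurable_snd.comp measurable_fst)
    exact h.comp h2

lemma isProgressive_primitive {G : Filtration p.Time mΩ} {X : p.Time → Ω → ℝ}
    (h : IsProgressive G X) : IsProgressive G (primitive X) :=
  fun i => @measurable_integral_Iic p Ω (G i) i X (h i)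

lemma isProgressive_deterministic (G : Filtration p.Time mΩ) {f : p.Time → ℝ}
    (hf : Measurable f) : IsProgressive G fun t _ => f t :=
  fun i => hf.comp (measurable_subtype_coe.comp (@measurable_fst _ _ _ (G i)))

lemma isProgressive_randomVariable {G : Filtration p.Time mΩ} {Y : Ω → ℝ}
    (hY : ∀ i, Measurable[G i] Y) : IsProgressive G fun _ => Y :=
  fun i => (hY i).comp (@measurable_snd _ _ _ (G i))

lemma isProgressive_mono {G G' : Filtration p.Time mΩ} (hG : G ≤ G') {β : Type*}
    [MeasurableSpace β] {X : p.Time → Ω → β} (h : IsProgressive G X) : IsProgressive G' X :=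
  fun i => (h i).mono (sup_le_sup le_rfl (MeasurableSpace.comap_mono (hG i))) le_rfl

variable {P : Measure Ω} [IsProbabilityMeasure P]

lemma sq_eLpNorm_prod {X : p.Time → Ω → ℝ} (hX : Measurable fun q : p.Time × Ω => X q.1 q.2) :
    eLpNorm (fun q : p.Time × Ω => X q.1 q.2) 2 (p.timeMeasure.prod P) ^ 2 =
      ∫⁻ t, eLpNorm (X t) 2 P ^ 2 ∂p.timeMeasure := by
  rw [sq_eLpNorm_two, lintegral_prod _ (hX.enorm.pow_const 2).aemeasurable]
  exact lintegral_congr fun t => sq_eLpNorm_two.symm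

lemma eLpNorm_prod_le {X Y : p.Time → Ω → ℝ} (hX : Measurable fun q : p.Time × Ω => X q.1 q.2)
    (hY : Measurable fun q : p.Time × Ω => Y q.1 q.2)
    (h : ∀ᵐ t ∂p.timeMeasure, eLpNorm (X t) 2 P ≤ eLpNorm (Y t) 2 P) :
    eLpNorm (fun q : p.Time × Ω => X q.1 q.2) 2 (p.timeMeasure.prod P) ≤
      eLpNorm (fun q : p.Time × Ω => Y q.1 q.2) 2 (p.timeMeasure.prod P) := by
  rw [← ENNReal.pow_le_pow_left_iff two_ne_zero, sq_eLpNorm_prod hX, sq_eLpNorm_prod hY]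
  refine lintegral_mono_ae ?_
  filter_upwards [h] with t ht using pow_le_pow_left₀ zero_le ht 2

lemma memLp_prod_of_le {X Y : p.Time → Ω → ℝ} (hX : Measurable fun q : p.Time × Ω => X q.1 q.2)
    (hY : Measurable fun q : p.Time × Ω => Y q.1 q.2)
    (hYL : MemLp (fun q : p.Time × Ω => Y q.1 q.2) 2 (p.timeMeasure.prod P))
    (h : ∀ᵐ t ∂p.timeMeasure, eLpNorm (X t) 2 P ≤ eLpNorm (Y t) 2 P) :
    MemLp (fun q : p.Time × Ω => X q.1 q.2) 2 (p.timeMeasure.prod P) :=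
  ⟨hX.aestronglyMeasurable, (eLpNorm_prod_le hX hY h).trans_lt hYL.2⟩

lemma sq_enorm_primitive_le {X : p.Time → Ω → ℝ}
    (hX : Measurable fun q : p.Time × Ω => X q.1 q.2) (t : p.Time) (ω : Ω) :
    ‖primitive X t ω‖ₑ ^ 2 ≤
      p.timeMeasure Set.univ * ∫⁻ u, ‖X u ω‖ₑ ^ 2 ∂p.timeMeasure := by
  have hm : Measurable fun u => X u ω := hX.comp measurable_prodMk_right
  refine (pow_le_pow_left₀ zero_le ((enorm_integral_le_lintegral_enorm _).trans
    (setLIntegral_le_lintegral _ _)) 2).trans (sq_lintegral_enorm_le hm.aestronglyMeasurable)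

lemma sq_eLpNorm_primitive_le {X : p.Time → Ω → ℝ}
    (hX : Measurable fun q : p.Time × Ω => X q.1 q.2) (t : p.Time) :
    eLpNorm (primitive X t) 2 P ^ 2 ≤ p.timeMeasure Set.univ *
      eLpNorm (fun q : p.Time × Ω => X q.1 q.2) 2 (p.timeMeasure.prod P) ^ 2 := by
  rw [sq_eLpNorm_two, sq_eLpNorm_two, lintegral_prod_symm _ (hX.enorm.pow_const 2).aemeasurable,
    ← lintegral_const_mul' _ _ (measure_ne_top _ _)]
  exact lintegral_mono fun ω => sq_enorm_primitive_le hX t ω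

lemma sq_eLpNorm_prod_primitive_le {X : p.Time → Ω → ℝ}
    (hX : Measurable fun q : p.Time × Ω => X q.1 q.2)
    (hX' : Measurable fun q : p.Time × Ω => primitive X q.1 q.2) :
    eLpNorm (fun q : p.Time × Ω => primitive X q.1 q.2) 2 (p.timeMeasure.prod P) ^ 2 ≤
      p.timeMeasure Set.univ ^ 2 *
      eLpNorm (fun q : p.Time × Ω => X q.1 q.2) 2 (p.timeMeasure.prod P) ^ 2 := by
  rw [sq_eLpNorm_prod hX']
  refine (lintegral_mono fun t => sq_eLpNorm_primitive_le hX t).trans_eq ?_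
  rw [lintegral_const]
  ring

lemma memLp_prod_primitive {X : p.Time → Ω → ℝ}
    (hX : Measurable fun q : p.Time × Ω => X q.1 q.2)
    (hX' : Measurable fun q : p.Time × Ω => primitive X q.1 q.2)
    (h : MemLp (fun q : p.Time × Ω => X q.1 q.2) 2 (p.timeMeasure.prod P)) :
    MemLp (fun q : p.Time × Ω => primitive X q.1 q.2) 2 (p.timeMeasure.prod P) := by
  refine ⟨hX'.aestronglyMeasurable, ?_⟩
  have := (sq_eLpNorm_prod_primitive_le hX hX').trans_lt
    (ENNReal.mul_lt_top (ENNReal.pow_lt_top (measure_lt_top _ _)) (ENNReal.pow_lt_top h.2))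
  exact (ENNReal.pow_lt_top_iff.1 this).resolve_right two_ne_zero

lemma memLp_primitive {X : p.Time → Ω → ℝ}
    (hX : Measurable fun q : p.Time × Ω => X q.1 q.2) (t : p.Time)
    (hX' : Measurable (primitive X t))
    (h : MemLp (fun q : p.Time × Ω => X q.1 q.2) 2 (p.timeMeasure.prod P)) :
    MemLp (primitive X t) 2 P := by
  refine ⟨hX'.aestronglyMeasurable, ?_⟩
  have := (sq_eLpNorm_primitive_le (P := P) hX t).trans_lt
    (ENNReal.mul_lt_top (measure_lt_top _ _) (ENNReal.pow_lt_top h.2))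
  exact (ENNReal.pow_lt_top_iff.1 this).resolve_right two_ne_zero

end TraderParams

/-! ### Conditional expectations and conditional laws -/

section Conditioning


lemma setIntegral_eq_of_indep {Ω : Type*} {m₁ m₂ mΩ : MeasurableSpace Ω} {P : Measure Ω}
    [IsProbabilityMeasure P] (h₁ : m₁ ≤ mΩ) (h₂ : m₂ ≤ mΩ)
    (h : Indep m₁ m₂ P) {Z : Ω → ℝ} (hZ : StronglyMeasurable[m₁] Z) (hZi : Integrable Z P)
    {B : Set Ω} (hB : MeasurableSet[m₂] B) : ∫ ω in B, Z ω ∂P = P.real B * ∫ ω, Z ω ∂P := by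
  rw [← setIntegral_condExp h₂ hZi hB,
    setIntegral_congr_ae (g := fun _ => ∫ ω, Z ω ∂P) (h₂ _ hB)]
  · simp
  · filter_upwards [condExp_indep_eq h₁ h₂ hZ h] with ω hω _ using hω

/-- Conditioning on additional independent information does not change a conditional
expectation. -/
lemma condExp_sup_of_indep {Ω : Type*} {m₁ m₂ mΩ : MeasurableSpace Ω} {P : Measure Ω}
    [IsProbabilityMeasure P] (h₁ : m₁ ≤ mΩ) (h₂ : m₂ ≤ mΩ)
    {Y : Ω → ℝ} (hY : Measurable Y) (hYi : Integrable Y P)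
    (h : Indep m₂ (m₁ ⊔ MeasurableSpace.comap Y inferInstance) P) :
    P[Y | m₁ ⊔ m₂] =ᵐ[P] P[Y | m₁] := by
  have hm : m₁ ⊔ m₂ ≤ mΩ := sup_le h₁ h₂
  have hY' : m₁ ⊔ MeasurableSpace.comap Y inferInstance ≤ mΩ := sup_le h₁ hY.comap_le
  -- The intersections A ∩ B form a π-system that generates m₁ ⊔ m₂, so it suffices to compare
  -- integrals over them.
  set C : Set (Set Ω) :=
    {s | ∃ A B, MeasurableSet[m₁] A ∧ MeasurableSet[m₂] B ∧ s = A ∩ B} with hC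
  have hgen : m₁ ⊔ m₂ = MeasurableSpace.generateFrom C := by
    refine le_antisymm (sup_le ?_ ?_) ?_
    · exact fun A hA => MeasurableSpace.measurableSet_generateFrom
        ⟨A, Set.univ, hA, MeasurableSet.univ, (Set.inter_univ A).symm⟩
    · exact fun B hB => MeasurableSpace.measurableSet_generateFrom
        ⟨Set.univ, B, MeasurableSet.univ, hB, (Set.univ_inter B).symm⟩
    · refine MeasurableSpace.generateFrom_le ?_
      rintro _ ⟨A, B, hA, hB, rfl⟩
      exact MeasurableSet.inter ((le_sup_left : m₁ ≤ m₁ ⊔ m₂) A hA)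
        ((le_sup_right : m₂ ≤ m₁ ⊔ m₂) B hB)
  have hpi : IsPiSystem C := by
    rintro _ ⟨A, B, hA, hB, rfl⟩ _ ⟨A', B', hA', hB', rfl⟩ -
    exact ⟨A ∩ A', B ∩ B', hA.inter hA', hB.inter hB', Set.inter_inter_inter_comm _ _ _ _⟩
  -- Z restricted to A is measurable for m₁ ⊔ σ(Y), hence independent of B. This applies both to Y
  -- and to P[Y | m₁], with the same factor P(B).
  have hprod : ∀ {Z : Ω → ℝ}, StronglyMeasurable[m₁ ⊔ MeasurableSpace.comap Y inferInstance] Z →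
      Integrable Z P → ∀ A B, MeasurableSet[m₁] A → MeasurableSet[m₂] B →
      ∫ ω in A ∩ B, Z ω ∂P = P.real B * ∫ ω in A, Z ω ∂P := fun {Z} hZ hZi A B hA hB => by
    rw [Set.inter_comm, ← setIntegral_indicator (h₁ _ hA), ← integral_indicator (h₁ _ hA)]
    refine setIntegral_eq_of_indep hY' h₂ h.symm (hZ.indicator ?_) (hZi.indicator (h₁ _ hA)) hB
    exact (le_sup_left : m₁ ≤ m₁ ⊔ MeasurableSpace.comap Y inferInstance) A hA
  refine (ae_eq_condExp_of_forall_setIntegral_eq hm hYi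
    (fun _ _ _ => integrable_condExp.integrableOn) (fun s hs _ => ?_)
    (stronglyMeasurable_condExp.mono
      (le_sup_left : m₁ ≤ m₁ ⊔ m₂)).aestronglyMeasurable).symm
  induction s, hs using MeasurableSpace.induction_on_inter hgen hpi with
  | empty => simp
  | basic s hs =>
    obtain ⟨A, B, hA, hB, rfl⟩ := hs
    rw [hprod (stronglyMeasurable_condExp.mono le_sup_left) integrable_condExp A B hA hB,
      hprod ?_ hYi A B hA hB, setIntegral_condExp h₁ hYi hA]
    have hc : MeasurableSpace.comap Y inferInstance ≤
      m₁ ⊔ MeasurableSpace.comap Y inferInstance := le_sup_right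
    exact ((comap_measurable Y).mono hc le_rfl).stronglyMeasurable
  | compl s hs ih =>
    have := ih (measure_lt_top _ _)
    have e1 := integral_add_compl (hm _ hs) (integrable_condExp (m := m₁) (f := Y) (μ := P))
    have e2 := integral_add_compl (hm _ hs) hYi
    rw [integral_condExp h₁] at e1
    linarith
  | iUnion f hd hf ih =>
    rw [integral_iUnion (fun i => hm _ (hf i)) hd integrable_condExp.integrableOn,
      integral_iUnion (fun i => hm _ (hf i)) hd hYi.integrableOn]
    exact tsum_congr fun i => ih i (measure_lt_top _ _)

lemma integral_mul_sub_eq_zero {Ω : Type*} {m mΩ : MeasurableSpace Ω} {P : Measure Ω}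
    [IsProbabilityMeasure P] (hm : m ≤ mΩ) {k Y Z : Ω → ℝ}
    (hk : Measurable[m] k) (hkL : MemLp k 2 P) (hY : MemLp Y 2 P) (hZ : MemLp Z 2 P)
    (h : Z =ᵐ[P] P[Y | m]) : ∫ ω, k ω * (Y ω - Z ω) ∂P = 0 := by
  have hYi := hY.integrable one_le_two
  have h1 : Integrable (k * Y) P := hkL.integrable_mul hY
  have h2 : Integrable (k * Z) P := hkL.integrable_mul hZ
  have h3 : ∫ ω, (k * Y) ω ∂P = ∫ ω, (k * Z) ω ∂P := by
    rw [← integral_condExp hm (f := k * Y)]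
    refine integral_congr_ae ?_
    filter_upwards [condExp_mul_of_stronglyMeasurable_left hk.stronglyMeasurable h1 hYi, h]
      with ω hω hω'
    rw [hω, Pi.mul_apply, Pi.mul_apply, hω']
  simp only [Pi.mul_apply] at h3
  calc ∫ ω, k ω * (Y ω - Z ω) ∂P = ∫ ω, (k ω * Y ω - k ω * Z ω) ∂P := by simp only [mul_sub]
    _ = 0 := (integral_sub h1 h2).trans (sub_eq_zero.2 h3)

/-- The conditional expectation of a function of a known and an independent variable. -/
lemma condExp_comp_of_indep {Ω : Type*} {m mΩ : MeasurableSpace Ω} {P : Measure Ω}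
    [IsProbabilityMeasure P] (hm : m ≤ mΩ) {X Y : Ω → ℝ}
    (hX : Measurable[m] X) (hY : Measurable Y)
    (h : Indep (MeasurableSpace.comap Y inferInstance) m P) {g : ℝ × ℝ → ℝ} (hg : Measurable g)
    {C : ℝ} (hC : ∀ x, ‖g x‖ ≤ C) :
    (fun ω => ∫ y, g (X ω, y) ∂(P.map Y)) =ᵐ[P] P[fun ω => g (X ω, Y ω) | m] := by
  have : IsProbabilityMeasure (P.map Y) := Measure.isProbabilityMeasure_map hY.aemeasurable
  have hX' : Measurable X := hX.mono hm le_rfl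
  have hgm : StronglyMeasurable fun x : ℝ => ∫ y, g (x, y) ∂(P.map Y) :=
    hg.stronglyMeasurable.integral_prod_right'
  have hgb : ∀ x, ‖∫ y, g (x, y) ∂(P.map Y)‖ ≤ C := fun x => by
    simpa using norm_integral_le_of_norm_le_const (μ := P.map Y)
      (Filter.Eventually.of_forall fun y => hC (x, y))
  have hi1 : Integrable (fun ω => g (X ω, Y ω)) P := Integrable.of_bound
    (hg.comp (hX'.prodMk hY)).aestronglyMeasurable C (Filter.Eventually.of_forall fun ω => hC _)
  have hi2 : Integrable (fun ω => ∫ y, g (X ω, y) ∂(P.map Y)) P := Integrable.of_bound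
    (hgm.measurable.comp hX').aestronglyMeasurable C (Filter.Eventually.of_forall fun ω => hgb _)
  refine ae_eq_condExp_of_forall_setIntegral_eq hm hi1 (fun _ _ _ => hi2.integrableOn)
    (fun s hs _ => ?_) (hgm.measurable.comp hX).stronglyMeasurable.aestronglyMeasurable
  -- Pairing X with the indicator of s turns an integral over s into one against the law of (Z, Y).
  -- That law is a product, and Fubini's theorem integrates Y out.
  set Z : Ω → ℝ × ℝ := fun ω => (s.indicator (fun _ => 1) ω, X ω) with hZ
  have hZm : Measurable[m] Z := (measurable_const.indicator hs).prodMk hX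
  have hZ' : Measurable Z := hZm.mono hm le_rfl
  have hind : IndepFun Z Y P := by
    have : Indep m (MeasurableSpace.comap Y inferInstance) P := h.symm
    exact indep_of_indep_of_le_left this hZm.comap_le
  have hlaw := (indepFun_iff_map_prod_eq_prod_map_map hZ'.aemeasurable hY.aemeasurable).1 hind
  have hGm : Measurable fun q : (ℝ × ℝ) × ℝ => q.1.1 * g (q.1.2, q.2) := by fun_prop
  have : IsProbabilityMeasure (P.map Z) := Measure.isProbabilityMeasure_map hZ'.aemeasurable
  have hGi : Integrable (fun q : (ℝ × ℝ) × ℝ => q.1.1 * g (q.1.2, q.2))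
      ((P.map Z).prod (P.map Y)) := by
    rw [← hlaw, integrable_map_measure hGm.aestronglyMeasurable (hZ'.prodMk hY).aemeasurable]
    refine (hi1.indicator (hm _ hs)).congr (Filter.Eventually.of_forall fun ω => ?_)
    by_cases hω : ω ∈ s <;> simp [hZ, hω]
  have e1 : ∫ ω in s, g (X ω, Y ω) ∂P =
      ∫ q, q.1.1 * g (q.1.2, q.2) ∂((P.map Z).prod (P.map Y)) := by
    rw [← hlaw, integral_map (hZ'.prodMk hY).aemeasurable hGm.aestronglyMeasurable,
      ← integral_indicator (hm _ hs)]
    refine integral_congr_ae (Filter.Eventually.of_forall fun ω => ?_)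
    by_cases hω : ω ∈ s <;> simp [hZ, hω]
  rw [e1, integral_prod _ hGi, integral_map hZ'.aemeasurable
    hGm.stronglyMeasurable.integral_prod_right'.aestronglyMeasurable, ← integral_indicator (hm _ hs)]
  refine integral_congr_ae (Filter.Eventually.of_forall fun ω => ?_)
  by_cases hω : ω ∈ s <;> simp [hZ, hω]

/-- A family of probability measures with the conditional probabilities of `Y` is the conditional
distribution of `Y`. -/
lemma ae_eq_condDistrib {Ω : Type*} {mΩ : MeasurableSpace Ω} {P : Measure Ω}
    [IsProbabilityMeasure P] {β : Type*} {mβ : MeasurableSpace β} {X : Ω → β} (hX : Measurable X)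
    {Y : Ω → ℝ} (hY : Measurable Y) {ρ : Ω → Measure ℝ} (hρ : ∀ ω, IsProbabilityMeasure (ρ ω))
    (h : ∀ S : Set ℝ, MeasurableSet S → (fun ω => (ρ ω).real S) =ᵐ[P]
      P[(Y ⁻¹' S).indicator (fun _ => (1 : ℝ)) | mβ.comap X]) :
    ρ =ᵐ[P] fun ω => condDistrib Y X P (X ω) := by
  -- Intervals with rational endpoints cost countably many null sets and determine the measure.
  have h1 : ∀ᵐ ω ∂P, ∀ r r' : ℚ, (ρ ω).real (Set.Ioo (r : ℝ) r') =
      (condDistrib Y X P (X ω)).real (Set.Ioo (r : ℝ) r') := by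
    refine ae_all_iff.2 fun r => ae_all_iff.2 fun r' => ?_
    exact (h _ measurableSet_Ioo).trans (condDistrib_ae_eq_condExp hX hY measurableSet_Ioo).symm
  filter_upwards [h1] with ω hω
  refine Real.measure_ext_Ioo_rat fun r r' => ?_
  exact (measureReal_eq_measureReal_iff).1 (hω r r')

/-- The mean of a version of the conditional law is the conditional expectation. -/
lemma integral_ae_eq_condExp {Ω : Type*} {m mΩ : MeasurableSpace Ω} {P : Measure Ω}
    [IsProbabilityMeasure P] (hm : m ≤ mΩ) {Y : Ω → ℝ} (hY : Measurable Y) (hYi : Integrable Y P)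
    {ρ : Ω → Measure ℝ} (hρ : ∀ ω, IsProbabilityMeasure (ρ ω))
    (h : ∀ S : Set ℝ, MeasurableSet S → (fun ω => (ρ ω).real S) =ᵐ[P]
      P[(Y ⁻¹' S).indicator (fun _ => (1 : ℝ)) | m]) :
    (fun ω => ∫ x, x ∂(ρ ω)) =ᵐ[P] P[Y | m] := by
  -- Conditioning on m is conditioning on the identity map from Ω to Ω with the σ-algebra m.
  have hid : @Measurable Ω Ω mΩ m id := measurable_id'' hm
  have hc : MeasurableSpace.comap id m = m := MeasurableSpace.comap_id
  have h1 := @ae_eq_condDistrib Ω mΩ P _ Ω m id hid Y hY ρ hρ (by rwa [hc])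
  have h2 := @condExp_ae_eq_integral_condDistrib' Ω Ω mΩ P _ id m ℝ _ _ _ _ _ _ Y hid hYi
  rw [hc] at h2
  filter_upwards [h1, h2] with ω h1 h2
  rw [h1, h2]

/-- Two versions of the conditional law agree. -/
lemma ae_eq_of_condLaw {Ω : Type*} {m mΩ : MeasurableSpace Ω} {P : Measure Ω}
    [IsProbabilityMeasure P] (hm : m ≤ mΩ) {Y Y' : Ω → ℝ} (hY : Measurable Y) (hYY' : Y =ᵐ[P] Y')
    {ρ ρ' : Ω → Measure ℝ} (hρ : ∀ ω, IsProbabilityMeasure (ρ ω))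
    (hρ' : ∀ ω, IsProbabilityMeasure (ρ' ω))
    (h : ∀ S : Set ℝ, MeasurableSet S → (fun ω => (ρ ω).real S) =ᵐ[P]
      P[(Y ⁻¹' S).indicator (fun _ => (1 : ℝ)) | m])
    (h' : ∀ S : Set ℝ, MeasurableSet S → (fun ω => (ρ' ω).real S) =ᵐ[P]
      P[(Y' ⁻¹' S).indicator (fun _ => (1 : ℝ)) | m]) : ρ =ᵐ[P] ρ' := by
  have hid : @Measurable Ω Ω mΩ m id := measurable_id'' hm
  have hc : MeasurableSpace.comap id m = m := MeasurableSpace.comap_id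
  have h1 := @ae_eq_condDistrib Ω mΩ P _ Ω m id hid Y hY ρ hρ (by rwa [hc])
  have h2 := @ae_eq_condDistrib Ω mΩ P _ Ω m id hid Y hY ρ' hρ' (by
    rw [hc]
    intro S hS
    refine (h' S hS).trans (condExp_congr_ae ?_)
    filter_upwards [hYY'] with ω hω
    by_cases hS' : Y ω ∈ S
    · rw [Set.indicator_of_mem (show ω ∈ Y ⁻¹' S from hS'), Set.indicator_of_mem]
      exact (hω ▸ hS' : Y' ω ∈ S)
    · rw [Set.indicator_of_notMem (show ω ∉ Y ⁻¹' S from hS'), Set.indicator_of_notMem]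
      exact (hω ▸ hS' : Y' ω ∉ S))
  exact h1.trans h2.symm

end Conditioning

/-! ### The objective as a concave quadratic functional -/

namespace TraderParams

variable {p : TraderParams} {Ω : Type*} {mΩ : MeasurableSpace Ω}

/-- The running gain of the representative trader, when the mean rate is `R`. -/
def runningGain (p : TraderParams) (Q₀ μ : Ω → ℝ) (R ν : p.Time → Ω → ℝ) (t : p.Time)
    (ω : Ω) : ℝ :=
  p.inventory Q₀ ν t ω * (p.b * R t ω + μ ω) - p.η * ν t ω ^ 2
    - 2 * p.a * p.inventory Q₀ ν t ω * ν t ω - p.φ * p.inventory Q₀ ν t ω ^ 2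

/-- The derivative of the running gain in the direction `h`. -/
def gainVariation (p : TraderParams) (Q₀ μ : Ω → ℝ) (R ν h : p.Time → Ω → ℝ) (t : p.Time)
    (ω : Ω) : ℝ :=
  primitive h t ω * (p.b * R t ω + μ ω) - 2 * p.η * ν t ω * h t ω
    - 2 * p.a * (primitive h t ω * ν t ω + p.inventory Q₀ ν t ω * h t ω)
    - 2 * p.φ * p.inventory Q₀ ν t ω * primitive h t ω

/-- The second order part of the running gain in the direction `h`, up to sign. -/
def gainCurvature (p : TraderParams) (h : p.Time → Ω → ℝ) (t : p.Time) (ω : Ω) : ℝ :=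
  p.η * h t ω ^ 2 + 2 * p.a * (primitive h t ω * h t ω) + p.φ * primitive h t ω ^ 2

/-- A jointly measurable, square integrable process. -/
structure IsSquareIntegrable (P : Measure Ω) (X : p.Time → Ω → ℝ) : Prop where
  measurable : Measurable fun q : p.Time × Ω => X q.1 q.2
  memLp : MemLp (fun q : p.Time × Ω => X q.1 q.2) 2 (p.timeMeasure.prod P)

variable {P : Measure Ω} [IsProbabilityMeasure P]

lemma measurable_primitive (hp : p.Positive) {X : p.Time → Ω → ℝ}
    (hX : Measurable fun q : p.Time × Ω => X q.1 q.2) :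
    Measurable fun q : p.Time × Ω => primitive X q.1 q.2 := by
  have h : IsProgressive (Filtration.const p.Time mΩ le_rfl) X := fun i =>
    hX.comp ((measurable_subtype_coe.comp measurable_fst).prodMk measurable_snd)
  exact hp.measurable_of_isProgressive (isProgressive_primitive h)

namespace IsSquareIntegrable

variable {X Y : p.Time → Ω → ℝ}

lemma primitive (hp : p.Positive) (hX : IsSquareIntegrable P X) :
    IsSquareIntegrable P (primitive X) :=
  ⟨measurable_primitive hp hX.measurable,
    memLp_prod_primitive hX.measurable (measurable_primitive hp hX.measurable) hX.memLp⟩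

omit [IsProbabilityMeasure P] in
lemma add (hX : IsSquareIntegrable P X) (hY : IsSquareIntegrable P Y) :
    IsSquareIntegrable P fun t ω => X t ω + Y t ω :=
  ⟨hX.measurable.add hY.measurable, hX.memLp.add hY.memLp⟩

omit [IsProbabilityMeasure P] in
lemma sub (hX : IsSquareIntegrable P X) (hY : IsSquareIntegrable P Y) :
    IsSquareIntegrable P fun t ω => X t ω - Y t ω :=
  ⟨hX.measurable.sub hY.measurable, hX.memLp.sub hY.memLp⟩

omit [IsProbabilityMeasure P] in
lemma const_mul (hX : IsSquareIntegrable P X) (c : ℝ) :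
    IsSquareIntegrable P fun t ω => c * X t ω :=
  ⟨hX.measurable.const_mul c, hX.memLp.const_mul c⟩

omit [IsProbabilityMeasure P] in
lemma integrable_mul (hX : IsSquareIntegrable P X) (hY : IsSquareIntegrable P Y) :
    Integrable (fun q : p.Time × Ω => X q.1 q.2 * Y q.1 q.2) (p.timeMeasure.prod P) :=
  hX.memLp.integrable_mul hY.memLp

lemma integrable (hX : IsSquareIntegrable P X) :
    Integrable (fun q : p.Time × Ω => X q.1 q.2) (p.timeMeasure.prod P) :=
  hX.memLp.integrable one_le_two

lemma ae_integrable (hX : IsSquareIntegrable P X) :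
    ∀ᵐ ω ∂P, Integrable (fun t => X t ω) p.timeMeasure := hX.integrable.prod_left_ae

lemma ae_memLp (hX : IsSquareIntegrable P X) : ∀ᵐ t ∂p.timeMeasure, MemLp (X t) 2 P := by
  have h1 : ∫⁻ t, eLpNorm (X t) 2 P ^ 2 ∂p.timeMeasure ≠ ⊤ := by
    rw [← sq_eLpNorm_prod hX.measurable]
    exact ENNReal.pow_ne_top hX.memLp.2.ne
  have h2 : Measurable fun t => eLpNorm (X t) 2 P ^ 2 := by
    simp only [sq_eLpNorm_two]
    exact (hX.measurable.enorm.pow_const 2).lintegral_prod_right'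
  filter_upwards [ae_lt_top h2 h1] with t ht
  exact ⟨(hX.measurable.comp measurable_prodMk_left).aestronglyMeasurable,
    (ENNReal.pow_lt_top_iff.1 ht).resolve_right two_ne_zero⟩

lemma const {Y : Ω → ℝ} (hY : Measurable Y) (hY' : MemLp Y 2 P) :
    IsSquareIntegrable (p := p) P fun _ => Y :=
  ⟨hY.comp measurable_snd, hY'.comp_snd _⟩

omit [IsProbabilityMeasure P] in
lemma deterministic_mul {f : p.Time → ℝ} (hf : Continuous f) (hX : IsSquareIntegrable P X) :
    IsSquareIntegrable P fun t ω => f t * X t ω := by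
  obtain ⟨C, hC⟩ := isCompact_univ.exists_bound_of_continuousOn hf.continuousOn
  have hm : Measurable fun q : p.Time × Ω => f q.1 * X q.1 q.2 :=
    (hf.measurable.comp measurable_fst).mul hX.measurable
  refine ⟨hm, hX.memLp.of_le_mul (c := C) hm.aestronglyMeasurable
    (Filter.Eventually.of_forall fun q => ?_)⟩
  rw [norm_mul]
  exact mul_le_mul_of_nonneg_right (hC _ trivial) (norm_nonneg _)

lemma inventory (hp : p.Positive) {Q₀ : Ω → ℝ} (hQ₀ : Measurable Q₀) (hQ₀' : MemLp Q₀ 2 P)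
    (hX : IsSquareIntegrable P X) : IsSquareIntegrable P (p.inventory Q₀ X) :=
  (const hQ₀ hQ₀').add (hX.primitive hp)

/-- The primitive is linear, up to a null set of paths. -/
lemma primitive_add_mul (hX : IsSquareIntegrable P X) (hY : IsSquareIntegrable P Y) (c : ℝ) :
    ∀ᵐ ω ∂P, ∀ t, TraderParams.primitive (fun t ω => X t ω + c * Y t ω) t ω =
      TraderParams.primitive X t ω + c * TraderParams.primitive Y t ω := by
  filter_upwards [hX.ae_integrable, hY.ae_integrable] with ω h1 h2 t
  unfold TraderParams.primitive
  rw [integral_add h1.integrableOn (h2.const_mul c).integrableOn, integral_const_mul]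

end IsSquareIntegrable

omit [IsProbabilityMeasure P] in
lemma ae_prod_of_ae_snd {Pr : p.Time → Ω → Prop} (h : ∀ᵐ ω ∂P, ∀ t, Pr t ω) :
    ∀ᵐ q ∂(p.timeMeasure.prod P), Pr q.1 q.2 := by
  filter_upwards [Measure.quasiMeasurePreserving_snd.ae h] with q hq using hq q.1

variable {Q₀ μ : Ω → ℝ} {R ν h : p.Time → Ω → ℝ}

section Gain

variable (hp : p.Positive) (hQ₀ : Measurable Q₀) (hQ₀' : MemLp Q₀ 2 P) (hμ : Measurable μ)
  (hμ' : MemLp μ 2 P) (hR : IsSquareIntegrable P R) (hν : IsSquareIntegrable P ν)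
  (hh : IsSquareIntegrable P h)

include hp hQ₀ hQ₀' hμ hμ' hR hν in
lemma integrable_runningGain : Integrable
    (fun q : p.Time × Ω => p.runningGain Q₀ μ R ν q.1 q.2) (p.timeMeasure.prod P) := by
  have hQ := hν.inventory hp hQ₀ hQ₀'
  have hS := (hR.const_mul p.b).add (IsSquareIntegrable.const hμ hμ')
  refine ((((hQ.integrable_mul hS).sub ((hν.integrable_mul hν).const_mul p.η)).sub
    ((hQ.integrable_mul hν).const_mul (2 * p.a))).sub
    ((hQ.integrable_mul hQ).const_mul p.φ)).congr (Filter.Eventually.of_forall fun q => ?_)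
  simp only [runningGain, Pi.sub_apply]
  ring

include hp hQ₀ hQ₀' hμ hμ' hR hν hh in
lemma integrable_gainVariation : Integrable
    (fun q : p.Time × Ω => p.gainVariation Q₀ μ R ν h q.1 q.2) (p.timeMeasure.prod P) := by
  have hQ := hν.inventory hp hQ₀ hQ₀'
  have hH := hh.primitive hp
  have hS := (hR.const_mul p.b).add (IsSquareIntegrable.const hμ hμ')
  refine ((((hH.integrable_mul hS).sub ((hν.integrable_mul hh).const_mul (2 * p.η))).sub
    (((hH.integrable_mul hν).add (hQ.integrable_mul hh)).const_mul (2 * p.a))).sub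
    ((hQ.integrable_mul hH).const_mul (2 * p.φ))).congr (Filter.Eventually.of_forall fun q => ?_)
  simp only [gainVariation, Pi.sub_apply, Pi.add_apply]
  ring

include hp hh in
lemma integrable_gainCurvature : Integrable
    (fun q : p.Time × Ω => p.gainCurvature h q.1 q.2) (p.timeMeasure.prod P) := by
  have hH := hh.primitive hp
  refine ((((hh.integrable_mul hh).const_mul p.η).add
    ((hH.integrable_mul hh).const_mul (2 * p.a))).add
    ((hH.integrable_mul hH).const_mul p.φ)).congr (Filter.Eventually.of_forall fun q => ?_)
  simp only [gainCurvature, Pi.add_apply]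
  ring

-- The inventory is affine in the control, so the gain is a quadratic polynomial in c. Its curvature
-- depends on neither Q₀, μ, R nor ν.
include hp hQ₀ hQ₀' hμ hμ' hR hν hh in
lemma integral_runningGain_add_mul (c : ℝ) :
    ∫ q, p.runningGain Q₀ μ R (fun t ω => ν t ω + c * h t ω) q.1 q.2 ∂(p.timeMeasure.prod P) =
      ∫ q, p.runningGain Q₀ μ R ν q.1 q.2 ∂(p.timeMeasure.prod P) +
        c * ∫ q, p.gainVariation Q₀ μ R ν h q.1 q.2 ∂(p.timeMeasure.prod P) -
        c ^ 2 * ∫ q, p.gainCurvature h q.1 q.2 ∂(p.timeMeasure.prod P) := by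
  have h1 := integrable_runningGain hp hQ₀ hQ₀' hμ hμ' hR hν
  have h2 := (integrable_gainVariation hp hQ₀ hQ₀' hμ hμ' hR hν hh).const_mul c
  have h3 := (integrable_gainCurvature hp hh).const_mul (c ^ 2)
  rw [← integral_const_mul, ← integral_const_mul, ← integral_add h1 h2]
  refine Eq.trans (integral_congr_ae ?_) (integral_sub (h1.add h2) h3)
  filter_upwards [ae_prod_of_ae_snd (hν.primitive_add_mul hh c)] with q hq
  simp only [runningGain, gainVariation, gainCurvature, inventory_eq, hq]
  ring

-- Along a path the cross term 2aHh integrates to aH(T)² ≥ 0, and the term in φ is nonnegative. What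
-- remains is the coercive part.
include hp hh in
lemma integral_gainCurvature_ge :
    p.η * ∫ q, h q.1 q.2 ^ 2 ∂(p.timeMeasure.prod P) ≤
      ∫ q, p.gainCurvature h q.1 q.2 ∂(p.timeMeasure.prod P) := by
  have hH := hh.primitive hp
  have h0 : 0 ≤ ∫ q, primitive h q.1 q.2 * h q.1 q.2 ∂(p.timeMeasure.prod P) := by
    rw [integral_prod_symm _ (hH.integrable_mul hh)]
    refine integral_nonneg_of_ae ?_
    filter_upwards [hh.ae_integrable] with ω hω
    have hA := HasACDeriv.of_intervalIntegrable (intervalIntegrable_extend hp hω) 0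
    have hB := (hA.mul hA).integral_eq_sub hp.T_mem
    simp only [intervalIntegral.integral_same] at hB
    have e : 2 * ∫ t, primitive h t ω * h t ω ∂p.timeMeasure =
        (∫ u in (0 : ℝ)..p.T, extend hp (fun t => h t ω) u) ^ 2 := by
      rw [integral_extend hp, ← intervalIntegral.integral_const_mul]
      refine Eq.trans ?_ (hB.trans (by ring))
      refine intervalIntegral.integral_congr fun r hr => ?_
      have hr' : r ∈ Set.Icc 0 p.T := Set.uIcc_subset_Icc hp.zero_mem hp.T_mem hr
      simp only [extend_of_mem hp _ hr', primitive, setIntegral_Iic_extend hp]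
      ring
    have := sq_nonneg (∫ u in (0 : ℝ)..p.T, extend hp (fun t => h t ω) u)
    simp only [Pi.zero_apply]
    linarith
  have e : ∫ q, p.gainCurvature h q.1 q.2 ∂(p.timeMeasure.prod P) =
      p.η * ∫ q, h q.1 q.2 ^ 2 ∂(p.timeMeasure.prod P) +
        2 * p.a * ∫ q, primitive h q.1 q.2 * h q.1 q.2 ∂(p.timeMeasure.prod P) +
        p.φ * ∫ q, primitive h q.1 q.2 ^ 2 ∂(p.timeMeasure.prod P) := by
    have h1 := hh.memLp.integrable_sq.const_mul p.η
    have h2 := (hH.integrable_mul hh).const_mul (2 * p.a)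
    have h3 := hH.memLp.integrable_sq.const_mul p.φ
    rw [← integral_const_mul, ← integral_const_mul, ← integral_const_mul, ← integral_add h1 h2]
    exact integral_add (h1.add h2) h3
  have h4 : 0 ≤ ∫ q, primitive h q.1 q.2 ^ 2 ∂(p.timeMeasure.prod P) :=
    integral_nonneg fun q => sq_nonneg _
  have ha := hp.a
  have hφ := hp.φ
  rw [e]
  have := mul_nonneg (by positivity : 0 ≤ 2 * p.a) h0
  have := mul_nonneg hφ.le h4
  linarith

include hp hQ₀ hQ₀' hμ hμ' hν in
lemma traderObjective_eq {m : p.Time → Ω → Measure ℝ} (hR : IsSquareIntegrable P (p.meanRate m)) :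
    p.traderObjective P Q₀ μ m ν =
      ∫ q, p.runningGain Q₀ μ (p.meanRate m) ν q.1 q.2 ∂(p.timeMeasure.prod P) := by
  rw [integral_prod_symm _ (integrable_runningGain hp hQ₀ hQ₀' hμ hμ' hR hν)]
  rfl

end Gain

end TraderParams

/-! ### The candidate equilibrium -/

namespace TraderParams

variable {p : TraderParams} {Ω : Type*} {mΩ : MeasurableSpace Ω}

/-- The standing assumptions on the information and the signal. -/
structure SignalModel (p : TraderParams) (P : Measure Ω) (F : Filtration p.Time mΩ)
    (Q₀ μ : Ω → ℝ) (M : p.Time → Ω → ℝ) : Prop where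
  measurable_inventory : Measurable Q₀
  memLp_inventory : MemLp Q₀ 2 P
  measurable_signal : Measurable μ
  memLp_signal : MemLp μ 2 P
  indep : Indep (MeasurableSpace.comap Q₀ inferInstance)
    ((⨆ t, F t) ⊔ MeasurableSpace.comap μ inferInstance) P
  progressive : IsProgressive F M
  condExp : ∀ t, M t =ᵐ[P] P[μ | F t]

/-- The mean rate as a process. -/
def crowdPath (p : TraderParams) (q : ℝ) (M : p.Time → Ω → ℝ) (t : p.Time) (ω : Ω) : ℝ :=
  p.crowdRate q (fun u => M u ω) t

/-- The rate of the representative trader as a process. -/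
def traderPath (p : TraderParams) (q : ℝ) (Q₀ : Ω → ℝ) (M : p.Time → Ω → ℝ) (t : p.Time)
    (ω : Ω) : ℝ :=
  p.traderRate q (Q₀ ω) (fun u => M u ω) t

/-- The conditional law of the rate of the representative trader. -/
def crowdLaw (p : TraderParams) (q : ℝ) (ρ : Measure ℝ) (M : p.Time → Ω → ℝ) (t : p.Time)
    (ω : Ω) : Measure ℝ :=
  ρ.map fun x => p.traderRate q x (fun u => M u ω) t

lemma crowdPath_eq (q : ℝ) (M : p.Time → Ω → ℝ) (t : p.Time) (ω : Ω) :
    p.crowdPath q M t ω = p.crowdDeriv t * (q / p.crowd 0 +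
      primitive (fun u ω => p.signalRatio u * M u ω) t ω) + p.signalCoef t * M t ω := rfl

lemma traderPath_eq (q : ℝ) (Q₀ : Ω → ℝ) (M : p.Time → Ω → ℝ) (t : p.Time) (ω : Ω) :
    p.traderPath q Q₀ M t ω =
      p.crowdPath q M t ω + p.soloDeriv t / p.solo 0 * (Q₀ ω - q) := rfl

section Coefficients

variable (hp : p.Positive)
include hp

lemma Positive.signalPart_eq (hθ : p.b * p.opBound < 1) (M : p.Time → Ω → ℝ) (t : p.Time)
    (ω : Ω) : p.signalPart p.riccatiSol M t ω =
      p.crowdDeriv t * primitive (fun u ω => p.signalRatio u * M u ω) t ω +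
        p.signalCoef t * M t ω := by
  rw [signalPart, hp.Dbar_eq hθ t.2, mul_comm (M t ω), primitive, ← integral_const_mul]
  congr 1
  refine setIntegral_congr_fun measurableSet_Iic fun s _ => ?_
  simp only [hp.Cbar_eq hθ s.2 t.2]
  ring

lemma Positive.crowdPath_eq_signalPart (hθ : p.b * p.opBound < 1) (q : ℝ)
    (M : p.Time → Ω → ℝ) (t : p.Time) (ω : Ω) :
    p.crowdPath q M t ω = (p.Abar p.riccatiSol t + p.Bbar p.riccatiSol t) * q +
      p.signalPart p.riccatiSol M t ω := by
  rw [crowdPath_eq, hp.signalPart_eq hθ, hp.Abar_eq hθ t.2, hp.Bbar_eq t.2]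
  ring

/-- Since Ā + B̄ = v'/v(0), the initial inventories regroup into a mean part driven by `crowd` and a
deviation Q₀ - E[Q₀] driven by `solo`, which does not feel the impact b. -/
lemma Positive.nuHat_eq (hθ : p.b * p.opBound < 1) (P : Measure Ω) (Q₀ : Ω → ℝ)
    (M : p.Time → Ω → ℝ) :
    p.nuHat p.riccatiSol P Q₀ M = p.traderPath (∫ ω, Q₀ ω ∂P) Q₀ M := by
  ext t ω
  rw [traderPath_eq, hp.crowdPath_eq_signalPart hθ, nuHat, hp.Abar_eq hθ t.2,
    hp.Bbar_eq t.2]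
  ring

lemma Positive.continuous_signalCoef : Continuous fun t : p.Time => p.signalCoef t := by
  have h : (fun t : p.Time => p.signalCoef t) = fun t : p.Time => p.currentKernel t := by
    ext t
    rw [Positive.currentKernel_eq t.2.2]
  rw [h]
  exact hp.continuous_currentKernel.comp continuous_subtype_val

lemma Positive.continuous_signalSlope : Continuous fun t : p.Time => p.signalSlope t := by
  have h1 := hp.continuous_signalCoef
  have h2 : Continuous fun t : p.Time => p.crowdDeriv t :=
    continuous_crowdDeriv.comp continuous_subtype_val
  have h3 : Continuous fun t : p.Time => p.crowd t := continuous_crowd.comp continuous_subtype_val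
  unfold signalSlope
  exact ((h1.const_mul _).neg.sub continuous_const).sub
    ((h1.mul h2).div h3 fun t => (hp.crowd_pos t.2.2).ne')

lemma Positive.continuous_signalRatio_coe : Continuous fun t : p.Time => p.signalRatio t :=
  hp.continuous_signalRatio.comp continuous_subtype_val

omit hp in
lemma continuous_soloDeriv_coe :
    Continuous fun t : p.Time => p.soloDeriv t / p.solo 0 :=
  (continuous_soloDeriv.comp continuous_subtype_val).div_const _

lemma Positive.isProgressive_crowdPath {F : Filtration p.Time mΩ} {M : p.Time → Ω → ℝ}
    (hM : IsProgressive F M) (q : ℝ) : IsProgressive F (p.crowdPath q M) := by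
  have h1 := isProgressive_primitive ((isProgressive_deterministic F
    hp.continuous_signalRatio_coe.measurable).mul hM)
  have h2 := isProgressive_deterministic F (f := fun t : p.Time => p.crowdDeriv t)
    ((continuous_crowdDeriv (p := p)).comp continuous_subtype_val).measurable
  have h3 := isProgressive_deterministic F hp.continuous_signalCoef.measurable
  exact (h2.mul ((isProgressive_const F (q / p.crowd 0)).add h1)).add (h3.mul hM)

end Coefficients

lemma isProgressive_traderPath (hp : p.Positive) {F : Filtration p.Time mΩ}
    {M : p.Time → Ω → ℝ} {Q₀ : Ω → ℝ} (hQ₀ : Measurable Q₀) (hM : IsProgressive F M) (q : ℝ) :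
    IsProgressive (p.traderFiltration F Q₀ hQ₀) (p.traderPath q Q₀ M) := by
  have hle : F ≤ p.traderFiltration F Q₀ hQ₀ := le_sup_left
  have hQ : ∀ i, Measurable[p.traderFiltration F Q₀ hQ₀ i] Q₀ := fun i =>
    (comap_measurable Q₀).mono
      (le_sup_right : MeasurableSpace.comap Q₀ inferInstance ≤ F i ⊔ _) le_rfl
  have h1 := isProgressive_mono hle (hp.isProgressive_crowdPath hM q)
  have h2 := isProgressive_deterministic (p.traderFiltration F Q₀ hQ₀)
    continuous_soloDeriv_coe.measurable
  have h3 := isProgressive_randomVariable (fun i => (hQ i).sub_const q)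
  exact h1.add (h2.mul h3)

lemma measurable_map_affine (ρ : Measure ℝ) [SFinite ρ] (q : ℝ) :
    Measurable fun c : ℝ × ℝ => ρ.map fun x => c.1 + c.2 * (x - q) := by
  refine Measure.measurable_of_measurable_coe _ fun S hS => ?_
  have h : ∀ c : ℝ × ℝ, ρ.map (fun x => c.1 + c.2 * (x - q)) S =
      ρ (Prod.mk c ⁻¹' ((fun r : (ℝ × ℝ) × ℝ => r.1.1 + r.1.2 * (r.2 - q)) ⁻¹' S)) := fun c => by
    rw [Measure.map_apply (by fun_prop) hS]
    rfl
  simp_rw [h]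
  exact measurable_measure_prodMk_left (hS.preimage (by fun_prop))

lemma isProgressive_crowdLaw (hp : p.Positive) {F : Filtration p.Time mΩ} {M : p.Time → Ω → ℝ}
    (hM : IsProgressive F M) (q : ℝ) (ρ : Measure ℝ) [SFinite ρ] :
    IsProgressive F (p.crowdLaw q ρ M) := fun i =>
  (measurable_map_affine ρ q).comp ((hp.isProgressive_crowdPath hM q i).prodMk
    (isProgressive_deterministic F continuous_soloDeriv_coe.measurable i))

namespace SignalModel

variable {P : Measure Ω} [IsProbabilityMeasure P] {F : Filtration p.Time mΩ} {Q₀ μ : Ω → ℝ}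
  {M : p.Time → Ω → ℝ} (hp : p.Positive) (hS : SignalModel p P F Q₀ μ M)

include hS

omit [IsProbabilityMeasure P] in
lemma indep_filtration (t : p.Time) :
    Indep (MeasurableSpace.comap Q₀ inferInstance) (F t) P :=
  indep_of_indep_of_le_right hS.indep ((le_iSup (fun t => F t) t).trans le_sup_left)

omit [IsProbabilityMeasure P] in
lemma memLp (t : p.Time) : MemLp (M t) 2 P :=
  (memLp_congr_ae (hS.condExp t)).2 (hS.memLp_signal.condExp one_le_two)

/-- The trader's own inventory reveals nothing about μ. This uses that Q₀ is independent of F_t and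
μ jointly, not only of each. -/
lemma condExp_trader (t : p.Time) :
    M t =ᵐ[P] P[μ | p.traderFiltration F Q₀ hS.measurable_inventory t] := by
  refine (hS.condExp t).trans (condExp_sup_of_indep (F.le t) hS.measurable_inventory.comap_le
    hS.measurable_signal (hS.memLp_signal.integrable one_le_two) ?_).symm
  exact indep_of_indep_of_le_right hS.indep (sup_le_sup_right (le_iSup (fun t => F t) t) _)

include hp

lemma isSquareIntegrable : IsSquareIntegrable P M := by
  have hm := hp.measurable_of_isProgressive hS.progressive
  have hμ := IsSquareIntegrable.const (p := p) hS.measurable_signal hS.memLp_signal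
  refine ⟨hm, memLp_prod_of_le (Y := fun _ => μ) hm hμ.measurable hμ.memLp (Filter.Eventually.of_forall fun t => ?_)⟩
  rw [eLpNorm_congr_ae (hS.condExp t)]
  exact eLpNorm_condExp_le_eLpNorm μ one_le_two

lemma isSquareIntegrable_crowdPath (q : ℝ) : IsSquareIntegrable P (p.crowdPath q M) := by
  have hM := hS.isSquareIntegrable hp
  have h1 := (hM.deterministic_mul hp.continuous_signalRatio_coe).primitive hp
  have h2 := ((IsSquareIntegrable.const (p := p) (P := P) measurable_const
    (memLp_const (q / p.crowd 0))).add h1).deterministic_mul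
      (f := fun t => p.crowdDeriv t) (continuous_crowdDeriv.comp continuous_subtype_val)
  exact h2.add (hM.deterministic_mul hp.continuous_signalCoef)

lemma isAdmissible_traderPath (q : ℝ) :
    p.IsAdmissible P F Q₀ hS.measurable_inventory (p.traderPath q Q₀ M) where
  progressive := isProgressive_traderPath hp _ hS.progressive q
  memLp := by
    have h1 := hS.isSquareIntegrable_crowdPath hp q
    have h2 := (IsSquareIntegrable.const (p := p) (hS.measurable_inventory.sub_const q)
      (hS.memLp_inventory.sub (memLp_const q))).deterministic_mul continuous_soloDeriv_coe
    exact (h1.add h2).memLp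

omit hS [IsProbabilityMeasure P] in
lemma _root_.TraderParams.IsAdmissible.isSquareIntegrable {hQ₀ : Measurable Q₀}
    {ν : p.Time → Ω → ℝ} (h : p.IsAdmissible P F Q₀ hQ₀ ν) : IsSquareIntegrable P ν :=
  ⟨hp.measurable_of_isProgressive h.progressive, h.memLp⟩

/-- The first order condition. -/
lemma integral_gainVariation_eq_zero (q : ℝ) {h : p.Time → Ω → ℝ}
    (hh : p.IsAdmissible P F Q₀ hS.measurable_inventory h) :
    ∫ z, p.gainVariation Q₀ μ (p.crowdPath q M) (p.traderPath q Q₀ M) h z.1 z.2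
      ∂(p.timeMeasure.prod P) = 0 := by
  have hM := hS.isSquareIntegrable hp
  have hh' := hh.isSquareIntegrable hp
  have hμ := IsSquareIntegrable.const (p := p) hS.measurable_signal hS.memLp_signal
  have hν := (hS.isAdmissible_traderPath hp q).isSquareIntegrable hp
  have hV := integrable_gainVariation hp hS.measurable_inventory hS.memLp_inventory
    hS.measurable_signal hS.memLp_signal (hS.isSquareIntegrable_crowdPath hp q) hν hh'
  -- The factor of μ - M in `integral_variation`. It involves h only up to time t, so it is
  -- progressive for the trader's filtration.
  set k : p.Time → Ω → ℝ := fun t ω => (1 + 2 * p.η * p.signalSlope t) * primitive h t ω +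
    2 * p.η * p.signalCoef t * h t ω with hk
  have hc1 : Continuous fun t : p.Time => 1 + 2 * p.η * p.signalSlope t :=
    continuous_const.add (hp.continuous_signalSlope.const_mul _)
  have hc2 : Continuous fun t : p.Time => 2 * p.η * p.signalCoef t :=
    hp.continuous_signalCoef.const_mul _
  have hkS : IsSquareIntegrable P k :=
    ((hh'.primitive hp).deterministic_mul hc1).add (hh'.deterministic_mul hc2)
  have hkP : IsProgressive (p.traderFiltration F Q₀ hS.measurable_inventory) k :=
    ((isProgressive_deterministic _ hc1.measurable).mul
      (isProgressive_primitive hh.progressive)).add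
      ((isProgressive_deterministic _ hc2.measurable).mul hh.progressive)
  have hI := hkS.integrable_mul (hμ.sub hM)
  have e : ∫ z, p.gainVariation Q₀ μ (p.crowdPath q M) (p.traderPath q Q₀ M) h z.1 z.2
      ∂(p.timeMeasure.prod P) =
      ∫ z, k z.1 z.2 * (μ z.2 - M z.1 z.2) ∂(p.timeMeasure.prod P) := by
    rw [integral_prod_symm _ hV, integral_prod_symm _ hI]
    refine integral_congr_ae ?_
    filter_upwards [hM.ae_integrable, hh'.ae_integrable, hV.prod_left_ae] with ω h1 h2 h3
    have hQ : ∀ t, p.inventory Q₀ (p.traderPath q Q₀ M) t ω =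
        p.crowd t * p.crowdFactor q (fun u => M u ω) t + p.solo t / p.solo 0 * (Q₀ ω - q) :=
      fun t => hp.inventory_traderRate q (Q₀ ω) h1 t
    refine (hp.integral_variation q (Q₀ ω) (μ ω) h1 h2 (fun t => rfl) hQ h3).trans ?_
    refine integral_congr_ae (Filter.Eventually.of_forall fun t => ?_)
    simp only [hk, primitive]
    ring
  rw [e, integral_prod _ hI]
  refine integral_eq_zero_of_ae ?_
  -- At a fixed time μ - M_t is orthogonal to the square integrable k_t, which is known to the
  -- trader.
  filter_upwards [hkS.ae_memLp] with t ht
  exact integral_mul_sub_eq_zero ((p.traderFiltration F Q₀ hS.measurable_inventory).le t)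
    (hkP.adapted t) ht hS.memLp_signal (hS.memLp t) (hS.condExp_trader t)

omit hp hS in
lemma traderRate_affine (q : ℝ) (M : p.Time → ℝ) (t : p.Time) :
    (fun x => p.traderRate q x M t) =
      fun x => p.crowdRate q M t + p.soloDeriv t / p.solo 0 * (x - q) := rfl

omit hp in
lemma memLp_centered (q c : ℝ) : MemLp (fun ω => c * (Q₀ ω - q)) 2 P :=
  (hS.memLp_inventory.sub (memLp_const q)).const_mul c

omit hp in
lemma integral_centered (c : ℝ) : ∫ ω, c * (Q₀ ω - ∫ ω, Q₀ ω ∂P) ∂P = 0 := by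
  rw [integral_const_mul, integral_sub (hS.memLp_inventory.integrable one_le_two)
    (integrable_const _)]
  simp

omit hp in
lemma meanRate_crowdLaw (t : p.Time) (ω : Ω) :
    p.meanRate (p.crowdLaw (∫ ω, Q₀ ω ∂P) (P.map Q₀) M) t ω =
      p.crowdPath (∫ ω, Q₀ ω ∂P) M t ω := by
  rw [meanRate, crowdLaw, traderRate_affine, integral_map (by fun_prop) (by fun_prop),
    integral_map hS.measurable_inventory.aemeasurable (by fun_prop),
    integral_add (integrable_const _) ((hS.memLp_centered _ _).integrable one_le_two),
    hS.integral_centered]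
  simp [crowdPath]

omit hp hS [IsProbabilityMeasure P] in
lemma measurable_traderRate (q : ℝ) (M : p.Time → ℝ) (t : p.Time) :
    Measurable fun x => p.traderRate q x M t := by
  rw [traderRate_affine]
  fun_prop

omit hp in
lemma memLp_crowdLaw (q : ℝ) (t : p.Time) (ω : Ω) :
    MemLp (fun x : ℝ => x) 2 (p.crowdLaw q (P.map Q₀) M t ω) := by
  have hf := measurable_traderRate q (fun u => M u ω) t
  rw [crowdLaw, memLp_map_measure_iff (by fun_prop) hf.aemeasurable,
    memLp_map_measure_iff (by fun_prop) hS.measurable_inventory.aemeasurable]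
  have h : MemLp (fun ω' => p.crowdRate q (fun u => M u ω) t +
      p.soloDeriv t / p.solo 0 * (Q₀ ω' - q)) 2 P :=
    (memLp_const (p.crowdRate q (fun u => M u ω) t)).add (hS.memLp_centered q _)
  exact h

/-- The quadratic expansion with c = 1 around the candidate: the linear term vanishes and the
curvature is nonnegative. -/
lemma integral_runningGain_le (q : ℝ) {ν : p.Time → Ω → ℝ}
    (hν : p.IsAdmissible P F Q₀ hS.measurable_inventory ν) :
    ∫ z, p.runningGain Q₀ μ (p.crowdPath q M) ν z.1 z.2 ∂(p.timeMeasure.prod P) ≤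
      ∫ z, p.runningGain Q₀ μ (p.crowdPath q M) (p.traderPath q Q₀ M) z.1 z.2
        ∂(p.timeMeasure.prod P) := by
  have hadm := hS.isAdmissible_traderPath hp q
  have hR := hS.isSquareIntegrable_crowdPath hp q
  have hN := hadm.isSquareIntegrable hp
  have hdS := (hν.isSquareIntegrable hp).sub hN
  have hdA : p.IsAdmissible P F Q₀ hS.measurable_inventory
      (fun t ω => ν t ω - p.traderPath q Q₀ M t ω) :=
    ⟨hν.progressive.sub hadm.progressive, hdS.memLp⟩
  have h1 := integral_runningGain_add_mul hp hS.measurable_inventory hS.memLp_inventory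
    hS.measurable_signal hS.memLp_signal hR hN hdS 1
  rw [hS.integral_gainVariation_eq_zero hp q hdA] at h1
  simp only [one_mul, add_sub_cancel] at h1
  have h2 := integral_gainCurvature_ge hp hdS
  have h3 := mul_nonneg hp.η.le (integral_nonneg (μ := p.timeMeasure.prod P)
    fun z => sq_nonneg (ν z.1 z.2 - p.traderPath q Q₀ M z.1 z.2))
  rw [h1]
  linarith

/-- At time t the rate is affine in Q₀ with coefficients known from F_t, and Q₀ is independent of
F_t. -/
lemma crowdLaw_real_ae_eq (q : ℝ) (t : p.Time) {S : Set ℝ} (hms : MeasurableSet S) :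
    (fun ω => (p.crowdLaw q (P.map Q₀) M t ω).real S) =ᵐ[P]
      P[(p.traderPath q Q₀ M t ⁻¹' S).indicator (fun _ => (1 : ℝ)) | F t] := by
  have hc := condExp_comp_of_indep (F.le t) ((hp.isProgressive_crowdPath hS.progressive
    q).adapted t) hS.measurable_inventory (hS.indep_filtration t)
    (g := fun r => S.indicator (fun _ => (1 : ℝ)) (r.1 + p.soloDeriv t / p.solo 0 * (r.2 - q)))
    ((measurable_const.indicator hms).comp (by fun_prop)) (C := 1) (fun x => by
      by_cases hx : x.1 + p.soloDeriv t / p.solo 0 * (x.2 - q) ∈ S <;> simp [hx])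
  refine Filter.EventuallyEq.trans (Filter.Eventually.of_forall fun ω => ?_) hc
  have hf := measurable_traderRate q (fun u => M u ω) t
  have e : (p.crowdLaw q (P.map Q₀) M t ω).real S =
      ∫ x, ((fun x => p.traderRate q x (fun u => M u ω) t) ⁻¹' S).indicator 1 x ∂(P.map Q₀) := by
    rw [crowdLaw, map_measureReal_apply hf hms, integral_indicator_one (hf hms)]
  exact e

/-- The candidate is an equilibrium. -/
lemma isMFGEquilibrium :
    p.IsMFGEquilibrium P F Q₀ hS.measurable_inventory μ
      (p.traderPath (∫ ω, Q₀ ω ∂P) Q₀ M)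
      (p.crowdLaw (∫ ω, Q₀ ω ∂P) (P.map Q₀) M) := by
  have hQm := hS.measurable_inventory
  have hρ : IsProbabilityMeasure (P.map Q₀) := Measure.isProbabilityMeasure_map hQm.aemeasurable
  have hmean : p.meanRate (p.crowdLaw (∫ ω, Q₀ ω ∂P) (P.map Q₀) M) =
      p.crowdPath (∫ ω, Q₀ ω ∂P) M := by
    ext t ω
    exact hS.meanRate_crowdLaw t ω
  have hadm := hS.isAdmissible_traderPath hp (∫ ω, Q₀ ω ∂P)
  have hR := hS.isSquareIntegrable_crowdPath hp (∫ ω, Q₀ ω ∂P)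
  rw [← hmean] at hR
  exact {
    admissible := hadm
    isProbabilityMeasure := fun t ω =>
      Measure.isProbabilityMeasure_map (measurable_traderRate _ _ t).aemeasurable
    secondMoment := hS.memLp_crowdLaw _
    progressive := isProgressive_mono le_sup_left (isProgressive_crowdLaw hp hS.progressive _ _)
    optimal := fun ν' hν' => by
      rw [traderObjective_eq hp hQm hS.memLp_inventory hS.measurable_signal hS.memLp_signal
        (hadm.isSquareIntegrable hp) hR, traderObjective_eq hp hQm hS.memLp_inventory
        hS.measurable_signal hS.memLp_signal (hν'.isSquareIntegrable hp) hR, hmean]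
      exact hS.integral_runningGain_le hp _ hν'
    consistent := Filter.Eventually.of_forall fun t S hms => hS.crowdLaw_real_ae_eq hp _ t hms }

/-! ### Uniqueness of the equilibrium -/

omit hS in
/-- The mean rate of an equilibrium. -/
lemma _root_.TraderParams.IsMFGEquilibrium.meanRate_eq {hQ₀ : Measurable Q₀}
    {ν : p.Time → Ω → ℝ} {m : p.Time → Ω → Measure ℝ}
    (h : p.IsMFGEquilibrium P F Q₀ hQ₀ μ ν m) :
    ∀ᵐ t ∂p.timeMeasure, p.meanRate m t =ᵐ[P] P[ν t | F t] := by
  have hν := h.admissible.isSquareIntegrable hp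
  filter_upwards [hν.ae_memLp, h.consistent] with t ht hc
  exact integral_ae_eq_condExp (F.le t) (hν.measurable.comp measurable_prodMk_left)
    (ht.integrable one_le_two) (h.isProbabilityMeasure t) hc

omit hS in
lemma _root_.TraderParams.IsMFGEquilibrium.isSquareIntegrable_meanRate {hQ₀ : Measurable Q₀}
    {ν : p.Time → Ω → ℝ} {m : p.Time → Ω → Measure ℝ}
    (h : p.IsMFGEquilibrium P F Q₀ hQ₀ μ ν m) : IsSquareIntegrable P (p.meanRate m) := by
  have hν := h.admissible.isSquareIntegrable hp
  have hm : Measurable fun z : p.Time × Ω => p.meanRate m z.1 z.2 := by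
    -- A progressive process of probability measures is a kernel, so its mean is jointly measurable.
    let κ : Kernel (p.Time × Ω) ℝ :=
      ⟨fun z => m z.1 z.2, hp.measurable_of_isProgressive h.progressive⟩
    have : IsMarkovKernel κ := ⟨fun z => h.isProbabilityMeasure z.1 z.2⟩
    exact (StronglyMeasurable.integral_kernel (κ := κ) stronglyMeasurable_id).measurable
  refine ⟨hm, memLp_prod_of_le hm hν.measurable hν.memLp ?_⟩
  filter_upwards [h.meanRate_eq hp] with t ht
  rw [eLpNorm_congr_ae ht]
  exact eLpNorm_condExp_le_eLpNorm _ one_le_two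

/-- An optimal control satisfies the first order condition. -/
lemma gainVariation_eq_zero_of_equilibrium {ν h : p.Time → Ω → ℝ} {m : p.Time → Ω → Measure ℝ}
    (he : p.IsMFGEquilibrium P F Q₀ hS.measurable_inventory μ ν m)
    (hh : p.IsAdmissible P F Q₀ hS.measurable_inventory h) :
    ∫ z, p.gainVariation Q₀ μ (p.meanRate m) ν h z.1 z.2 ∂(p.timeMeasure.prod P) = 0 := by
  have hQm := hS.measurable_inventory
  have hR := he.isSquareIntegrable_meanRate hp
  have hν := he.admissible.isSquareIntegrable hp
  have hhS := hh.isSquareIntegrable hp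
  set V := ∫ z, p.gainVariation Q₀ μ (p.meanRate m) ν h z.1 z.2 ∂(p.timeMeasure.prod P)
  set K := ∫ z, p.gainCurvature h z.1 z.2 ∂(p.timeMeasure.prod P) with hK
  have key : ∀ c : ℝ, c * V ≤ c ^ 2 * K := fun c => by
    have hadm : p.IsAdmissible P F Q₀ hQm fun t ω => ν t ω + c * h t ω :=
      ⟨he.admissible.progressive.add ((isProgressive_const _ c).mul hh.progressive),
        (hν.add (hhS.const_mul c)).memLp⟩
    have h1 := he.optimal _ hadm
    rw [traderObjective_eq hp hQm hS.memLp_inventory hS.measurable_signal hS.memLp_signal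
      (hadm.isSquareIntegrable hp) hR, traderObjective_eq hp hQm hS.memLp_inventory
      hS.measurable_signal hS.memLp_signal hν hR, integral_runningGain_add_mul hp hQm
      hS.memLp_inventory hS.measurable_signal hS.memLp_signal hR hν hhS c] at h1
    linarith
  have hK0 : 0 ≤ K := by
    refine le_trans (mul_nonneg hp.η.le (integral_nonneg fun z => sq_nonneg _))
      (integral_gainCurvature_ge hp hhS)
  -- K may vanish, hence K + 1. The inequality becomes V²(K + 1) ≤ V²K, which forces V = 0.
  have h1 := key (V / (K + 1))
  have hK1 : 0 < K + 1 := by linarith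
  rw [div_pow, div_mul_eq_mul_div, div_mul_eq_mul_div, div_le_div_iff₀ hK1 (by positivity)] at h1
  have h2 : V ^ 2 * (K + 1) ≤ 0 := by
    have : (K + 1) * (V ^ 2 * (K + 1)) ≤ (K + 1) * 0 := by nlinarith
    exact le_of_mul_le_mul_left this hK1
  have h3 : V ^ 2 ≤ 0 := by
    by_contra hV
    push Not at hV
    nlinarith [mul_pos hV hK1]
  exact pow_eq_zero_iff two_ne_zero |>.1 (le_antisymm h3 (sq_nonneg V))

omit hS in
lemma _root_.TraderParams.Positive.b_mul_T_lt (hθ : p.b * p.opBound < 1) : p.b * p.T < p.η := by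
  have h1 := mul_lt_mul_of_pos_left hp.T_lt_opBound hp.b
  have h2 := mul_lt_mul_of_pos_right hθ hp.η
  linarith

/-- Two equilibria have the same control. -/
lemma control_unique (hθ : p.b * p.opBound < 1) {ν ν' : p.Time → Ω → ℝ}
    {m m' : p.Time → Ω → Measure ℝ}
    (he : p.IsMFGEquilibrium P F Q₀ hS.measurable_inventory μ ν m)
    (he' : p.IsMFGEquilibrium P F Q₀ hS.measurable_inventory μ ν' m') :
    ∀ᵐ t ∂p.timeMeasure, ν t =ᵐ[P] ν' t := by
  have hQm := hS.measurable_inventory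
  have hT := hp.T
  have hR := he.isSquareIntegrable_meanRate hp
  have hR' := he'.isSquareIntegrable_meanRate hp
  have hν := he.admissible.isSquareIntegrable hp
  have hν' := he'.admissible.isSquareIntegrable hp
  set d : p.Time → Ω → ℝ := fun t ω => ν t ω - ν' t ω with hd
  set r : p.Time → Ω → ℝ := fun t ω => p.meanRate m t ω - p.meanRate m' t ω with hr
  have hdS : IsSquareIntegrable P d := hν.sub hν'
  have hrS : IsSquareIntegrable P r := hR.sub hR'
  have hDS := hdS.primitive hp
  have hdA : p.IsAdmissible P F Q₀ hQm d :=
    ⟨he.admissible.progressive.sub he'.admissible.progressive, hdS.memLp⟩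
  -- r_t is the conditional expectation of d_t, a contraction in L².
  have hrd : ∀ᵐ t ∂p.timeMeasure, eLpNorm (r t) 2 P ≤ eLpNorm (d t) 2 P := by
    filter_upwards [he.meanRate_eq hp, he'.meanRate_eq hp, hν.ae_memLp, hν'.ae_memLp]
      with t h1 h2 h3 h4
    have h5 : r t =ᵐ[P] P[d t | F t] := (h1.sub h2).trans
      (condExp_sub (h3.integrable one_le_two) (h4.integrable one_le_two) (F t)).symm
    rw [eLpNorm_congr_ae h5]
    exact eLpNorm_condExp_le_eLpNorm _ one_le_two
  have hr2 : ∫ z, r z.1 z.2 ^ 2 ∂(p.timeMeasure.prod P) ≤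
      1 * ∫ z, d z.1 z.2 ^ 2 ∂(p.timeMeasure.prod P) := by
    refine integral_sq_le_of_sq_eLpNorm_le hrS.memLp.1 hdS.memLp zero_le_one ?_
    rw [ENNReal.ofReal_one, one_mul]
    exact pow_le_pow_left₀ zero_le (eLpNorm_prod_le hrS.measurable hdS.measurable hrd) 2
  have hD2 : ∫ z, primitive d z.1 z.2 ^ 2 ∂(p.timeMeasure.prod P) ≤
      p.T ^ 2 * ∫ z, d z.1 z.2 ^ 2 ∂(p.timeMeasure.prod P) := by
    refine integral_sq_le_of_sq_eLpNorm_le hDS.memLp.1 hdS.memLp (sq_nonneg _) ?_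
    rw [ENNReal.ofReal_pow hT.le, ← hp.timeMeasure_univ]
    exact sq_eLpNorm_prod_primitive_le hdS.measurable hDS.measurable
  have hV := hS.gainVariation_eq_zero_of_equilibrium hp he hdA
  have hV' := hS.gainVariation_eq_zero_of_equilibrium hp he' hdA
  have hVi := integrable_gainVariation hp hQm hS.memLp_inventory hS.measurable_signal
    hS.memLp_signal hR hν hdS
  have hVi' := integrable_gainVariation hp hQm hS.memLp_inventory hS.measurable_signal
    hS.memLp_signal hR' hν' hdS
  have hDr := (hDS.integrable_mul hrS).const_mul p.b
  have hCi := (integrable_gainCurvature hp hdS).const_mul 2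
  -- In the difference of the two first order conditions in the direction d, μ and Q₀ drop out; the
  -- rest is bDr minus twice the curvature of d.
  have hbal : p.b * ∫ z, primitive d z.1 z.2 * r z.1 z.2 ∂(p.timeMeasure.prod P) =
      2 * ∫ z, p.gainCurvature d z.1 z.2 ∂(p.timeMeasure.prod P) := by
    have h0 := integral_sub hVi hVi'
    rw [hV, hV', sub_zero] at h0
    rw [← sub_eq_zero, ← integral_const_mul, ← integral_const_mul, ← integral_sub hDr hCi]
    refine Eq.trans (integral_congr_ae ?_) h0
    have hlin := hν'.primitive_add_mul hdS 1
    filter_upwards [ae_prod_of_ae_snd hlin] with z hz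
    have e : (fun t ω => ν' t ω + 1 * d t ω) = ν := by
      ext t ω
      simp [hd]
    rw [e] at hz
    simp only [gainVariation, gainCurvature, inventory_eq, hz]
    simp only [hd, hr]
    ring
  have hcurv := integral_gainCurvature_ge hp hdS
  -- The weight T in Young's inequality balances ‖D‖ ≤ T‖d‖ against ‖r‖ ≤ ‖d‖, giving the bound
  -- T‖d‖².
  have hyoung : ∫ z, primitive d z.1 z.2 * r z.1 z.2 ∂(p.timeMeasure.prod P) ≤
      (2 * p.T)⁻¹ * ∫ z, primitive d z.1 z.2 ^ 2 ∂(p.timeMeasure.prod P) +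
        p.T / 2 * ∫ z, r z.1 z.2 ^ 2 ∂(p.timeMeasure.prod P) := by
    have h1 := hDS.memLp.integrable_sq.const_mul (2 * p.T)⁻¹
    have h2 := hrS.memLp.integrable_sq.const_mul (p.T / 2)
    rw [← integral_const_mul, ← integral_const_mul, ← integral_add h1 h2]
    refine integral_mono (hDS.integrable_mul hrS) (h1.add h2) fun z => ?_
    have e : (2 * p.T)⁻¹ * primitive d z.1 z.2 ^ 2 + p.T / 2 * r z.1 z.2 ^ 2 -
      primitive d z.1 z.2 * r z.1 z.2 =
      (2 * p.T)⁻¹ * (primitive d z.1 z.2 - p.T * r z.1 z.2) ^ 2 := by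
        field_simp
        ring
    have h3 : 0 ≤ (2 * p.T)⁻¹ * (primitive d z.1 z.2 - p.T * r z.1 z.2) ^ 2 := by positivity
    linarith
  set N := ∫ z, d z.1 z.2 ^ 2 ∂(p.timeMeasure.prod P) with hN
  have hN0 : 0 ≤ N := integral_nonneg fun z => sq_nonneg _
  have h1 : ∫ z, primitive d z.1 z.2 * r z.1 z.2 ∂(p.timeMeasure.prod P) ≤ p.T * N := by
    refine hyoung.trans ?_
    have h2 : (2 * p.T)⁻¹ * ∫ z, primitive d z.1 z.2 ^ 2 ∂(p.timeMeasure.prod P) ≤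
      (2 * p.T)⁻¹ * (p.T ^ 2 * N) := mul_le_mul_of_nonneg_left hD2 (by positivity)
    have h3 : p.T / 2 * ∫ z, r z.1 z.2 ^ 2 ∂(p.timeMeasure.prod P) ≤ p.T / 2 * (1 * N) :=
      mul_le_mul_of_nonneg_left hr2 (by positivity)
    have e : (2 * p.T)⁻¹ * (p.T ^ 2 * N) = p.T / 2 * N := by field_simp
    linarith
  have h2 := mul_le_mul_of_nonneg_left h1 hp.b.le
  have hbT := hp.b_mul_T_lt hθ
  have hN1 : N ≤ 0 := by
    -- Altogether 2ηN ≤ bTN, and bT < η excludes N > 0.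
    by_contra hN1
    push Not at hN1
    have h3 := mul_lt_mul_of_pos_right hbT hN1
    have h4 := mul_pos hp.η hN1
    have h5 : p.b * (p.T * N) = p.b * p.T * N := by ring
    linarith
  have hzero : (fun z : p.Time × Ω => d z.1 z.2 ^ 2) =ᵐ[p.timeMeasure.prod P] 0 :=
    (integral_eq_zero_iff_of_nonneg (fun z => sq_nonneg _) hdS.memLp.integrable_sq).1
      (le_antisymm hN1 hN0)
  filter_upwards [Measure.ae_ae_of_ae_prod hzero] with t ht
  filter_upwards [ht] with ω hω
  exact sub_eq_zero.1 (pow_eq_zero_iff two_ne_zero |>.1 hω)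

/-! ### Conditional moments of the equilibrium control -/

lemma memLp_crowdPath (q : ℝ) (t : p.Time) : MemLp (p.crowdPath q M t) 2 P := by
  have hR := (hS.isSquareIntegrable hp).deterministic_mul hp.continuous_signalRatio_coe
  have h1 := memLp_primitive hR.measurable t
    ((hR.primitive hp).measurable.comp measurable_prodMk_left) hR.memLp
  have h2 : MemLp (fun ω => p.crowdDeriv t * (q / p.crowd 0 +
      primitive (fun u ω => p.signalRatio u * M u ω) t ω)) 2 P :=
    ((memLp_const (q / p.crowd 0)).add h1).const_mul (p.crowdDeriv t)
  have h3 : MemLp (fun ω => p.crowdDeriv t * (q / p.crowd 0 +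
      primitive (fun u ω => p.signalRatio u * M u ω) t ω) + p.signalCoef t * M t ω) 2 P :=
    h2.add ((hS.memLp t).const_mul (p.signalCoef t))
  exact h3

lemma memLp_traderPath (q : ℝ) (t : p.Time) : MemLp (p.traderPath q Q₀ M t) 2 P := by
  have h : MemLp (fun ω => p.crowdPath q M t ω + p.soloDeriv t / p.solo 0 * (Q₀ ω - q)) 2 P :=
    (hS.memLp_crowdPath hp q t).add (hS.memLp_centered q _)
  exact h

omit hp in
lemma condExp_inventory {g : ℝ → ℝ} (hg : Measurable g) (t : p.Time) :
    P[fun ω => g (Q₀ ω) | F t] =ᵐ[P] fun _ => ∫ ω, g (Q₀ ω) ∂P :=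
  condExp_indep_eq hS.measurable_inventory.comap_le (F.le t)
    (hg.comp (comap_measurable Q₀)).stronglyMeasurable (hS.indep_filtration t)

lemma condExp_traderPath (t : p.Time) :
    P[p.traderPath (∫ ω, Q₀ ω ∂P) Q₀ M t | F t] =ᵐ[P]
      p.crowdPath (∫ ω, Q₀ ω ∂P) M t := by
  set q := ∫ ω, Q₀ ω ∂P with hq
  have hi := hS.memLp_inventory.integrable one_le_two
  have hX := ((hp.isProgressive_crowdPath hS.progressive q).adapted t).stronglyMeasurable
  have hXi := (hS.memLp_crowdPath hp q t).integrable one_le_two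
  have h1 := hS.condExp_inventory (g := fun x => p.soloDeriv t / p.solo 0 * (x - q))
    (by fun_prop) t
  have h2 : ∫ ω, p.soloDeriv t / p.solo 0 * (Q₀ ω - q) ∂P = 0 := hS.integral_centered _
  have hYi : Integrable (fun ω => p.soloDeriv t / p.solo 0 * (Q₀ ω - q)) P :=
    (hS.memLp_centered q _).integrable one_le_two
  refine (condExp_add hXi hYi (F t)).trans ?_
  rw [condExp_of_stronglyMeasurable (F.le t) hX hXi]
  filter_upwards [h1] with ω hω
  rw [Pi.add_apply]
  refine (congrArg _ (hω.trans h2)).trans (add_zero _)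

/-- In the expanded square the cross term has conditional mean zero, since Q₀ - E[Q₀] is centered
and independent of F_t. The last term contributes the variance of Q₀. -/
lemma condExp_sq_traderPath (t : p.Time) :
    P[fun ω => p.traderPath (∫ ω, Q₀ ω ∂P) Q₀ M t ω ^ 2 | F t] =ᵐ[P]
      fun ω => p.crowdPath (∫ ω, Q₀ ω ∂P) M t ω ^ 2 +
        (p.soloDeriv t / p.solo 0) ^ 2 * (∫ ω, Q₀ ω ^ 2 ∂P - (∫ ω, Q₀ ω ∂P) ^ 2) := by
  set q := ∫ ω, Q₀ ω ∂P with hq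
  set z := p.soloDeriv t / p.solo 0 with hz
  have hi := hS.memLp_inventory.integrable one_le_two
  have hX := ((hp.isProgressive_crowdPath hS.progressive q).adapted t).stronglyMeasurable
  have hXL := hS.memLp_crowdPath hp q t
  have hYL := hS.memLp_centered q z
  set X := p.crowdPath q M t with hXdef
  have h1 := hS.condExp_inventory (g := fun x => z * (x - q)) (by fun_prop) t
  have h2 := hS.condExp_inventory (g := fun x => (z * (x - q)) ^ 2) (by fun_prop) t
  have e1 : ∫ ω, z * (Q₀ ω - q) ∂P = 0 := hS.integral_centered z
  have e2 : ∫ ω, (z * (Q₀ ω - q)) ^ 2 ∂P = z ^ 2 * (∫ ω, Q₀ ω ^ 2 ∂P - q ^ 2) := by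
    have h3 : ∀ ω, (z * (Q₀ ω - q)) ^ 2 = z ^ 2 * (Q₀ ω ^ 2 - (2 * q * Q₀ ω - q ^ 2)) :=
      fun ω => by ring
    have h4 : Integrable (fun ω => 2 * q * Q₀ ω - q ^ 2) P :=
      (hi.const_mul (2 * q)).sub (integrable_const (q ^ 2))
    simp only [h3]
    rw [integral_const_mul, integral_sub hS.memLp_inventory.integrable_sq h4,
      integral_sub (hi.const_mul (2 * q)) (integrable_const _), integral_const_mul]
    simp only [← hq, integral_const, probReal_univ, one_smul]
    ring
  have i1 : Integrable (fun ω => X ω ^ 2) P := hXL.integrable_sq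
  have i2 : Integrable ((fun ω => 2 * X ω) * fun ω => z * (Q₀ ω - q)) P :=
    (hXL.const_mul 2).integrable_mul hYL
  have i3 : Integrable (fun ω => (z * (Q₀ ω - q)) ^ 2) P := hYL.integrable_sq
  have hexp : (fun ω => p.traderPath q Q₀ M t ω ^ 2) =
      ((fun ω => X ω ^ 2) + (fun ω => 2 * X ω) * fun ω => z * (Q₀ ω - q)) +
        fun ω => (z * (Q₀ ω - q)) ^ 2 := by
    ext ω
    simp only [traderPath_eq, Pi.add_apply, Pi.mul_apply]
    ring
  have c1 : P[fun ω => X ω ^ 2 | F t] = fun ω => X ω ^ 2 :=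
    condExp_of_stronglyMeasurable (F.le t) (hX.pow 2) i1
  have c2 := condExp_mul_of_stronglyMeasurable_left (hX.const_mul 2) i2
    (hYL.integrable one_le_two)
  rw [hexp]
  filter_upwards [condExp_add (i1.add i2) i3 (F t), condExp_add i1 i2 (F t), c2, h1, h2]
    with ω a1 a2 a3 a4 a5
  rw [a1, Pi.add_apply, a2, Pi.add_apply, a3, Pi.mul_apply, a4, a5, c1, e1, e2]
  ring

end SignalModel

end TraderParams

end

theorem lemma4p1 (p : TraderParams) (ha : 0 < p.a) (hφ : 0 < p.φ) (hη : 0 < p.η) (hT : 0 < p.T)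
    (hb : 0 < p.b)
    (hb_small : p.b < Real.exp (-(2 * p.T * (max p.a (Real.sqrt (p.η * p.φ)) / p.η))) *
      (min (min (p.η ^ 2 * p.a⁻¹) (p.η ^ (3 / 2 : ℝ) * p.φ ^ (-(1 / 2) : ℝ))) p.η /
        (p.T ^ 2 + p.T))) :
    ∃ γ : ℝ → ℝ,
      -- the Riccati equation has a unique solution on `[0, T]`
      p.IsRiccatiSolution γ ∧
      (∀ γ', p.IsRiccatiSolution γ' → Set.EqOn γ' γ (Set.Icc 0 p.T)) ∧
      -- the series that define the coefficients converge, and `(I - bL)⁻¹ z` is what it should be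
      (∀ t ∈ Set.Icc 0 p.T, Summable fun k : ℕ => p.b ^ k * ((p.opL γ)^[k] (p.zCoef γ)) t) ∧
      (∀ s ∈ Set.Icc 0 p.T, ∀ t ∈ Set.Icc 0 p.T,
        Summable fun k : ℕ => p.b ^ k * p.LhatIter₁ γ k s t) ∧
      (∀ t ∈ Set.Icc 0 p.T, Summable fun k : ℕ => p.b ^ k * p.LhatIter₂ γ k t) ∧
      ContinuousOn (p.resolventZ γ) (Set.Icc 0 p.T) ∧
      (∀ t ∈ Set.Icc 0 p.T,
        p.resolventZ γ t - p.b * p.opL γ (p.resolventZ γ) t = p.zCoef γ t) ∧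
      -- the coefficients are analytic
      AnalyticOn ℝ (p.Abar γ) (Set.Icc 0 p.T) ∧
      AnalyticOn ℝ (p.Bbar γ) (Set.Icc 0 p.T) ∧
      AnalyticOn ℝ (fun q : ℝ × ℝ => p.Cbar γ q.1 q.2) (Set.Icc 0 p.T ×ˢ Set.Icc 0 p.T) ∧
      AnalyticOn ℝ (p.Dbar γ) (Set.Icc 0 p.T) ∧
      -- for every filtration and every martingale `M t = E[μ | F t]`
      ∀ {Ω : Type*} {mΩ : MeasurableSpace Ω} (P : Measure Ω) [IsProbabilityMeasure P]
        (F : Filtration p.Time mΩ) (Q₀ : Ω → ℝ) (hQ₀ : Measurable Q₀) (μ : Ω → ℝ)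
        (M : p.Time → Ω → ℝ),
        MemLp Q₀ 2 P → Measurable μ → MemLp μ 2 P →
        Indep (MeasurableSpace.comap Q₀ inferInstance)
          ((⨆ t, F t) ⊔ MeasurableSpace.comap μ inferInstance) P →
        Martingale M F P → IsProgressive F M → (∀ t, M t =ᵐ[P] P[μ | F t]) →
        -- existence of an equilibrium with control `nuHat`
        (∃ m, p.IsMFGEquilibrium P F Q₀ hQ₀ μ (p.nuHat γ P Q₀ M) m) ∧
        -- every equilibrium has this control, and the mean rate given below
        (∀ ν m, p.IsMFGEquilibrium P F Q₀ hQ₀ μ ν m →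
          ∀ᵐ t ∂p.timeMeasure, ν t =ᵐ[P] p.nuHat γ P Q₀ M t ∧
            p.meanRate m t =ᵐ[P] fun ω =>
              (p.Abar γ t + p.Bbar γ t) * P[Q₀] + p.signalPart γ M t ω) ∧
        -- uniqueness of the flow of conditional laws
        (∀ ν m ν' m', p.IsMFGEquilibrium P F Q₀ hQ₀ μ ν m →
          p.IsMFGEquilibrium P F Q₀ hQ₀ μ ν' m' → ∀ᵐ t ∂p.timeMeasure, m t =ᵐ[P] m' t) ∧
        -- the conditional first and second moments
        (∀ t, MemLp (p.nuHat γ P Q₀ M t) 2 P ∧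
          P[p.nuHat γ P Q₀ M t | F t] =ᵐ[P] (fun ω =>
            (p.Abar γ t + p.Bbar γ t) * P[Q₀] + p.signalPart γ M t ω) ∧
          P[fun ω => p.nuHat γ P Q₀ M t ω ^ 2 | F t] =ᵐ[P] (fun ω =>
            (p.Abar γ t ^ 2 + 2 * p.Abar γ t * p.Bbar γ t) * P[Q₀] ^ 2 +
              p.Bbar γ t ^ 2 * P[fun ω' => Q₀ ω' ^ 2] +
              2 * (p.Abar γ t + p.Bbar γ t) * p.signalPart γ M t ω * P[Q₀] +
              p.signalPart γ M t ω ^ 2)) := by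

  have hp : p.Positive := ⟨ha, hφ, hη, hb, hT⟩
  have hθ := TraderParams.b_mul_opBound_lt_one hp hb_small
  refine ⟨p.riccatiSol, hp.isRiccatiSolution, fun γ' h => hp.isRiccatiSolution.eqOn h,
    fun t ht => (hp.hasSum_resolventZ hθ ht).summable,
    fun s hs t ht => (hp.hasSum_LhatIter₁ hθ hs ht).summable,
    fun t ht => (hp.hasSum_LhatIter₂ hθ ht).summable, ?_,
    fun t ht => hp.resolventZ_sub hθ ht, hp.analyticOn_Abar hθ, hp.analyticOn_Bbar, hp.analyticOn_Cbar hθ, hp.analyticOn_Dbar hθ, ?_⟩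
  · exact (TraderParams.continuous_crowdDeriv.div_const _).continuousOn.congr
      fun t ht => hp.resolventZ_eq hθ ht
  intro Ω mΩ P _ F Q₀ hQ₀ μ M hQ₀' hμ hμ' hind _ hM hMμ
  have hS : p.SignalModel P F Q₀ μ M := ⟨hQ₀, hQ₀', hμ, hμ', hind, hM, hMμ⟩
  rw [hp.nuHat_eq hθ]
  have hX : ∀ t : p.Time, p.crowdPath (∫ ω, Q₀ ω ∂P) M t = fun ω =>
      (p.Abar p.riccatiSol t + p.Bbar p.riccatiSol t) * P[Q₀] + p.signalPart p.riccatiSol M t ω :=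
    fun t => funext fun ω => hp.crowdPath_eq_signalPart hθ _ M t ω
  have he := hS.isMFGEquilibrium hp
  refine ⟨⟨_, he⟩, fun ν m h => ?_, fun ν m ν' m' h h' => ?_, fun t => ⟨?_, ?_, ?_⟩⟩
  · filter_upwards [hS.control_unique hp hθ h he, h.meanRate_eq hp] with t h1 h2
    refine ⟨h1, ?_⟩
    rw [← hX t]
    exact (h2.trans (condExp_congr_ae h1)).trans (hS.condExp_traderPath hp t)
  · have hν := h.admissible.isSquareIntegrable hp
    have hν' := h'.admissible.isSquareIntegrable hp
    filter_upwards [hS.control_unique hp hθ h h', h.consistent, h'.consistent] with t h1 h2 h3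
    exact ae_eq_of_condLaw (F.le t) (hν.measurable.comp measurable_prodMk_left) h1
      (h.isProbabilityMeasure t) (h'.isProbabilityMeasure t) h2 h3
  · exact hS.memLp_traderPath hp _ t
  · rw [← hX t]
    exact hS.condExp_traderPath hp t
  -- The square of (Ā + B̄)E[Q₀] + X contains B̄²E[Q₀]², which the variance term removes.
  · refine (hS.condExp_sq_traderPath hp t).trans (Filter.Eventually.of_forall fun ω => ?_)
    have hz : p.soloDeriv t / p.solo 0 = p.Bbar p.riccatiSol t := (hp.Bbar_eq t.2).symm
    simp only [hX, hz]
    ring
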